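/- **Setting.** Let $\mathcal S,\mathcal A$ be measurable spaces, $\phi:\mathcal S\times\mathcal A\to\mathbb R^{d_\phi}$ measurable, $\Theta^*\in\mathbb R^{d_x\times d_\phi}$. The data $(x_t,s_t,a_{t0},a_{t1},y_t)$, $t\in[N_0]$, $N_0\ge1$, are i.i.d.; $(x_t,s_t,a_{t0},a_{t1})\sim P$ with $x_t\in\mathbb R^{d_x}$, and $y_t\in\{0,1\}$ follows the Bradley–Terry–Luce model $$\mathbb P(y_t=1\mid x_t,s_t,a_{t0},a_{t1})=\frac{\exp(x_t^\top\Theta^*\phi(s_t,a_{t1}))}{\exp(x_t^\top\Theta^*\phi(s_t,a_{t0}))+\exp(x_t^\top\Theta^*\phi(s_t,a_{t1}))}.$$ Put $\psi_t=\phi(s_t,a_{t1})-\phi(s_t,a_{t0})$, $z_t=\psi_t\otimes x_t$, and let $$\mathcal L(\Theta)=\frac1{N_0}\sum_{t=1}^{N_0}\Big(\log\big(1+e^{-x_t^\top\Theta\psi_t}\big)+(1-y_t)\,x_t^\top\Theta\psi_t\Big)$$ be the negative log-likelihood. **Assumptions.** $\|x_t\|_2\le B_x$ almost surely; $\|\phi(s,a)\|_2\le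 B_\phi$ for all $s,a$; $\|\Theta\|_F\le B_\theta$ whenever $\|\Theta-\Theta^*\|_F\le1$; and $\Sigma=\mathbb E_P\,z_tz_t^\top$ is positive definite, with $\Sigma\succeq\lambda I$, $\lambda>0$. The matrix $\Theta^*$ has rank $r\ge1$ and singular values $\sigma_1\ge\dots\ge\sigma_r>0$. **Algorithm (factored gradient descent).** Given $\Theta_0$ with singular value decomposition $\Theta_0=U_0D_0V_0^\top$, let $U^{(0)}\in\mathbb R^{d_x\times r}$ and $V^{(0)}\in\mathbb R^{d_\phi\times r}$ consist of the first $r$ columns of $U_0$ and $V_0$, each column multiplied by the square root of the corresponding (non-increasingly ordered) singular value. With $\tilde{\mathcal L}(U,V)=\mathcal L(UV^\top)+\frac18\|U^\top U-V^\top V\|_F^2$, iterate $$U^{(k+1)}=U^{(k)}-\eta\nabla_U\tilde{\mathcal L}(U^{(k)},V^{(k)}),\qquad V^{(k+1)}=V^{(k)}-\eta\nabla_V\tilde{\mathcal L}(U^{(k+1)},V^{(k)}),$$ and put $\Theta^{(k)}=U^{(k)}(V^{(k)})^\top$. **Theorem (Estimation Bound).** For all $B_x,B_\phi,B_\theta,\lambda>0$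 there are constants $\bar c_1,\kappa,C_0,C_1>0$, depending only on $B_x,B_\phi,B_\theta,\lambda$, such that the following holds in every setting as above, for every $\delta\in(0,1)$, every $c_1\in(0,\bar c_1]$ and every $c_2\in(0,\kappa\sqrt{\sigma_r}\,]$. There is a number of iterations $K$ (not depending on the realized data or on $\Theta_0$) such that, with probability at least $1-\delta$, for every initial estimate $\Theta_0$ (which may depend on the data) with $\|\Theta_0-\Theta^*\|_F\le c_2\sqrt{\sigma_r}$, the algorithm run with step size $\eta=c_1/\sigma_1$ yields $\hat\Theta=\Theta^{(K)}$ with $$\|\hat\Theta-\Theta^*\|_F\le C_1\sqrt{\frac{\sigma_1\,r\,\log\frac{d_x+d_\phi}{\delta}}{\sigma_r\,N_0}},$$ and, if in addition $N_0\ge C_0\,r\log\big(\frac{d_x+d_\phi}{\delta}\big)/\sigma_r^2$, the same bound holds on the same event for $\hat\Theta=\Theta^{(k)}$ simultaneously for all $k\ge K$ (hence for any limit of the iterates). -/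

import Mathlib

open MeasureTheory ProbabilityTheory
open scoped Matrix

attribute [local instance] Matrix.frobeniusNormedAddCommGroup

/-- The `m × n` matrix with diagonal entries `s 0, s 1, …` and zeros elsewhere. -/
def rectDiag (m n : ℕ) (s : ℕ → ℝ) : Matrix (Fin m) (Fin n) ℝ :=
  Matrix.of fun i j => if (i : ℕ) = (j : ℕ) then s i else 0

/-- `M = U D Vᵀ` is a singular value decomposition: `U`, `V` are square orthogonal matrices and
`D` is the rectangular diagonal matrix of the singular values `s 0 ≥ s 1 ≥ … ≥ 0`. -/
structure IsSVD {m n : ℕ} (M : Matrix (Fin m) (Fin n) ℝ) (U : Matrix (Fin m) (Fin m) ℝ)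
    (s : ℕ → ℝ) (V : Matrix (Fin n) (Fin n) ℝ) : Prop where
  left_orthogonal : U ∈ Matrix.orthogonalGroup (Fin m) ℝ
  right_orthogonal : V ∈ Matrix.orthogonalGroup (Fin n) ℝ
  antitone : Antitone s
  nonneg : ∀ i, 0 ≤ s i
  eq_zero : ∀ i, min m n ≤ i → s i = 0
  eq_mul : M = U * rectDiag m n s * Vᵀ

/-- One comparison `(x, s, a₀, a₁)`: context, state, and the two actions. -/
abbrev Query (dx : ℕ) (S A : Type*) : Type _ := EuclideanSpace ℝ (Fin dx) × S × A × A

section Model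

variable {dx dφ : ℕ} {S A : Type*}

/-- The bilinear reward `xᵀ Θ φ(s, a)`. -/
noncomputable def reward (φ : S → A → EuclideanSpace ℝ (Fin dφ))
    (Θ : Matrix (Fin dx) (Fin dφ) ℝ) (x : EuclideanSpace ℝ (Fin dx)) (s : S) (a : A) : ℝ :=
  x.ofLp ⬝ᵥ (Θ *ᵥ (φ s a).ofLp)

/-- The Bradley-Terry-Luce probability that `a₁` is preferred to `a₀`. -/
noncomputable def btlProb (φ : S → A → EuclideanSpace ℝ (Fin dφ))
    (Θ : Matrix (Fin dx) (Fin dφ) ℝ) (w : Query dx S A) : ℝ :=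
  Real.exp (reward φ Θ w.1 w.2.1 w.2.2.2) /
    (Real.exp (reward φ Θ w.1 w.2.1 w.2.2.1) + Real.exp (reward φ Θ w.1 w.2.1 w.2.2.2))

/-- The vector `z = (φ(s, a₁) - φ(s, a₀)) ⊗ x`. -/
noncomputable def featureVec (φ : S → A → EuclideanSpace ℝ (Fin dφ)) (w : Query dx S A) :
    Fin dφ × Fin dx → ℝ :=
  fun p => (φ w.2.1 w.2.2.2 - φ w.2.1 w.2.2.1) p.1 * w.1 p.2

/-- The second moment matrix `𝔼_P z zᵀ`. -/
noncomputable def secondMoment [MeasurableSpace S] [MeasurableSpace A]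
    (φ : S → A → EuclideanSpace ℝ (Fin dφ)) (P : Measure (Query dx S A)) :
    Matrix (Fin dφ × Fin dx) (Fin dφ × Fin dx) ℝ :=
  Matrix.of fun p q => ∫ w, featureVec φ w p * featureVec φ w q ∂P

/-- `(W t, y t)`, `t < N`, are i.i.d.; `W t` has law `P`, and given `W t` the label `y t` is `true`
(that is, `a₁` is preferred) with the Bradley-Terry-Luce probability for the parameter `Θ`. -/
structure IsBTLData [MeasurableSpace S] [MeasurableSpace A] {Ω : Type*} [MeasurableSpace Ω]
    (μ : Measure Ω) (P : Measure (Query dx S A)) (φ : S → A → EuclideanSpace ℝ (Fin dφ))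
    (Θ : Matrix (Fin dx) (Fin dφ) ℝ) {N : ℕ} (W : Fin N → Ω → Query dx S A)
    (y : Fin N → Ω → Bool) : Prop where
  measurable_query : ∀ t, Measurable (W t)
  measurable_label : ∀ t, Measurable (y t)
  indep : iIndepFun (fun t ω => (W t ω, y t ω)) μ
  law : ∀ t, μ.map (W t) = P
  label : ∀ t, ∀ B : Set (Query dx S A), MeasurableSet B →
    μ {ω | W t ω ∈ B ∧ y t ω = true} = ∫⁻ w in B, ENNReal.ofReal (btlProb φ Θ w) ∂P

/-- The negative log-likelihood
`(1/N) ∑ₜ (log (1 + exp (-xₜᵀ Θ (φ(sₜ,aₜ₁) - φ(sₜ,aₜ₀)))) + (1 - yₜ) xₜᵀ Θ (φ(sₜ,aₜ₁) - φ(sₜ,aₜ₀)))`. -/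
noncomputable def negLogLik (φ : S → A → EuclideanSpace ℝ (Fin dφ)) {N : ℕ}
    (w : Fin N → Query dx S A) (y : Fin N → Bool) (Θ : Matrix (Fin dx) (Fin dφ) ℝ) : ℝ :=
  (1 / (N : ℝ)) * ∑ t,
    let m : ℝ := (w t).1.ofLp ⬝ᵥ
      (Θ *ᵥ (φ (w t).2.1 (w t).2.2.2 - φ (w t).2.1 (w t).2.2.1).ofLp)
    Real.log (1 + Real.exp (-m)) + (1 - ((y t).toNat : ℝ)) * m

end Model

/-- The gradient (matrix of partial derivatives) of a function of a matrix. -/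
noncomputable def matGrad {m n : ℕ} (f : Matrix (Fin m) (Fin n) ℝ → ℝ)
    (M : Matrix (Fin m) (Fin n) ℝ) : Matrix (Fin m) (Fin n) ℝ :=
  Matrix.of fun i j => deriv (fun t : ℝ => f (M + t • Matrix.single i j (1 : ℝ))) 0

/-- The regularized factored objective `L(U Vᵀ) + ‖Uᵀ U - Vᵀ V‖_F² / 8`. -/
noncomputable def factoredObjective {m n r : ℕ} (L : Matrix (Fin m) (Fin n) ℝ → ℝ)
    (U : Matrix (Fin m) (Fin r) ℝ) (V : Matrix (Fin n) (Fin r) ℝ) : ℝ :=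
  L (U * Vᵀ) + (1 / 8) * ‖Uᵀ * U - Vᵀ * V‖ ^ 2

/-- Alternating factored gradient descent with step size `η`: first `U` is updated, then `V` at the
new `U`. -/
noncomputable def fgd {m n r : ℕ} (L : Matrix (Fin m) (Fin n) ℝ → ℝ) (η : ℝ)
    (Uinit : Matrix (Fin m) (Fin r) ℝ) (Vinit : Matrix (Fin n) (Fin r) ℝ) :
    ℕ → Matrix (Fin m) (Fin r) ℝ × Matrix (Fin n) (Fin r) ℝ
  | 0 => (Uinit, Vinit)
  | k + 1 =>
    let U := (fgd L η Uinit Vinit k).1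
    let V := (fgd L η Uinit Vinit k).2
    let U' := U - η • matGrad (fun X => factoredObjective L X V) U
    let V' := V - η • matGrad (fun Y => factoredObjective L U' Y) V
    (U', V')

/-- The estimate `U⁽ᵏ⁾ (V⁽ᵏ⁾)ᵀ` after `k` rounds, started from the leading `r` singular triples of
the initial matrix `U₀ diag(s₀) V₀ᵀ`: the columns of `U⁽⁰⁾`, `V⁽⁰⁾` are the first `r` columns of
`U₀`, `V₀` times the square roots of the first `r` singular values. -/
noncomputable def fgdEstimate {m n : ℕ} (r : ℕ) (L : Matrix (Fin m) (Fin n) ℝ → ℝ) (η : ℝ)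
    (U₀ : Matrix (Fin m) (Fin m) ℝ) (s₀ : ℕ → ℝ) (V₀ : Matrix (Fin n) (Fin n) ℝ) (k : ℕ) :
    Matrix (Fin m) (Fin n) ℝ :=
  let F := fgd L η (U₀ * rectDiag m r fun i => Real.sqrt (s₀ i))
    (V₀ * rectDiag n r fun i => Real.sqrt (s₀ i)) k
  F.1 * F.2ᵀ

/-! The lower bound on the second moment hides a bound on the dimension. The trace of Σ is at most
R² with R = 2·Bφ·Bx, so dx·dφ·λ ≤ R² (`card_le_of_secondMoment`). Every dimensional factor can thus
be absorbed into constants depending on Bx, Bφ, Bθ, λ, and crude tools suffice: entrywise Hoeffding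
with a union bound instead of matrix concentration, Frobenius norms instead of operator norms.

Statistics. On `goodEvent` every entry of the score at Θ* is O(√(log((dx+dφ)/δ)/N₀)), and the
empirical second moment is still at least λ/2. The loss is then convex and R²/4-smooth everywhere
and α-strongly convex between Θ* and its unit ball (`logisticLoss_regular`), and the gradient at Θ*
is bounded by a deterministic e.

Optimization. Near-balanced factors of a matrix close to Θ* have squared singular values at least
σ_r/2 (`HasThinSVD.factor_lower_bound`). Up to a quadratic remainder, the deviation UVᵀ − Θ* lies in
the directions reachable by moving U and V, so its pairing with the gradient G is controlled by GV
and GᵀU (`frobInner_deviation_le`). With strong convexity this gives a Polyak-Lojasiewicz inequality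
with slack e² (`LocalRegime.gradient_domination`). By smoothness each alternating half step lowers
the objective by a multiple of the squared partial gradient, and the low objective value keeps the
iterates in the local region (`LocalRegime.half_step`, `LocalRegime.full_step`). The excess
therefore contracts geometrically to order e² (`LocalRegime.fgd_invariant`), and strong convexity
converts this into a squared error of order e².

If N₀ is below the threshold C₀·r·log((dx+dφ)/δ)/σ_r², the claimed bound already exceeds σ_r, and
the truncated initial estimate meets it with K = 0. -/

section Frobenius

/-! ### Frobenius inner product and norm. -/

variable {m n k : ℕ}

/-- The Frobenius inner product of two real matrices. -/
def frobInner (A B : Matrix (Fin m) (Fin n) ℝ) : ℝ := ∑ i, ∑ j, A i j * B i j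

theorem frobInner_eq_trace (A B : Matrix (Fin m) (Fin n) ℝ) :
    frobInner A B = (Aᵀ * B).trace := by
  simp only [frobInner, Matrix.trace, Matrix.diag, Matrix.mul_apply, Matrix.transpose_apply]
  exact Finset.sum_comm

theorem frobInner_comm (A B : Matrix (Fin m) (Fin n) ℝ) : frobInner A B = frobInner B A := by
  simp [frobInner, mul_comm]

theorem frobInner_add_left (A B C : Matrix (Fin m) (Fin n) ℝ) :
    frobInner (A + B) C = frobInner A C + frobInner B C := by
  simp [frobInner, add_mul, Finset.sum_add_distrib]

theorem frobInner_add_right (A B C : Matrix (Fin m) (Fin n) ℝ) :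
    frobInner A (B + C) = frobInner A B + frobInner A C := by
  simp [frobInner, mul_add, Finset.sum_add_distrib]

theorem frobInner_sub_left (A B C : Matrix (Fin m) (Fin n) ℝ) :
    frobInner (A - B) C = frobInner A C - frobInner B C := by
  simp [frobInner, sub_mul, Finset.sum_sub_distrib]

theorem frobInner_sub_right (A B C : Matrix (Fin m) (Fin n) ℝ) :
    frobInner A (B - C) = frobInner A B - frobInner A C := by
  simp [frobInner, mul_sub, Finset.sum_sub_distrib]

theorem frobInner_smul_left (c : ℝ) (A B : Matrix (Fin m) (Fin n) ℝ) :
    frobInner (c • A) B = c * frobInner A B := by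
  simp [frobInner, Finset.mul_sum, mul_assoc]

theorem frobInner_smul_right (c : ℝ) (A B : Matrix (Fin m) (Fin n) ℝ) :
    frobInner A (c • B) = c * frobInner A B := by
  rw [frobInner_comm, frobInner_smul_left, frobInner_comm]

theorem frobInner_neg_right (A B : Matrix (Fin m) (Fin n) ℝ) :
    frobInner A (-B) = -frobInner A B := by
  simp [frobInner]

theorem frobInner_transpose (A B : Matrix (Fin m) (Fin n) ℝ) :
    frobInner Aᵀ Bᵀ = frobInner A B := by
  simp only [frobInner, Matrix.transpose_apply]
  exact Finset.sum_comm

theorem frobInner_mul_left (A : Matrix (Fin m) (Fin k) ℝ) (B : Matrix (Fin k) (Fin n) ℝ)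
    (C : Matrix (Fin m) (Fin n) ℝ) : frobInner (A * B) C = frobInner B (Aᵀ * C) := by
  simp [frobInner_eq_trace, Matrix.transpose_mul, Matrix.mul_assoc]

theorem frobInner_mul_left' (A : Matrix (Fin m) (Fin k) ℝ) (B : Matrix (Fin k) (Fin n) ℝ)
    (C : Matrix (Fin m) (Fin n) ℝ) : frobInner (A * B) C = frobInner A (C * Bᵀ) := by
  rw [← frobInner_transpose, Matrix.transpose_mul, frobInner_mul_left, ← frobInner_transpose]
  simp

theorem frobenius_norm_sq (A : Matrix (Fin m) (Fin n) ℝ) : ‖A‖ ^ 2 = frobInner A A := by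
  rw [Matrix.frobenius_norm_def, ← Real.sqrt_eq_rpow, Real.sq_sqrt]
  · simp [frobInner, sq]
  · positivity

theorem frobenius_norm_sq_eq_sum (A : Matrix (Fin m) (Fin n) ℝ) :
    ‖A‖ ^ 2 = ∑ i, ∑ j, A i j ^ 2 := by
  rw [frobenius_norm_sq]; simp [frobInner, sq]

theorem frobenius_norm_add_sq (A B : Matrix (Fin m) (Fin n) ℝ) :
    ‖A + B‖ ^ 2 = ‖A‖ ^ 2 + 2 * frobInner A B + ‖B‖ ^ 2 := by
  simp only [frobenius_norm_sq, frobInner_add_left, frobInner_add_right, frobInner_comm B A]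
  ring

theorem frobenius_norm_sub_sq (A B : Matrix (Fin m) (Fin n) ℝ) :
    ‖A - B‖ ^ 2 = ‖A‖ ^ 2 - 2 * frobInner A B + ‖B‖ ^ 2 := by
  simp only [frobenius_norm_sq, frobInner_sub_left, frobInner_sub_right, frobInner_comm B A]
  ring

theorem frobenius_norm_smul (c : ℝ) (A : Matrix (Fin m) (Fin n) ℝ) : ‖c • A‖ = |c| * ‖A‖ := by
  rw [← sq_eq_sq₀ (norm_nonneg _) (by positivity), mul_pow, sq_abs, frobenius_norm_sq,
    frobenius_norm_sq, frobInner_smul_left, frobInner_smul_right]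
  ring

theorem abs_frobInner_le (A B : Matrix (Fin m) (Fin n) ℝ) : |frobInner A B| ≤ ‖A‖ * ‖B‖ := by
  refine abs_le_of_sq_le_sq ?_ (by positivity)
  rw [mul_pow, frobenius_norm_sq_eq_sum, frobenius_norm_sq_eq_sum]
  simp only [frobInner, ← Fintype.sum_prod_type']
  exact Finset.sum_mul_sq_le_sq_mul_sq _ _ _

theorem frobInner_le (A B : Matrix (Fin m) (Fin n) ℝ) : frobInner A B ≤ ‖A‖ * ‖B‖ :=
  (le_abs_self _).trans (abs_frobInner_le A B)

theorem frobenius_norm_mul_le (A : Matrix (Fin m) (Fin k) ℝ) (B : Matrix (Fin k) (Fin n) ℝ) :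
    ‖A * B‖ ≤ ‖A‖ * ‖B‖ := Matrix.frobenius_norm_mul A B

theorem frobenius_norm_mul_of_isometry (A : Matrix (Fin m) (Fin k) ℝ)
    (B : Matrix (Fin k) (Fin n) ℝ) (hA : Aᵀ * A = 1) : ‖A * B‖ = ‖B‖ := by
  rw [← sq_eq_sq₀ (norm_nonneg _) (norm_nonneg _), frobenius_norm_sq, frobInner_mul_left,
    ← Matrix.mul_assoc, hA, Matrix.one_mul, frobenius_norm_sq]

theorem frobenius_norm_mul_transpose_of_isometry (A : Matrix (Fin m) (Fin k) ℝ)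
    (B : Matrix (Fin n) (Fin k) ℝ) (hB : Bᵀ * B = 1) : ‖A * Bᵀ‖ = ‖A‖ := by
  rw [← Matrix.frobenius_norm_transpose, Matrix.transpose_mul, Matrix.transpose_transpose,
    frobenius_norm_mul_of_isometry _ _ hB, Matrix.frobenius_norm_transpose]

/-- A symmetric idempotent matrix is a contraction, and so is its complement. -/
theorem frobenius_norm_projection_sq (Q : Matrix (Fin m) (Fin m) ℝ) (hs : Qᵀ = Q)
    (hi : Q * Q = Q) (A : Matrix (Fin m) (Fin n) ℝ) :
    ‖Q * A‖ ^ 2 + ‖(1 - Q) * A‖ ^ 2 = ‖A‖ ^ 2 := by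
  have h1 : frobInner (Q * A) A = ‖Q * A‖ ^ 2 := by
    rw [frobenius_norm_sq, frobInner_mul_left, frobInner_mul_left, ← Matrix.mul_assoc Qᵀ, hs, hi]
  rw [Matrix.sub_mul, Matrix.one_mul, frobenius_norm_sub_sq, frobInner_comm, h1]
  ring

theorem frobenius_norm_projection_le (Q : Matrix (Fin m) (Fin m) ℝ) (hs : Qᵀ = Q)
    (hi : Q * Q = Q) (A : Matrix (Fin m) (Fin n) ℝ) : ‖Q * A‖ ≤ ‖A‖ := by
  refine le_of_sq_le_sq ?_ (norm_nonneg _)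
  have := frobenius_norm_projection_sq Q hs hi A
  nlinarith [sq_nonneg ‖(1 - Q) * A‖]

theorem frobenius_norm_compl_projection_le (Q : Matrix (Fin m) (Fin m) ℝ) (hs : Qᵀ = Q)
    (hi : Q * Q = Q) (A : Matrix (Fin m) (Fin n) ℝ) : ‖(1 - Q) * A‖ ≤ ‖A‖ := by
  refine le_of_sq_le_sq ?_ (norm_nonneg _)
  have := frobenius_norm_projection_sq Q hs hi A
  nlinarith [sq_nonneg ‖Q * A‖]

theorem frobenius_norm_mul_compl_projection_le (Q : Matrix (Fin n) (Fin n) ℝ) (hs : Qᵀ = Q)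
    (hi : Q * Q = Q) (A : Matrix (Fin m) (Fin n) ℝ) : ‖A * (1 - Q)‖ ≤ ‖A‖ := by
  rw [← Matrix.frobenius_norm_transpose, Matrix.transpose_mul, Matrix.transpose_sub, hs,
    Matrix.transpose_one, ← Matrix.frobenius_norm_transpose A]
  exact frobenius_norm_compl_projection_le Q hs hi _

theorem dotProduct_self_mulVec_le (A : Matrix (Fin m) (Fin n) ℝ) (v : Fin n → ℝ) :
    (A *ᵥ v) ⬝ᵥ (A *ᵥ v) ≤ ‖A‖ ^ 2 * (v ⬝ᵥ v) := by
  rw [frobenius_norm_sq_eq_sum, Finset.sum_mul, dotProduct]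
  refine Finset.sum_le_sum fun i _ => ?_
  have := Finset.sum_mul_sq_le_sq_mul_sq Finset.univ (A i) v
  simpa [Matrix.mulVec, dotProduct, sq] using this

theorem sq_dotProduct_le (v w : Fin n → ℝ) : (v ⬝ᵥ w) ^ 2 ≤ (v ⬝ᵥ v) * (w ⬝ᵥ w) := by
  have := Finset.sum_mul_sq_le_sq_mul_sq Finset.univ v w
  simpa [dotProduct, sq] using this

theorem dotProduct_self_nonneg' (v : Fin n → ℝ) : 0 ≤ v ⬝ᵥ v :=
  Finset.sum_nonneg fun i _ => mul_self_nonneg (v i)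

theorem frobenius_norm_sq_eq_sum_col (A : Matrix (Fin m) (Fin n) ℝ) :
    ‖A‖ ^ 2 = ∑ j, A.col j ⬝ᵥ A.col j := by
  rw [frobenius_norm_sq_eq_sum, Finset.sum_comm]
  simp [dotProduct, sq, Matrix.col]

/-- A lower bound on vectors gives the same lower bound in Frobenius norm. -/
theorem le_frobenius_norm_sq_mul (A : Matrix (Fin m) (Fin k) ℝ) (c : ℝ)
    (h : ∀ v : Fin k → ℝ, c * (v ⬝ᵥ v) ≤ (A *ᵥ v) ⬝ᵥ (A *ᵥ v)) (B : Matrix (Fin k) (Fin n) ℝ) :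
    c * ‖B‖ ^ 2 ≤ ‖A * B‖ ^ 2 := by
  rw [frobenius_norm_sq_eq_sum_col, frobenius_norm_sq_eq_sum_col, Finset.mul_sum]
  refine Finset.sum_le_sum fun j _ => ?_
  have : (A * B).col j = A *ᵥ B.col j := by
    ext i; simp [Matrix.col, Matrix.mul_apply, Matrix.mulVec, dotProduct]
  rw [this]
  exact h _

theorem dotProduct_mulVec_self_of_isometry (A : Matrix (Fin m) (Fin k) ℝ) (hA : Aᵀ * A = 1)
    (v : Fin k → ℝ) : (A *ᵥ v) ⬝ᵥ (A *ᵥ v) = v ⬝ᵥ v := by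
  rw [Matrix.dotProduct_mulVec, ← Matrix.mulVec_transpose, Matrix.mulVec_mulVec, hA,
    Matrix.one_mulVec]

theorem frobenius_norm_diagonal_le {s : Fin n → ℝ} {c : ℝ} (hc : 0 ≤ c) (h : ∀ i, |s i| ≤ c) :
    ‖Matrix.diagonal s‖ ≤ n * c := by
  rcases Nat.eq_zero_or_pos n with rfl | hn
  · simp [Matrix.frobenius_norm_def]
  refine le_of_sq_le_sq ?_ (by positivity)
  have h1 : ‖Matrix.diagonal s‖ ^ 2 = ∑ i, s i ^ 2 := by
    rw [frobenius_norm_sq_eq_sum]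
    refine Finset.sum_congr rfl fun i _ => ?_
    rw [Finset.sum_eq_single i] <;> simp +contextual [eq_comm]
  have h2 : ∑ i, s i ^ 2 ≤ ∑ _i : Fin n, c ^ 2 :=
    Finset.sum_le_sum fun i _ => sq_le_sq' (by linarith [neg_abs_le (s i), h i])
      ((le_abs_self _).trans (h i))
  have h3 : (1 : ℝ) ≤ n := by exact_mod_cast hn
  rw [h1]
  refine h2.trans ?_
  simp only [Finset.sum_const, Finset.card_univ, Fintype.card_fin, nsmul_eq_mul]
  nlinarith [sq_nonneg c, mul_nonneg (sq_nonneg c) (sub_nonneg.2 h3)]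

end Frobenius

/-! ### Singular values: comparison with low-rank matrices, truncation, thin form. -/

section SVD

variable {m n k : ℕ}

theorem rectDiag_mul_transpose {r : ℕ} (a b : ℕ → ℝ) :
    rectDiag m r a * (rectDiag n r b)ᵀ =
      rectDiag m n fun i => if i < r then a i * b i else 0 := by
  ext i j
  simp only [rectDiag, Matrix.mul_apply, Matrix.transpose_apply, Matrix.of_apply]
  by_cases hi : (i : ℕ) < r
  · rw [Finset.sum_eq_single ⟨i, hi⟩]
    · by_cases hij : (i : ℕ) = j
      · simp [hij, hij ▸ hi]
      · simp [hij, Ne.symm hij]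
    · intro q _ hq
      have : (i : ℕ) ≠ q := fun h => hq (Fin.ext h.symm)
      simp [this]
    · simp
  · rw [Finset.sum_eq_zero]
    · simp [hi]
    · intro q _
      have : (i : ℕ) ≠ q := fun h => hi (h ▸ q.2)
      simp [this]

theorem rectDiag_transpose_mul {r : ℕ} (hr : r ≤ m) (a b : ℕ → ℝ) :
    (rectDiag m r a)ᵀ * rectDiag m r b = Matrix.diagonal fun i : Fin r => a i * b i := by
  ext i j
  simp only [rectDiag, Matrix.mul_apply, Matrix.transpose_apply, Matrix.of_apply,
    Matrix.diagonal_apply]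
  rw [Finset.sum_eq_single ⟨i, i.2.trans_le hr⟩]
  · by_cases hij : i = j
    · simp [hij]
    · have : (i : ℕ) ≠ j := fun h => hij (Fin.ext h)
      simp [hij, this]
  · intro q _ hq
    have : (q : ℕ) ≠ i := fun h => hq (Fin.ext h)
    simp [this]
  · simp

theorem rectDiag_transpose (a : ℕ → ℝ) : (rectDiag m n a)ᵀ = rectDiag n m a := by
  ext i j
  simp only [rectDiag, Matrix.transpose_apply, Matrix.of_apply]
  by_cases h : (i : ℕ) = j
  · simp [h]
  · simp [h, Ne.symm h]

theorem rectDiag_congr {a b : ℕ → ℝ} (h : ∀ i, i < min m n → a i = b i) :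
    rectDiag m n a = rectDiag m n b := by
  ext i j
  simp only [rectDiag, Matrix.of_apply]
  split_ifs with hij
  · exact h i (lt_min i.2 (hij ▸ j.2))
  · rfl

theorem frobenius_norm_rectDiag_le {a : ℕ → ℝ} {c : ℝ} (hc : 0 ≤ c)
    (h : ∀ i, i < min m n → |a i| ≤ c) : ‖rectDiag m n a‖ ≤ m * n * c := by
  have hsq : ‖rectDiag m n a‖ ^ 2 ≤ m * n * c ^ 2 := by
    rw [frobenius_norm_sq_eq_sum]
    have : ∀ i : Fin m, ∀ j : Fin n, rectDiag m n a i j ^ 2 ≤ c ^ 2 := by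
      intro i j
      simp only [rectDiag, Matrix.of_apply]
      split_ifs with hij
      · rw [← sq_abs]
        exact pow_le_pow_left₀ (abs_nonneg _) (h i (lt_min i.2 (hij ▸ j.2))) 2
      · nlinarith [sq_nonneg c]
    refine (Finset.sum_le_sum fun i _ => Finset.sum_le_sum fun j _ => this i j).trans ?_
    simp [mul_assoc]
  refine le_of_sq_le_sq (hsq.trans ?_) (by positivity)
  have hmn : (m * n : ℝ) ≤ (m * n : ℝ) ^ 2 := by
    have : (m * n : ℕ) ≤ (m * n) ^ 2 := Nat.le_self_pow (by norm_num) _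
    exact_mod_cast this
  rw [mul_pow]
  exact mul_le_mul_of_nonneg_right hmn (sq_nonneg c)

theorem IsSVD.left_isometry {M : Matrix (Fin m) (Fin n) ℝ} {U s V} (h : IsSVD M U s V) :
    Uᵀ * U = 1 := (Matrix.mem_orthogonalGroup_iff' (Fin m) ℝ).1 h.left_orthogonal

theorem IsSVD.right_isometry {M : Matrix (Fin m) (Fin n) ℝ} {U s V} (h : IsSVD M U s V) :
    Vᵀ * V = 1 := (Matrix.mem_orthogonalGroup_iff' (Fin n) ℝ).1 h.right_orthogonal

/-- A matrix with more columns than its rank annihilates a nonzero vector. -/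
theorem exists_mulVec_eq_zero_of_rank_lt (A : Matrix (Fin m) (Fin k) ℝ) (h : A.rank < k) :
    ∃ v : Fin k → ℝ, v ≠ 0 ∧ A *ᵥ v = 0 := by
  have h1 := LinearMap.finrank_range_add_finrank_ker A.mulVecLin
  have h2 : 0 < Module.finrank ℝ (LinearMap.ker A.mulVecLin) := by
    simp only [Module.finrank_fin_fun] at h1
    change Module.finrank ℝ (LinearMap.range A.mulVecLin) < k at h
    omega
  rw [Module.finrank_pos_iff] at h2
  obtain ⟨⟨v, hv⟩, hne⟩ := exists_ne (0 : LinearMap.ker A.mulVecLin)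
  exact ⟨v, fun h0 => hne (Subtype.ext h0), by simpa using hv⟩

/-- The `r`-th singular value (counted from zero) is at most the Frobenius distance to any matrix
of rank at most `r`. -/
theorem IsSVD.singularValue_le {M : Matrix (Fin m) (Fin n) ℝ} {U s V} (h : IsSVD M U s V)
    {N : Matrix (Fin m) (Fin n) ℝ} {r : ℕ} (hN : N.rank ≤ r) : s r ≤ ‖M - N‖ := by
  by_cases hr : min m n ≤ r
  · rw [h.eq_zero r hr]; exact norm_nonneg _
  have hrm : r + 1 ≤ m := by omega
  have hrn : r + 1 ≤ n := by omega
  -- The columns of `V * J` are the r + 1 leading right singular vectors. As `N` has rank at most r,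
  -- it kills a nonzero combination of them, on which `M - N` acts like `M` and stretches by at
  -- least `s r`.
  set J : Matrix (Fin n) (Fin (r + 1)) ℝ := rectDiag n (r + 1) fun _ => 1 with hJ
  have hJJ : Jᵀ * J = 1 := by
    rw [hJ, rectDiag_transpose_mul hrn]; simp
  have hrank : (N * (V * J)).rank < r + 1 :=
    ((Matrix.rank_mul_le_left _ _).trans hN).trans_lt (Nat.lt_succ_self r)
  obtain ⟨v, hv0, hv⟩ := exists_mulVec_eq_zero_of_rank_lt _ hrank
  have hMVJ : M * (V * J) = U * rectDiag m (r + 1) s := by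
    have h1 : rectDiag m n s * J = rectDiag m (r + 1) s := by
      have h2 := rectDiag_mul_transpose (m := m) (n := r + 1) (r := n) s fun _ => 1
      rw [rectDiag_transpose] at h2
      rw [hJ, h2]
      refine rectDiag_congr fun i hi => ?_
      have : i < n := by omega
      simp [this]
    rw [h.eq_mul, Matrix.mul_assoc, ← Matrix.mul_assoc Vᵀ, h.right_isometry, Matrix.one_mul,
      Matrix.mul_assoc, h1]
  have hvv : 0 < v ⬝ᵥ v := by
    refine lt_of_le_of_ne (dotProduct_self_nonneg' v) fun h0 => hv0 ?_
    exact dotProduct_self_eq_zero.1 h0.symm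
  have hup := dotProduct_self_mulVec_le (M - N) ((V * J) *ᵥ v)
  have hVJ : ((V * J) *ᵥ v) ⬝ᵥ ((V * J) *ᵥ v) = v ⬝ᵥ v := by
    refine dotProduct_mulVec_self_of_isometry _ ?_ v
    rw [Matrix.transpose_mul, Matrix.mul_assoc, ← Matrix.mul_assoc Vᵀ, h.right_isometry,
      Matrix.one_mul, hJJ]
  have hlow : (M - N) *ᵥ ((V * J) *ᵥ v) = U *ᵥ (rectDiag m (r + 1) s *ᵥ v) := by
    rw [Matrix.sub_mulVec, Matrix.mulVec_mulVec, Matrix.mulVec_mulVec, hv, hMVJ, sub_zero,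
      Matrix.mulVec_mulVec]
  rw [hVJ, hlow, dotProduct_mulVec_self_of_isometry _ h.left_isometry, Matrix.dotProduct_mulVec,
    ← Matrix.mulVec_transpose, Matrix.mulVec_mulVec, rectDiag_transpose_mul hrm] at hup
  have hge : s r ^ 2 * (v ⬝ᵥ v) ≤
      ((Matrix.diagonal fun i : Fin (r + 1) => s i * s i) *ᵥ v) ⬝ᵥ v := by
    simp only [dotProduct, Matrix.mulVec_diagonal, Finset.mul_sum]
    refine Finset.sum_le_sum fun i _ => ?_
    have h1 : s r ≤ s i := h.antitone (Nat.lt_succ_iff.1 i.2)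
    have h2 : s r ^ 2 ≤ s i * s i := by nlinarith [h.nonneg r]
    nlinarith [mul_self_nonneg (v i)]
  refine le_of_sq_le_sq ?_ (norm_nonneg _)
  exact le_of_mul_le_mul_right (hge.trans hup) hvv

/-- Truncating the singular value decomposition after `r` terms at most multiplies the distance to
a rank-`r` matrix by a dimensional factor. -/
theorem IsSVD.truncation_dist_le {M : Matrix (Fin m) (Fin n) ℝ} {U s V} (h : IsSVD M U s V)
    {N : Matrix (Fin m) (Fin n) ℝ} {r : ℕ} (hN : N.rank ≤ r) :
    ‖(U * rectDiag m r fun i => Real.sqrt (s i)) * (V * rectDiag n r fun i => Real.sqrt (s i))ᵀ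
      - N‖ ≤ (1 + m * n) * ‖M - N‖ := by
  have h1 : (U * rectDiag m r fun i => Real.sqrt (s i)) *
      (V * rectDiag n r fun i => Real.sqrt (s i))ᵀ =
      U * rectDiag m n (fun i => if i < r then s i else 0) * Vᵀ := by
    rw [Matrix.transpose_mul, Matrix.mul_assoc, ← Matrix.mul_assoc (rectDiag m r _),
      rectDiag_mul_transpose, ← Matrix.mul_assoc]
    simp only [Real.mul_self_sqrt (h.nonneg _)]
  have h2 : U * rectDiag m n (fun i => if i < r then s i else 0) * Vᵀ - M =
      U * rectDiag m n (fun i => if i < r then 0 else -s i) * Vᵀ := by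
    rw [h.eq_mul, ← Matrix.sub_mul, ← Matrix.mul_sub]
    congr 2
    ext i j
    simp only [rectDiag, Matrix.sub_apply, Matrix.of_apply]
    split_ifs <;> simp
  -- Each discarded singular value has index at least r, hence is at most `‖M - N‖`; counting all
  -- m·n entries is crude but harmless.
  have h3 : ‖U * rectDiag m n (fun i => if i < r then 0 else -s i) * Vᵀ‖ ≤
      m * n * ‖M - N‖ := by
    rw [frobenius_norm_mul_transpose_of_isometry _ _ h.right_isometry,
      frobenius_norm_mul_of_isometry _ _ h.left_isometry]
    refine frobenius_norm_rectDiag_le (norm_nonneg _) fun i _ => ?_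
    split_ifs with hi
    · simp
    · rw [abs_neg, abs_of_nonneg (h.nonneg i)]
      exact (h.antitone (not_lt.1 hi)).trans (h.singularValue_le hN)
  rw [h1]
  calc _ = ‖(U * rectDiag m n (fun i => if i < r then s i else 0) * Vᵀ - M) + (M - N)‖ := by
        rw [sub_add_sub_cancel]
    _ ≤ _ := norm_add_le _ _
    _ ≤ m * n * ‖M - N‖ + ‖M - N‖ := by rw [h2]; gcongr
    _ = _ := by ring

/-- The factors of a truncated singular value decomposition are balanced. -/
theorem IsSVD.truncation_balanced {M : Matrix (Fin m) (Fin n) ℝ} {U s V} (h : IsSVD M U s V)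
    {r : ℕ} (hm : r ≤ m) (hn : r ≤ n) (a : ℕ → ℝ) :
    (U * rectDiag m r a)ᵀ * (U * rectDiag m r a) =
      (V * rectDiag n r a)ᵀ * (V * rectDiag n r a) := by
  rw [Matrix.transpose_mul, Matrix.transpose_mul, Matrix.mul_assoc, Matrix.mul_assoc,
    ← Matrix.mul_assoc Uᵀ, ← Matrix.mul_assoc Vᵀ, h.left_isometry, h.right_isometry,
    Matrix.one_mul, Matrix.one_mul, rectDiag_transpose_mul hm, rectDiag_transpose_mul hn]

/-- The thin singular value decomposition of a matrix of rank `r`. -/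
theorem IsSVD.exists_thin {M : Matrix (Fin m) (Fin n) ℝ} {U s V} (h : IsSVD M U s V) {r : ℕ}
    (hr : M.rank = r) : ∃ (Ur : Matrix (Fin m) (Fin r) ℝ) (Vr : Matrix (Fin n) (Fin r) ℝ),
      Urᵀ * Ur = 1 ∧ Vrᵀ * Vr = 1 ∧ M = Ur * Matrix.diagonal (fun i : Fin r => s i) * Vrᵀ := by
  have hm : r ≤ m := by simpa [hr] using M.rank_le_height
  have hn : r ≤ n := by simpa [hr] using M.rank_le_width
  -- Comparing `M` with itself, a matrix of rank r, makes the singular values from index r on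
  -- vanish.
  have hz : ∀ i, r ≤ i → s i = 0 := fun i hi => by
    have h1 := h.singularValue_le (N := M) hr.le
    rw [sub_self, norm_zero] at h1
    exact le_antisymm ((h.antitone hi).trans h1) (h.nonneg i)
  refine ⟨U * rectDiag m r fun _ => 1, V * rectDiag n r fun _ => 1, ?_, ?_, ?_⟩
  · rw [Matrix.transpose_mul, Matrix.mul_assoc, ← Matrix.mul_assoc Uᵀ, h.left_isometry,
      Matrix.one_mul, rectDiag_transpose_mul hm]
    simp
  · rw [Matrix.transpose_mul, Matrix.mul_assoc, ← Matrix.mul_assoc Vᵀ, h.right_isometry,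
      Matrix.one_mul, rectDiag_transpose_mul hn]
    simp
  · have h1 : (rectDiag m r fun _ => 1) * Matrix.diagonal (fun i : Fin r => s i) =
        rectDiag m r s := by
      ext i j
      simp only [Matrix.mul_diagonal, rectDiag, Matrix.of_apply]
      split_ifs with hij <;> simp [hij]
    rw [Matrix.mul_assoc U, h1, Matrix.transpose_mul, Matrix.mul_assoc U,
      ← Matrix.mul_assoc (rectDiag m r s), rectDiag_mul_transpose, ← Matrix.mul_assoc]
    rw [h.eq_mul]
    congr 2
    refine rectDiag_congr fun i _ => ?_
    split_ifs with hi
    · simp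
    · exact hz i (not_lt.1 hi)

end SVD

/-! ### The factored objective: conditioning of the factors, gradients, second-order expansion. -/

section Factored

variable {m n r : ℕ}

/-- `G` is the gradient of the `β`-smooth convex function `L`, which is `α`-strongly convex
between `Θs` and the points of the unit ball around it. -/
structure IsRegularLoss (L : Matrix (Fin m) (Fin n) ℝ → ℝ)
    (G : Matrix (Fin m) (Fin n) ℝ → Matrix (Fin m) (Fin n) ℝ) (Θs : Matrix (Fin m) (Fin n) ℝ)
    (α β : ℝ) : Prop where
  upper : ∀ Θ E, L (Θ + E) ≤ L Θ + frobInner (G Θ) E + β / 2 * ‖E‖ ^ 2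
  lower : ∀ Θ E, L Θ + frobInner (G Θ) E ≤ L (Θ + E)
  lipschitz : ∀ Θ Θ', ‖G Θ - G Θ'‖ ≤ β * ‖Θ - Θ'‖
  strong_above : ∀ Θ, ‖Θ - Θs‖ ≤ 1 →
    L Θs + frobInner (G Θs) (Θ - Θs) + α / 2 * ‖Θ - Θs‖ ^ 2 ≤ L Θ
  strong_below : ∀ Θ, ‖Θ - Θs‖ ≤ 1 →
    L Θ - frobInner (G Θ) (Θ - Θs) + α / 2 * ‖Θ - Θs‖ ^ 2 ≤ L Θs

/-- Transposition exchanges the two factors, so each fact about U is reused for V. -/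
theorem IsRegularLoss.transpose {L : Matrix (Fin m) (Fin n) ℝ → ℝ} {G Θs} {α β : ℝ}
    (h : IsRegularLoss L G Θs α β) :
    IsRegularLoss (fun Θ => L Θᵀ) (fun Θ => (G Θᵀ)ᵀ) Θsᵀ α β where
  upper Θ E := by
    have := h.upper Θᵀ Eᵀ
    rwa [Matrix.frobenius_norm_transpose, ← frobInner_transpose, Matrix.transpose_transpose,
      ← Matrix.transpose_add] at this
  lower Θ E := by
    have := h.lower Θᵀ Eᵀ
    rwa [← frobInner_transpose, Matrix.transpose_transpose, ← Matrix.transpose_add] at this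
  lipschitz Θ Θ' := by
    have := h.lipschitz Θᵀ Θ'ᵀ
    rwa [← Matrix.transpose_sub, Matrix.frobenius_norm_transpose, ← Matrix.frobenius_norm_transpose,
      Matrix.transpose_sub] at this
  strong_above Θ hΘ := by
    have e1 : Θ - Θsᵀ = (Θᵀ - Θs)ᵀ := by simp
    rw [e1, Matrix.frobenius_norm_transpose] at hΘ
    simp only [e1, Matrix.transpose_transpose, frobInner_transpose,
      Matrix.frobenius_norm_transpose]
    exact h.strong_above Θᵀ hΘ
  strong_below Θ hΘ := by
    have e1 : Θ - Θsᵀ = (Θᵀ - Θs)ᵀ := by simp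
    rw [e1, Matrix.frobenius_norm_transpose] at hΘ
    simp only [e1, Matrix.transpose_transpose, frobInner_transpose,
      Matrix.frobenius_norm_transpose]
    exact h.strong_below Θᵀ hΘ

/-- `M` has a thin singular value decomposition with `r` singular values in `[σ, τ]`. -/
def HasThinSVD (M : Matrix (Fin m) (Fin n) ℝ) (r : ℕ) (σ τ : ℝ) : Prop :=
  ∃ (Ur : Matrix (Fin m) (Fin r) ℝ) (Vr : Matrix (Fin n) (Fin r) ℝ) (s : Fin r → ℝ),
    Urᵀ * Ur = 1 ∧ Vrᵀ * Vr = 1 ∧ M = Ur * Matrix.diagonal s * Vrᵀ ∧ ∀ i, σ ≤ s i ∧ s i ≤ τ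

theorem HasThinSVD.transpose {M : Matrix (Fin m) (Fin n) ℝ} {σ τ : ℝ} (h : HasThinSVD M r σ τ) :
    HasThinSVD Mᵀ r σ τ := by
  obtain ⟨Ur, Vr, s, hU, hV, rfl, hs⟩ := h
  exact ⟨Vr, Ur, s, hV, hU, by simp [Matrix.mul_assoc], hs⟩

theorem HasThinSVD.norm_le {M : Matrix (Fin m) (Fin n) ℝ} {σ τ : ℝ} (h : HasThinSVD M r σ τ)
    (hσ : 0 ≤ σ) (hτ : 0 ≤ τ) : ‖M‖ ≤ r * τ := by
  obtain ⟨Ur, Vr, s, hU, hV, rfl, hs⟩ := h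
  rw [frobenius_norm_mul_transpose_of_isometry _ _ hV, frobenius_norm_mul_of_isometry _ _ hU]
  exact frobenius_norm_diagonal_le hτ fun i => by
    rw [abs_of_nonneg (hσ.trans (hs i).1)]; exact (hs i).2

/-- Only `M * T * M = M` is needed of the inverse: in `frobInner_deviation_le` it inserts `T`
between two copies of `M`, which makes a remainder quadratic. -/
theorem HasThinSVD.exists_pseudoinverse {M : Matrix (Fin m) (Fin n) ℝ} {σ τ : ℝ}
    (h : HasThinSVD M r σ τ) (hσ : 0 < σ) :
    ∃ T : Matrix (Fin n) (Fin m) ℝ, M * T * M = M ∧ ‖T‖ ≤ r / σ := by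
  obtain ⟨Ur, Vr, s, hU, hV, rfl, hs⟩ := h
  refine ⟨Vr * Matrix.diagonal (fun i => (s i)⁻¹) * Urᵀ, ?_, ?_⟩
  · have h1 : Matrix.diagonal s * Matrix.diagonal (fun i => (s i)⁻¹) = 1 := by
      rw [Matrix.diagonal_mul_diagonal, ← Matrix.diagonal_one]
      congr 1
      ext i
      exact mul_inv_cancel₀ (hσ.trans_le (hs i).1).ne'
    calc _ = Ur * (Matrix.diagonal s * (Vrᵀ * Vr) * Matrix.diagonal (fun i => (s i)⁻¹)) *
          (Urᵀ * Ur) * Matrix.diagonal s * Vrᵀ := by simp only [Matrix.mul_assoc]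
      _ = _ := by rw [hU, hV, Matrix.mul_one (Matrix.diagonal s), h1, Matrix.mul_one, Matrix.mul_one]
  · rw [frobenius_norm_mul_transpose_of_isometry _ _ hU, frobenius_norm_mul_of_isometry _ _ hV,
      div_eq_mul_inv]
    refine frobenius_norm_diagonal_le (by positivity) fun i => ?_
    rw [abs_of_nonneg (by have := hσ.trans_le (hs i).1; positivity)]
    exact inv_anti₀ hσ (hs i).1

/-- Near-balanced factors of a matrix close to a rank-`r` matrix are well conditioned. -/
theorem HasThinSVD.factor_lower_bound {M : Matrix (Fin m) (Fin n) ℝ} {σ τ : ℝ}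
    (h : HasThinSVD M r σ τ) (hσ : 0 < σ) {U : Matrix (Fin m) (Fin r) ℝ}
    {V : Matrix (Fin n) (Fin r) ℝ} (hΔ : ‖U * Vᵀ - M‖ ≤ σ / 4)
    (hB : ‖Uᵀ * U - Vᵀ * V‖ ≤ σ / 4) (w : Fin r → ℝ) :
    σ / 2 * (w ⬝ᵥ w) ≤ (U *ᵥ w) ⬝ᵥ (U *ᵥ w) := by
  obtain ⟨Ur, Vr, s, hU, hV, hM, hs⟩ := h
  have hdot : ∀ x : Fin r → ℝ, (Ur *ᵥ x) ⬝ᵥ (U *ᵥ ((Vᵀ * Vr) *ᵥ x)) =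
      x ⬝ᵥ (Matrix.diagonal s *ᵥ x) + (Ur *ᵥ x) ⬝ᵥ ((U * Vᵀ - M) *ᵥ (Vr *ᵥ x)) := by
    intro x
    have h1 : U *ᵥ ((Vᵀ * Vr) *ᵥ x) = M *ᵥ (Vr *ᵥ x) + (U * Vᵀ - M) *ᵥ (Vr *ᵥ x) := by
      rw [← Matrix.add_mulVec, add_sub_cancel]
      simp only [Matrix.mulVec_mulVec, Matrix.mul_assoc]
    have h2 : M *ᵥ (Vr *ᵥ x) = Ur *ᵥ (Matrix.diagonal s *ᵥ x) := by
      rw [hM, Matrix.mulVec_mulVec, Matrix.mul_assoc, hV, Matrix.mul_one, Matrix.mulVec_mulVec]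
    rw [h1, dotProduct_add, h2, Matrix.dotProduct_mulVec, ← Matrix.mulVec_transpose,
      Matrix.mulVec_mulVec, hU, Matrix.one_mulVec]
  -- The diagonal contributes σ and the deviation `U * Vᵀ - M` costs at most σ/4.
  have hlow : ∀ x : Fin r → ℝ,
      3 / 4 * σ * (x ⬝ᵥ x) ≤ (Ur *ᵥ x) ⬝ᵥ (U *ᵥ ((Vᵀ * Vr) *ᵥ x)) := by
    intro x
    have h1 : σ * (x ⬝ᵥ x) ≤ x ⬝ᵥ (Matrix.diagonal s *ᵥ x) := by
      simp only [dotProduct, Matrix.mulVec_diagonal, Finset.mul_sum]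
      refine Finset.sum_le_sum fun i _ => ?_
      nlinarith [mul_self_nonneg (x i), (hs i).1]
    have h2 := sq_dotProduct_le (Ur *ᵥ x) ((U * Vᵀ - M) *ᵥ (Vr *ᵥ x))
    have h3 := dotProduct_self_mulVec_le (U * Vᵀ - M) (Vr *ᵥ x)
    rw [dotProduct_mulVec_self_of_isometry _ hV] at h3
    rw [dotProduct_mulVec_self_of_isometry _ hU] at h2
    have h0 := dotProduct_self_nonneg' x
    have h4 : ((Ur *ᵥ x) ⬝ᵥ ((U * Vᵀ - M) *ᵥ (Vr *ᵥ x))) ^ 2 ≤ (σ / 4 * (x ⬝ᵥ x)) ^ 2 := by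
      refine h2.trans ?_
      have h5 : ‖U * Vᵀ - M‖ ^ 2 ≤ (σ / 4) ^ 2 := pow_le_pow_left₀ (norm_nonneg _) hΔ 2
      calc _ ≤ (x ⬝ᵥ x) * ((σ / 4) ^ 2 * (x ⬝ᵥ x)) := by gcongr; exact h3.trans (by gcongr)
        _ = _ := by ring
    have h6 := abs_le_of_sq_le_sq' h4 (by positivity)
    rw [hdot]
    linarith [h6.1]
  have hinj : Function.Injective (Vᵀ * Vr).mulVec := by
    intro x x' hxx
    have h0 : (Vᵀ * Vr) *ᵥ (x - x') = 0 := by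
      rw [Matrix.mulVec_sub]; exact sub_eq_zero.2 hxx
    have h1 := hlow (x - x')
    rw [h0, Matrix.mulVec_zero, dotProduct_zero] at h1
    have h2 := dotProduct_self_nonneg' (x - x')
    have h3 : (x - x') ⬝ᵥ (x - x') = 0 := le_antisymm (by nlinarith) h2
    exact sub_eq_zero.1 (dotProduct_self_eq_zero.1 h3)
  -- A square injective matrix is onto, so w = VᵀVr x. Then ‖Uw‖ ≥ (3/4)σ‖x‖ and ‖w‖² ≤ ‖Vw‖‖x‖.
  -- Eliminating x bounds ‖Uw‖‖Vw‖ from below (`h11`), and near balance ties ‖Vw‖ to ‖Uw‖.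
  obtain ⟨x, hx⟩ := (Matrix.mulVec_surjective_iff_isUnit.2
    (Matrix.mulVec_injective_iff_isUnit.1 hinj)) w
  have hx' : (Vᵀ * Vr) *ᵥ x = w := hx
  have h1 := hlow x
  rw [hx'] at h1
  have h2 := sq_dotProduct_le (Ur *ᵥ x) (U *ᵥ w)
  rw [dotProduct_mulVec_self_of_isometry _ hU] at h2
  have h3 : w ⬝ᵥ w = (V *ᵥ w) ⬝ᵥ (Vr *ᵥ x) := by
    calc w ⬝ᵥ w = w ⬝ᵥ ((Vᵀ * Vr) *ᵥ x) := by rw [hx']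
      _ = _ := by
        rw [← Matrix.mulVec_mulVec, Matrix.dotProduct_mulVec, Matrix.vecMul_transpose]
  have h4 := sq_dotProduct_le (V *ᵥ w) (Vr *ᵥ x)
  rw [dotProduct_mulVec_self_of_isometry _ hV, ← h3] at h4
  have h5 : (V *ᵥ w) ⬝ᵥ (V *ᵥ w) = (U *ᵥ w) ⬝ᵥ (U *ᵥ w) - w ⬝ᵥ ((Uᵀ * U - Vᵀ * V) *ᵥ w) := by
    rw [Matrix.sub_mulVec, dotProduct_sub, ← Matrix.mulVec_mulVec, ← Matrix.mulVec_mulVec,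
      Matrix.dotProduct_mulVec w Uᵀ, Matrix.vecMul_transpose, Matrix.dotProduct_mulVec w Vᵀ,
      Matrix.vecMul_transpose]
    ring
  have h6 := sq_dotProduct_le w ((Uᵀ * U - Vᵀ * V) *ᵥ w)
  have h7 := dotProduct_self_mulVec_le (Uᵀ * U - Vᵀ * V) w
  have hw := dotProduct_self_nonneg' w
  have hxx := dotProduct_self_nonneg' x
  have h8 : (w ⬝ᵥ ((Uᵀ * U - Vᵀ * V) *ᵥ w)) ^ 2 ≤ (σ / 4 * (w ⬝ᵥ w)) ^ 2 := by
    refine h6.trans ?_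
    have h9 : ‖Uᵀ * U - Vᵀ * V‖ ^ 2 ≤ (σ / 4) ^ 2 := pow_le_pow_left₀ (norm_nonneg _) hB 2
    calc _ ≤ (w ⬝ᵥ w) * ((σ / 4) ^ 2 * (w ⬝ᵥ w)) := by gcongr; exact h7.trans (by gcongr)
      _ = _ := by ring
  have h9 := (abs_le_of_sq_le_sq' h8 (by positivity)).1
  have hp := dotProduct_self_nonneg' (U *ᵥ w)
  have hq := dotProduct_self_nonneg' (V *ᵥ w)
  set p := (U *ᵥ w) ⬝ᵥ (U *ᵥ w)
  set q := (V *ᵥ w) ⬝ᵥ (V *ᵥ w)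
  set X := x ⬝ᵥ x
  set D := w ⬝ᵥ w
  have h10 : (3 / 4 * σ) ^ 2 * X ≤ p := by
    rcases hxx.eq_or_lt with h0 | h0
    · rw [← h0]; simpa using hp
    · refine le_of_mul_le_mul_left ?_ h0
      refine le_trans (le_of_eq ?_) ((pow_le_pow_left₀ (by positivity) h1 2).trans h2)
      ring
  have h11 : (3 / 4 * σ) ^ 2 * D ^ 2 ≤ p * q := by
    calc _ ≤ (3 / 4 * σ) ^ 2 * (q * X) := by gcongr
      _ = (3 / 4 * σ) ^ 2 * X * q := by ring
      _ ≤ _ := by gcongr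
  -- Otherwise ‖Uw‖²‖Vw‖² would be at most (3/8)σ²‖w‖⁴, against the lower bound (9/16)σ²‖w‖⁴.
  by_contra! hc
  have h12 : q ≤ 3 / 4 * σ * D := by linarith
  have h13 : p * q ≤ σ / 2 * D * (3 / 4 * σ * D) := mul_le_mul hc.le h12 hq (by positivity)
  have hD : 0 < D := by
    rcases hw.eq_or_lt with h0 | h0
    · rw [← h0] at hc; simp only [mul_zero] at hc; linarith
    · exact h0
  nlinarith [mul_pos (mul_pos hσ hσ) (mul_pos hD hD)]

/-- Orthogonal projection onto the column space of a matrix of full column rank. -/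
theorem exists_projection (U : Matrix (Fin m) (Fin r) ℝ) {c : ℝ} (hc : 0 < c)
    (hU : ∀ w, c * (w ⬝ᵥ w) ≤ (U *ᵥ w) ⬝ᵥ (U *ᵥ w)) :
    ∃ R : Matrix (Fin r) (Fin m) ℝ,
      (U * R)ᵀ = U * R ∧ U * R * (U * R) = U * R ∧ U * R * U = U := by
  have hinj : Function.Injective (Uᵀ * U).mulVec := by
    intro x x' hxx
    have h0 : (Uᵀ * U) *ᵥ (x - x') = 0 := by
      rw [Matrix.mulVec_sub]; exact sub_eq_zero.2 hxx
    have h1 := hU (x - x')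
    have h2 : (U *ᵥ (x - x')) ⬝ᵥ (U *ᵥ (x - x')) = 0 := by
      rw [Matrix.dotProduct_mulVec, ← Matrix.mulVec_transpose, Matrix.mulVec_mulVec, h0,
        zero_dotProduct]
    rw [h2] at h1
    have h3 := dotProduct_self_nonneg' (x - x')
    exact sub_eq_zero.1 (dotProduct_self_eq_zero.1 (le_antisymm (by nlinarith) h3))
  have hu := (Matrix.isUnit_iff_isUnit_det _).1 (Matrix.mulVec_injective_iff_isUnit.1 hinj)
  have hRU : (Uᵀ * U)⁻¹ * Uᵀ * U = 1 := by
    rw [Matrix.mul_assoc, Matrix.nonsing_inv_mul _ hu]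
  refine ⟨(Uᵀ * U)⁻¹ * Uᵀ, ?_, ?_, ?_⟩
  · rw [Matrix.transpose_mul, Matrix.transpose_mul, Matrix.transpose_nonsing_inv,
      Matrix.transpose_mul, Matrix.transpose_transpose, Matrix.mul_assoc]
  · rw [Matrix.mul_assoc, ← Matrix.mul_assoc _ U, hRU, Matrix.one_mul]
  · rw [Matrix.mul_assoc, hRU, Matrix.mul_one]

/-- The component of `G` along the deviation `U Vᵀ - M` is controlled by `Gᵀ U` and `G V`, up to a
term that is quadratic in the deviation. -/
theorem frobInner_deviation_le (G M : Matrix (Fin m) (Fin n) ℝ) (U : Matrix (Fin m) (Fin r) ℝ)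
    (V : Matrix (Fin n) (Fin r) ℝ) {c : ℝ} (hc : 0 < c)
    (hU : ∀ w, c ^ 2 * (w ⬝ᵥ w) ≤ (U *ᵥ w) ⬝ᵥ (U *ᵥ w))
    (hV : ∀ w, c ^ 2 * (w ⬝ᵥ w) ≤ (V *ᵥ w) ⬝ᵥ (V *ᵥ w)) {T : Matrix (Fin n) (Fin m) ℝ}
    (hT : M * T * M = M) :
    frobInner G (U * Vᵀ - M) ≤ (‖Gᵀ * U‖ + ‖G * V‖) / c * ‖U * Vᵀ - M‖ +
      ‖G‖ * ‖T‖ * ‖U * Vᵀ - M‖ ^ 2 := by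
  obtain ⟨R, hPs, hPi, hPU⟩ := exists_projection U (by positivity) hU
  obtain ⟨R', hQs, hQi, hQV⟩ := exists_projection V (by positivity) hV
  set P := U * R with hP
  set Q := V * R' with hQ
  set D := U * Vᵀ - M with hD
  have hVQ : Vᵀ * Q = Vᵀ := by
    rw [← hQs, ← Matrix.transpose_mul, hQV]
  have hPM : (1 - P) * M = -((1 - P) * D) := by
    rw [hD, Matrix.mul_sub, ← Matrix.mul_assoc, Matrix.sub_mul 1 P U, hPU, Matrix.one_mul]
    simp
  have hMQ : M * (1 - Q) = -(D * (1 - Q)) := by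
    rw [hD, Matrix.sub_mul, Matrix.mul_assoc U, Matrix.mul_sub Vᵀ, hVQ, Matrix.mul_one]
    simp
  -- Projecting on both sides kills `U * Vᵀ`, so the block is minus that of `M`. Writing M = MTM and
  -- applying `hPM` and `hMQ` puts a copy of `D` on each side of `T`.
  have hrem : (1 - P) * D * (1 - Q) = -((1 - P) * D * T * (D * (1 - Q))) := by
    calc (1 - P) * D * (1 - Q) = -((1 - P) * M * (1 - Q)) := by rw [hPM]; simp
      _ = -((1 - P) * M * T * (M * (1 - Q))) := by
        conv_lhs => rw [← hT]
        simp only [Matrix.mul_assoc]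
      _ = _ := by rw [hPM, hMQ]; simp
  have hdec : D = P * D + (1 - P) * D * Q + (1 - P) * D * (1 - Q) := by
    rw [add_assoc, ← Matrix.mul_add, add_sub_cancel, Matrix.mul_one, ← Matrix.add_mul,
      add_sub_cancel, Matrix.one_mul]
  have hlow : ∀ {m k : ℕ} (A : Matrix (Fin m) (Fin r) ℝ) (X : Matrix (Fin r) (Fin k) ℝ) (b : ℝ),
      (∀ w, c ^ 2 * (w ⬝ᵥ w) ≤ (A *ᵥ w) ⬝ᵥ (A *ᵥ w)) → ‖A * X‖ ≤ b → ‖X‖ ≤ b / c := by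
    intro m k A X b hA hb
    have h1 := le_frobenius_norm_sq_mul A _ hA X
    rw [le_div_iff₀ hc]
    refine le_trans ?_ hb
    refine le_of_sq_le_sq ?_ (norm_nonneg _)
    linarith [mul_pow ‖X‖ c 2]
  -- Since PD = U(RD), the pairing sees only `Uᵀ * G`, and the lower bound on U gives ‖RD‖ ≤ ‖PD‖/c.
  have h1 : frobInner G (P * D) ≤ ‖Gᵀ * U‖ * (‖D‖ / c) := by
    rw [frobInner_comm, hP, Matrix.mul_assoc, frobInner_mul_left, frobInner_comm]
    refine (frobInner_le _ _).trans ?_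
    have e1 : ‖Uᵀ * G‖ = ‖Gᵀ * U‖ := by
      rw [← Matrix.frobenius_norm_transpose]; simp
    rw [e1]
    gcongr
    refine hlow U _ _ hU ?_
    rw [← Matrix.mul_assoc]
    exact frobenius_norm_projection_le P hPs hPi D
  have h2 : frobInner G ((1 - P) * D * Q) ≤ ‖G * V‖ * (‖D‖ / c) := by
    rw [frobInner_comm, ← hQs, hQ, Matrix.transpose_mul, ← Matrix.mul_assoc, frobInner_mul_left',
      frobInner_comm, Matrix.transpose_transpose]
    refine (frobInner_le _ _).trans ?_
    gcongr
    rw [← Matrix.frobenius_norm_transpose, Matrix.transpose_mul, Matrix.transpose_transpose]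
    refine hlow V _ _ hV ?_
    rw [← Matrix.mul_assoc]
    refine (frobenius_norm_projection_le Q hQs hQi _).trans ?_
    rw [Matrix.frobenius_norm_transpose]
    exact frobenius_norm_compl_projection_le P hPs hPi D
  have h3 : frobInner G ((1 - P) * D * (1 - Q)) ≤ ‖G‖ * (‖D‖ * ‖T‖ * ‖D‖) := by
    refine (frobInner_le _ _).trans ?_
    rw [hrem, norm_neg]
    gcongr
    refine (frobenius_norm_mul_le _ _).trans ?_
    gcongr
    · refine (frobenius_norm_mul_le _ _).trans ?_
      gcongr
      exact frobenius_norm_compl_projection_le P hPs hPi D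
    · exact frobenius_norm_mul_compl_projection_le Q hQs hQi D
  calc frobInner G D = frobInner G (P * D) + frobInner G ((1 - P) * D * Q) +
        frobInner G ((1 - P) * D * (1 - Q)) := by
        rw [← frobInner_add_right, ← frobInner_add_right, ← hdec]
    _ ≤ _ := add_le_add (add_le_add h1 h2) h3
    _ = _ := by ring

/-- The gradient of the factored objective in its left factor. -/
noncomputable def factoredGrad (G : Matrix (Fin m) (Fin n) ℝ → Matrix (Fin m) (Fin n) ℝ)
    (U : Matrix (Fin m) (Fin r) ℝ) (V : Matrix (Fin n) (Fin r) ℝ) : Matrix (Fin m) (Fin r) ℝ :=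
  G (U * Vᵀ) * V + (1 / 2 : ℝ) • (U * (Uᵀ * U - Vᵀ * V))

/-- With B the imbalance, pair `gU` with UB and `gV` with −VB. The loss terms ⟨UB, GV⟩ and ⟨VB, GᵀU⟩
are equal and cancel, leaving half of the left side; Young's inequality finishes. -/
theorem imbalance_mul_sq_le (G : Matrix (Fin m) (Fin n) ℝ) (U : Matrix (Fin m) (Fin r) ℝ)
    (V : Matrix (Fin n) (Fin r) ℝ) {gU : Matrix (Fin m) (Fin r) ℝ} {gV : Matrix (Fin n) (Fin r) ℝ}
    (hU : gU = G * V + (1 / 2 : ℝ) • (U * (Uᵀ * U - Vᵀ * V)))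
    (hV : gV = Gᵀ * U + (1 / 2 : ℝ) • (V * (Vᵀ * V - Uᵀ * U))) :
    ‖U * (Uᵀ * U - Vᵀ * V)‖ ^ 2 + ‖V * (Uᵀ * U - Vᵀ * V)‖ ^ 2 ≤ 4 * (‖gU‖ ^ 2 + ‖gV‖ ^ 2) := by
  have hBt : (Uᵀ * U - Vᵀ * V)ᵀ = Uᵀ * U - Vᵀ * V := by simp
  have hneg : Vᵀ * V - Uᵀ * U = -(Uᵀ * U - Vᵀ * V) := by simp
  rw [hneg] at hV
  generalize Uᵀ * U - Vᵀ * V = B at *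
  have h1 : frobInner (U * B) (G * V) = frobInner (V * B) (Gᵀ * U) := by
    rw [frobInner_mul_left', hBt, frobInner_comm (V * B), frobInner_mul_left,
      Matrix.transpose_transpose, Matrix.mul_assoc]
  have h2 : frobInner (U * B) gU - frobInner (V * B) gV =
      1 / 2 * (‖U * B‖ ^ 2 + ‖V * B‖ ^ 2) := by
    rw [hU, hV, frobInner_add_right, frobInner_add_right, h1, frobInner_smul_right,
      frobInner_smul_right, Matrix.mul_neg, frobInner_neg_right, frobenius_norm_sq,
      frobenius_norm_sq]
    ring
  have h3 := frobInner_le (U * B) gU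
  have h4 := (abs_le.1 (abs_frobInner_le (V * B) gV)).1
  nlinarith [sq_nonneg (‖U * B‖ - 2 * ‖gU‖), sq_nonneg (‖V * B‖ - 2 * ‖gV‖)]

/-- The regularizer's share of the gradient is removed by the triangle inequality, at a cost bounded
by `imbalance_mul_sq_le`. -/
theorem gradient_mul_sq_le (G : Matrix (Fin m) (Fin n) ℝ) (U : Matrix (Fin m) (Fin r) ℝ)
    (V : Matrix (Fin n) (Fin r) ℝ) {gU : Matrix (Fin m) (Fin r) ℝ} {gV : Matrix (Fin n) (Fin r) ℝ}
    (hU : gU = G * V + (1 / 2 : ℝ) • (U * (Uᵀ * U - Vᵀ * V)))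
    (hV : gV = Gᵀ * U + (1 / 2 : ℝ) • (V * (Vᵀ * V - Uᵀ * U))) :
    ‖G * V‖ ^ 2 + ‖Gᵀ * U‖ ^ 2 ≤ 4 * (‖gU‖ ^ 2 + ‖gV‖ ^ 2) := by
  have h0 := imbalance_mul_sq_le G U V hU hV
  have hneg : V * (Vᵀ * V - Uᵀ * U) = -(V * (Uᵀ * U - Vᵀ * V)) := by
    rw [← Matrix.mul_neg, neg_sub]
  rw [hneg] at hV
  generalize U * (Uᵀ * U - Vᵀ * V) = X at *
  generalize V * (Uᵀ * U - Vᵀ * V) = Y at *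
  have e1 : G * V = gU - (1 / 2 : ℝ) • X := by rw [hU]; simp
  have e2 : Gᵀ * U = gV - (1 / 2 : ℝ) • (-Y) := by rw [hV]; simp
  have h1 : ‖G * V‖ ≤ ‖gU‖ + 1 / 2 * ‖X‖ := by
    rw [e1]; refine (norm_sub_le _ _).trans ?_
    rw [frobenius_norm_smul, abs_of_pos (by norm_num)]
  have h2 : ‖Gᵀ * U‖ ≤ ‖gV‖ + 1 / 2 * ‖Y‖ := by
    rw [e2]; refine (norm_sub_le _ _).trans ?_
    rw [frobenius_norm_smul, abs_of_pos (by norm_num), norm_neg]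
  have h3 := pow_le_pow_left₀ (norm_nonneg _) h1 2
  have h4 := pow_le_pow_left₀ (norm_nonneg _) h2 2
  nlinarith [sq_nonneg (‖gU‖ - 1 / 2 * ‖X‖), sq_nonneg (‖gV‖ - 1 / 2 * ‖Y‖)]

theorem norm_gram_sub_le (U H : Matrix (Fin m) (Fin r) ℝ) (W : Matrix (Fin r) (Fin r) ℝ) :
    ‖((U + H)ᵀ * (U + H) - W) - (Uᵀ * U - W)‖ ≤ (2 * ‖U‖ + ‖H‖) * ‖H‖ := by
  have e : ((U + H)ᵀ * (U + H) - W) - (Uᵀ * U - W) = Hᵀ * U + Uᵀ * H + Hᵀ * H := by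
    simp only [Matrix.transpose_add, Matrix.add_mul, Matrix.mul_add]
    abel
  rw [e]
  have h1 := frobenius_norm_mul_le Hᵀ U
  have h2 := frobenius_norm_mul_le Uᵀ H
  have h3 := frobenius_norm_mul_le Hᵀ H
  rw [Matrix.frobenius_norm_transpose] at h1 h2 h3
  linarith [norm_add_le (Hᵀ * U + Uᵀ * H) (Hᵀ * H), norm_add_le (Hᵀ * U) (Uᵀ * H)]

/-- Second-order expansion of the factored objective in its left factor. -/
theorem IsRegularLoss.factoredObjective_expansion {L : Matrix (Fin m) (Fin n) ℝ → ℝ} {G Θs}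
    {α β : ℝ} (h : IsRegularLoss L G Θs α β) (U H : Matrix (Fin m) (Fin r) ℝ)
    (V : Matrix (Fin n) (Fin r) ℝ) (hβ : 0 ≤ β) :
    |factoredObjective L (U + H) V - factoredObjective L U V - frobInner (factoredGrad G U V) H| ≤
      (β / 2 * ‖V‖ ^ 2 + 1 / 4 * ‖Uᵀ * U - Vᵀ * V‖ + 1 / 8 * (2 * ‖U‖ + ‖H‖) ^ 2) * ‖H‖ ^ 2 := by
  have hBt : (Uᵀ * U - Vᵀ * V)ᵀ = Uᵀ * U - Vᵀ * V := by simp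
  have hd := norm_gram_sub_le U H (Vᵀ * V)
  have e : ((U + H)ᵀ * (U + H) - Vᵀ * V) - (Uᵀ * U - Vᵀ * V) = Hᵀ * U + Uᵀ * H + Hᵀ * H := by
    simp only [Matrix.transpose_add, Matrix.add_mul, Matrix.mul_add]
    abel
  have e' : (U + H)ᵀ * (U + H) - Vᵀ * V =
      (Uᵀ * U - Vᵀ * V) + (Hᵀ * U + Uᵀ * H + Hᵀ * H) := by
    rw [← e]; abel
  rw [e] at hd
  -- The imbalance is symmetric, so both cross terms agree; 1/8 · 2 · 2 is the coefficient 1/2 in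
  -- `factoredGrad`.
  have hin : frobInner (Uᵀ * U - Vᵀ * V) (Hᵀ * U + Uᵀ * H) =
      2 * frobInner (U * (Uᵀ * U - Vᵀ * V)) H := by
    rw [frobInner_add_right, frobInner_mul_left]
    have : frobInner (Uᵀ * U - Vᵀ * V) (Hᵀ * U) = frobInner (Uᵀ * U - Vᵀ * V) (Uᵀ * H) := by
      rw [← frobInner_transpose, hBt]; simp
    rw [this]; ring
  have hL1 := h.upper (U * Vᵀ) (H * Vᵀ)
  have hL2 := h.lower (U * Vᵀ) (H * Vᵀ)
  rw [frobInner_comm, frobInner_mul_left', Matrix.transpose_transpose, frobInner_comm,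
    ← Matrix.add_mul] at hL1 hL2
  have hHV : ‖H * Vᵀ‖ ^ 2 ≤ (‖H‖ * ‖V‖) ^ 2 := by
    refine pow_le_pow_left₀ (norm_nonneg _) ?_ 2
    simpa [Matrix.frobenius_norm_transpose] using frobenius_norm_mul_le H Vᵀ
  have hHH : ‖Hᵀ * H‖ ≤ ‖H‖ * ‖H‖ := by
    simpa [Matrix.frobenius_norm_transpose] using frobenius_norm_mul_le Hᵀ H
  have hBH := abs_frobInner_le (Uᵀ * U - Vᵀ * V) (Hᵀ * H)
  have hBH' : |frobInner (Uᵀ * U - Vᵀ * V) (Hᵀ * H)| ≤ ‖Uᵀ * U - Vᵀ * V‖ * ‖H‖ ^ 2 :=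
    hBH.trans (by rw [sq]; gcongr)
  have hd2 := pow_le_pow_left₀ (norm_nonneg _) hd 2
  have hd0 := sq_nonneg ‖Hᵀ * U + Uᵀ * H + Hᵀ * H‖
  have hβ' : β / 2 * ‖H * Vᵀ‖ ^ 2 ≤ β / 2 * (‖H‖ * ‖V‖) ^ 2 := by gcongr
  have h0 : 0 ≤ β / 2 * (‖H‖ * ‖V‖) ^ 2 := by positivity
  unfold factoredObjective factoredGrad
  rw [e', frobenius_norm_add_sq, frobInner_add_right _ _ (Hᵀ * H), hin, frobInner_add_left,
    frobInner_smul_left]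
  rw [abs_le] at hBH' ⊢
  constructor <;> nlinarith [hBH'.1, hBH'.2]

/-- Turns the two-sided bound of `IsRegularLoss.factoredObjective_expansion` into partial
derivatives, so that no separate differentiability of the loss is required. -/
theorem hasDerivAt_zero_of_quadratic {h : ℝ → ℝ} {d C : ℝ}
    (hb : ∀ t, |t| ≤ 1 → |h t - h 0 - t * d| ≤ C * t ^ 2) : HasDerivAt h d 0 := by
  rw [hasDerivAt_iff_isLittleO_nhds_zero]
  have h1 : (fun t : ℝ => h (0 + t) - h 0 - t • d) =O[nhds 0] fun t => t ^ 2 := by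
    refine Asymptotics.IsBigO.of_bound C ?_
    filter_upwards [Metric.ball_mem_nhds (0 : ℝ) one_pos] with t ht
    rw [zero_add, smul_eq_mul, Real.norm_eq_abs, Real.norm_eq_abs, abs_of_nonneg (sq_nonneg t)]
    exact hb t (by simpa using (mem_ball_zero_iff.1 ht).le)
  refine h1.trans_isLittleO ?_
  simpa using Asymptotics.isLittleO_pow_pow (𝕜 := ℝ) (m := 1) (n := 2) (by norm_num)

theorem frobInner_single (A : Matrix (Fin m) (Fin n) ℝ) (i : Fin m) (j : Fin n) :
    frobInner A (Matrix.single i j 1) = A i j := by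
  rw [frobInner, Finset.sum_eq_single i, Finset.sum_eq_single j]
  · simp
  · intro b _ hb; simp [Ne.symm hb]
  · simp
  · intro b _ hb; simp [Ne.symm hb]
  · simp

theorem IsRegularLoss.matGrad_left {L : Matrix (Fin m) (Fin n) ℝ → ℝ} {G Θs} {α β : ℝ}
    (h : IsRegularLoss L G Θs α β) (hβ : 0 ≤ β) (U : Matrix (Fin m) (Fin r) ℝ)
    (V : Matrix (Fin n) (Fin r) ℝ) :
    matGrad (fun X => factoredObjective L X V) U = factoredGrad G U V := by
  ext i j
  rw [matGrad, Matrix.of_apply, ← frobInner_single (factoredGrad G U V) i j]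
  set E : Matrix (Fin m) (Fin r) ℝ := Matrix.single i j 1
  refine (hasDerivAt_zero_of_quadratic (C := (β / 2 * ‖V‖ ^ 2 + 1 / 4 * ‖Uᵀ * U - Vᵀ * V‖ +
    1 / 8 * (2 * ‖U‖ + ‖E‖) ^ 2) * ‖E‖ ^ 2) fun t ht => ?_).deriv
  have h1 := h.factoredObjective_expansion U (t • E) V hβ
  rw [frobInner_smul_right, frobenius_norm_smul] at h1
  simp only [zero_smul, add_zero]
  refine h1.trans ?_
  have h2 : |t| * ‖E‖ ≤ ‖E‖ := mul_le_of_le_one_left (norm_nonneg _) ht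
  calc _ ≤ (β / 2 * ‖V‖ ^ 2 + 1 / 4 * ‖Uᵀ * U - Vᵀ * V‖ +
    1 / 8 * (2 * ‖U‖ + ‖E‖) ^ 2) * (|t| * ‖E‖) ^ 2 := by gcongr
    _ = _ := by rw [mul_pow, sq_abs]; ring

theorem factoredObjective_transpose (L : Matrix (Fin m) (Fin n) ℝ → ℝ)
    (U : Matrix (Fin m) (Fin r) ℝ) (V : Matrix (Fin n) (Fin r) ℝ) :
    factoredObjective L U V = factoredObjective (fun Θ => L Θᵀ) V U := by
  simp [factoredObjective, norm_sub_rev]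

theorem IsRegularLoss.matGrad_right {L : Matrix (Fin m) (Fin n) ℝ → ℝ} {G Θs} {α β : ℝ}
    (h : IsRegularLoss L G Θs α β) (hβ : 0 ≤ β) (U : Matrix (Fin m) (Fin r) ℝ)
    (V : Matrix (Fin n) (Fin r) ℝ) :
    matGrad (fun Y => factoredObjective L U Y) V = factoredGrad (fun Θ => (G Θᵀ)ᵀ) V U := by
  rw [← h.transpose.matGrad_left hβ]
  congr 1
  ext Y
  exact factoredObjective_transpose L U Y

end Factored

/-! ### Local convergence: gradient domination, descent steps, linear rate. -/

section Descent

variable {m n r : ℕ}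

/-- The local regime of factored gradient descent: a regular loss around a rank-`r` matrix `Θs` with
singular values in `[σ, τ]`, the gradient at `Θs` being bounded by `e`; the iterates will stay in
the region of radius `ρ * σ`. -/
structure LocalRegime (L : Matrix (Fin m) (Fin n) ℝ → ℝ)
    (G : Matrix (Fin m) (Fin n) ℝ → Matrix (Fin m) (Fin n) ℝ) (Θs : Matrix (Fin m) (Fin n) ℝ)
    (r : ℕ) (α β d σ τ ρ e : ℝ) : Prop where
  loss : IsRegularLoss L G Θs α β
  thin : HasThinSVD Θs r σ τ
  α_pos : 0 < α
  α_le : α ≤ 1 / 4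
  β_nonneg : 0 ≤ β
  one_le_d : 1 ≤ d
  r_le : (r : ℝ) ≤ d
  σ_pos : 0 < σ
  σ_le : σ ≤ τ
  ρ_pos : 0 < ρ
  ρ_le : ρ ≤ 1 / 16
  dρ_le : d * ρ ≤ 1
  dρβ_le : d * ρ * β ≤ α / 4
  ρσ_le : 2 * (ρ * σ) ≤ 1
  grad_le : ‖G Θs‖ ≤ e
  e_le : e ≤ α / 8 * (ρ * σ)

theorem LocalRegime.transpose {L : Matrix (Fin m) (Fin n) ℝ → ℝ} {G Θs} {α β d σ τ ρ e : ℝ}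
    (H : LocalRegime L G Θs r α β d σ τ ρ e) :
    LocalRegime (fun Θ => L Θᵀ) (fun Θ => (G Θᵀ)ᵀ) Θsᵀ r α β d σ τ ρ e :=
  { H with
    loss := H.loss.transpose
    thin := H.thin.transpose
    grad_le := by
      rw [Matrix.frobenius_norm_transpose, Matrix.transpose_transpose]; exact H.grad_le }

/-- The pair `(U, V)` is nearly balanced and `U Vᵀ` is close to `Θs`. -/
def InRegion (Θs : Matrix (Fin m) (Fin n) ℝ) (δ : ℝ) (U : Matrix (Fin m) (Fin r) ℝ)
    (V : Matrix (Fin n) (Fin r) ℝ) : Prop :=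
  ‖U * Vᵀ - Θs‖ ≤ δ ∧ ‖Uᵀ * U - Vᵀ * V‖ ≤ δ

theorem InRegion.transpose {Θs : Matrix (Fin m) (Fin n) ℝ} {δ : ℝ} {U : Matrix (Fin m) (Fin r) ℝ}
    {V : Matrix (Fin n) (Fin r) ℝ} (h : InRegion Θs δ U V) : InRegion Θsᵀ δ V U := by
  constructor
  · rw [← Matrix.frobenius_norm_transpose]; simpa using h.1
  · rw [norm_sub_rev]; exact h.2

variable {L : Matrix (Fin m) (Fin n) ℝ → ℝ}
  {G : Matrix (Fin m) (Fin n) ℝ → Matrix (Fin m) (Fin n) ℝ} {Θs : Matrix (Fin m) (Fin n) ℝ}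
  {α β d σ τ ρ e : ℝ} {U : Matrix (Fin m) (Fin r) ℝ} {V : Matrix (Fin n) (Fin r) ℝ}

theorem LocalRegime.e_nonneg (H : LocalRegime L G Θs r α β d σ τ ρ e) : 0 ≤ e :=
  (norm_nonneg _).trans H.grad_le

theorem LocalRegime.region_le (H : LocalRegime L G Θs r α β d σ τ ρ e) : ρ * σ ≤ σ / 16 := by
  nlinarith [H.ρ_le, H.σ_pos]

theorem LocalRegime.norm_target_le (H : LocalRegime L G Θs r α β d σ τ ρ e) : ‖Θs‖ ≤ d * τ := by
  have hτ : 0 ≤ τ := H.σ_pos.le.trans H.σ_le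
  exact (H.thin.norm_le H.σ_pos.le hτ).trans (by gcongr; exact H.r_le)

/-- Expanding ‖UᵀU − VᵀV‖² gives ‖UᵀU‖² ≤ 2‖UVᵀ‖² + (ρσ)². Then ‖U‖² = ⟨1, UᵀU⟩, and the identity
has norm at most d. -/
theorem LocalRegime.norm_left_sq_le (H : LocalRegime L G Θs r α β d σ τ ρ e)
    (h : InRegion Θs (ρ * σ) U V) : ‖U‖ ^ 2 ≤ 2 * d ^ 2 * τ := by
  have hτ : 0 < τ := H.σ_pos.trans_le H.σ_le
  have hd : 0 < d := one_pos.trans_le H.one_le_d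
  have hρσ : ρ * σ ≤ τ / 16 := H.region_le.trans (by linarith [H.σ_le])
  have h1 : frobInner (Uᵀ * U) (Vᵀ * V) = ‖U * Vᵀ‖ ^ 2 := by
    rw [frobInner_mul_left, Matrix.transpose_transpose, frobenius_norm_sq, frobInner_mul_left',
      Matrix.transpose_transpose, Matrix.mul_assoc]
  have h2 := frobenius_norm_sub_sq (Uᵀ * U) (Vᵀ * V)
  rw [h1] at h2
  have h3 : ‖U * Vᵀ‖ ≤ 17 / 16 * (d * τ) := by
    have h4 : ‖U * Vᵀ‖ ≤ ‖U * Vᵀ - Θs‖ + ‖Θs‖ := norm_le_norm_sub_add _ _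
    have : τ ≤ d * τ := le_mul_of_one_le_left hτ.le H.one_le_d
    linarith [h.1, H.norm_target_le]
  have h4 : ‖Uᵀ * U‖ ≤ 2 * (d * τ) := by
    refine le_of_sq_le_sq ?_ (by positivity)
    have h5 := pow_le_pow_left₀ (norm_nonneg _) h3 2
    have h6 := pow_le_pow_left₀ (norm_nonneg _) (h.2.trans hρσ) 2
    have h7 : τ ^ 2 ≤ (d * τ) ^ 2 :=
      pow_le_pow_left₀ hτ.le (le_mul_of_one_le_left hτ.le H.one_le_d) 2
    nlinarith [sq_nonneg ‖Vᵀ * V‖]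
  have h5 : ‖U‖ ^ 2 = frobInner 1 (Uᵀ * U) := by
    rw [frobInner_comm, frobInner_mul_left, Matrix.transpose_transpose, Matrix.mul_one,
      frobenius_norm_sq]
  have h6 : ‖(1 : Matrix (Fin r) (Fin r) ℝ)‖ ≤ d := by
    rw [← Matrix.diagonal_one]
    refine (frobenius_norm_diagonal_le (c := 1) zero_le_one (by simp)).trans ?_
    rw [mul_one]; exact H.r_le
  calc ‖U‖ ^ 2 ≤ ‖(1 : Matrix (Fin r) (Fin r) ℝ)‖ * ‖Uᵀ * U‖ := h5 ▸ frobInner_le _ _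
    _ ≤ d * (2 * (d * τ)) := by gcongr
    _ = _ := by ring

theorem LocalRegime.norm_right_sq_le (H : LocalRegime L G Θs r α β d σ τ ρ e)
    (h : InRegion Θs (ρ * σ) U V) : ‖V‖ ^ 2 ≤ 2 * d ^ 2 * τ :=
  H.transpose.norm_left_sq_le h.transpose

theorem LocalRegime.norm_grad_le (H : LocalRegime L G Θs r α β d σ τ ρ e)
    (Θ : Matrix (Fin m) (Fin n) ℝ) : ‖G Θ‖ ≤ e + β * ‖Θ - Θs‖ := by
  have h1 : ‖G Θ‖ ≤ ‖G Θ - G Θs‖ + ‖G Θs‖ := norm_le_norm_sub_add _ _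
  linarith [H.loss.lipschitz Θ Θs, H.grad_le]

/-- The excess of the factored objective over the loss at the target. -/
noncomputable def excess (L : Matrix (Fin m) (Fin n) ℝ → ℝ) (Θs : Matrix (Fin m) (Fin n) ℝ)
    (U : Matrix (Fin m) (Fin r) ℝ) (V : Matrix (Fin n) (Fin r) ℝ) : ℝ :=
  factoredObjective L U V - L Θs

theorem excess_transpose (L : Matrix (Fin m) (Fin n) ℝ → ℝ) (Θs : Matrix (Fin m) (Fin n) ℝ)
    (U : Matrix (Fin m) (Fin r) ℝ) (V : Matrix (Fin n) (Fin r) ℝ) :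
    excess L Θs U V = excess (fun Θ => L Θᵀ) Θsᵀ V U := by
  rw [excess, excess, factoredObjective_transpose]; simp

theorem LocalRegime.excess_le (H : LocalRegime L G Θs r α β d σ τ ρ e)
    (U : Matrix (Fin m) (Fin r) ℝ) (V : Matrix (Fin n) (Fin r) ℝ) :
    excess L Θs U V ≤ e * ‖U * Vᵀ - Θs‖ + β / 2 * ‖U * Vᵀ - Θs‖ ^ 2 +
      1 / 8 * ‖Uᵀ * U - Vᵀ * V‖ ^ 2 := by
  have h1 := H.loss.upper Θs (U * Vᵀ - Θs)
  rw [add_sub_cancel] at h1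
  have h2 := frobInner_le (G Θs) (U * Vᵀ - Θs)
  have h3 := mul_le_mul_of_nonneg_right H.grad_le (norm_nonneg (U * Vᵀ - Θs))
  unfold excess factoredObjective
  linarith

theorem LocalRegime.le_excess (H : LocalRegime L G Θs r α β d σ τ ρ e)
    (h : ‖U * Vᵀ - Θs‖ ≤ 1) :
    α / 2 * ‖U * Vᵀ - Θs‖ ^ 2 + 1 / 8 * ‖Uᵀ * U - Vᵀ * V‖ ^ 2 ≤
      excess L Θs U V + e * ‖U * Vᵀ - Θs‖ := by
  have h1 := H.loss.strong_above _ h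
  have h2 := (abs_le.1 (abs_frobInner_le (G Θs) (U * Vᵀ - Θs))).1
  have h3 := mul_le_mul_of_nonneg_right H.grad_le (norm_nonneg (U * Vᵀ - Θs))
  unfold excess factoredObjective
  linarith

/-- The squared norm of the full gradient of the factored objective. -/
noncomputable def gradSq (G : Matrix (Fin m) (Fin n) ℝ → Matrix (Fin m) (Fin n) ℝ)
    (U : Matrix (Fin m) (Fin r) ℝ) (V : Matrix (Fin n) (Fin r) ℝ) : ℝ :=
  ‖factoredGrad G U V‖ ^ 2 + ‖factoredGrad (fun Θ => (G Θᵀ)ᵀ) V U‖ ^ 2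

theorem gradSq_nonneg (G : Matrix (Fin m) (Fin n) ℝ → Matrix (Fin m) (Fin n) ℝ)
    (U : Matrix (Fin m) (Fin r) ℝ) (V : Matrix (Fin n) (Fin r) ℝ) : 0 ≤ gradSq G U V := by
  unfold gradSq; positivity

theorem LocalRegime.left_lower_bound (H : LocalRegime L G Θs r α β d σ τ ρ e)
    (h : InRegion Θs (ρ * σ) U V) (w : Fin r → ℝ) :
    σ / 2 * (w ⬝ᵥ w) ≤ (U *ᵥ w) ⬝ᵥ (U *ᵥ w) :=
  have h0 : ρ * σ ≤ σ / 4 := H.region_le.trans (by linarith [H.σ_pos])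
  H.thin.factor_lower_bound H.σ_pos (h.1.trans h0) (h.2.trans h0) w

theorem LocalRegime.right_lower_bound (H : LocalRegime L G Θs r α β d σ τ ρ e)
    (h : InRegion Θs (ρ * σ) U V) (w : Fin r → ℝ) :
    σ / 2 * (w ⬝ᵥ w) ≤ (V *ᵥ w) ⬝ᵥ (V *ᵥ w) :=
  H.transpose.left_lower_bound h.transpose w

theorem factoredGrad_transpose_eq (G : Matrix (Fin m) (Fin n) ℝ → Matrix (Fin m) (Fin n) ℝ)
    (U : Matrix (Fin m) (Fin r) ℝ) (V : Matrix (Fin n) (Fin r) ℝ) :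
    factoredGrad (fun Θ => (G Θᵀ)ᵀ) V U =
      (G (U * Vᵀ))ᵀ * U + (1 / 2 : ℝ) • (V * (Vᵀ * V - Uᵀ * U)) := by
  simp [factoredGrad]

theorem LocalRegime.imbalance_sq_le (H : LocalRegime L G Θs r α β d σ τ ρ e)
    (h : InRegion Θs (ρ * σ) U V) : ‖Uᵀ * U - Vᵀ * V‖ ^ 2 ≤ 4 * (gradSq G U V / σ) := by
  have h1 := imbalance_mul_sq_le (G (U * Vᵀ)) U V rfl (factoredGrad_transpose_eq G U V)
  have h2 := le_frobenius_norm_sq_mul U _ (H.left_lower_bound h) (Uᵀ * U - Vᵀ * V)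
  have h3 := le_frobenius_norm_sq_mul V _ (H.right_lower_bound h) (Uᵀ * U - Vᵀ * V)
  rw [mul_div_assoc', le_div_iff₀ H.σ_pos]
  change _ ≤ 4 * gradSq G U V at h1
  linarith

/-- Write Δ = UVᵀ − Θs and u = ‖Δ‖. The sum of the two strong convexity inequalities is αu² ≤
⟨G(UVᵀ) − G(Θs), Δ⟩. The pairing with G(UVᵀ) is bounded by `frobInner_deviation_le`, whose remainder
is absorbed because u ≤ ρσ with dρ ≤ 1 and dρβ ≤ α/4; the pairing with G(Θs) costs at most eu. -/
theorem LocalRegime.deviation_sq_le (H : LocalRegime L G Θs r α β d σ τ ρ e)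
    (h : InRegion Θs (ρ * σ) U V) :
    α ^ 2 * ‖U * Vᵀ - Θs‖ ^ 2 ≤ 15 * e ^ 2 + 57 * (gradSq G U V / σ) := by
  obtain ⟨T, hT, hTn⟩ := H.thin.exists_pseudoinverse H.σ_pos
  have hσ := H.σ_pos
  have hα := H.α_pos
  have he := H.e_nonneg
  have hβ := H.β_nonneg
  have hρ := H.ρ_pos
  have hd := one_pos.trans_le H.one_le_d
  have hg := gradSq_nonneg G U V
  have h1 : ‖U * Vᵀ - Θs‖ ≤ 1 := h.1.trans (by linarith [H.ρσ_le, mul_pos hρ hσ])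
  set c := Real.sqrt (σ / 2) with hc
  have hcpos : 0 < c := Real.sqrt_pos.2 (by positivity)
  have hcsq : c ^ 2 = σ / 2 := Real.sq_sqrt (by positivity)
  have hdev := frobInner_deviation_le (G (U * Vᵀ)) Θs U V hcpos
    (by rw [hcsq]; exact H.left_lower_bound h) (by rw [hcsq]; exact H.right_lower_bound h) hT
  have hS := gradient_mul_sq_le (G (U * Vᵀ)) U V rfl (factoredGrad_transpose_eq G U V)
  change _ ≤ 4 * gradSq G U V at hS
  have hsa := H.loss.strong_above _ h1
  have hsb := H.loss.strong_below _ h1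
  have hcs := (abs_le.1 (abs_frobInner_le (G Θs) (U * Vᵀ - Θs))).1
  have hG := H.norm_grad_le (U * Vᵀ)
  have hge := H.grad_le
  have hu0 := norm_nonneg (U * Vᵀ - Θs)
  set u := ‖U * Vᵀ - Θs‖ with hu
  set S := ‖(G (U * Vᵀ))ᵀ * U‖ + ‖G (U * Vᵀ) * V‖ with hSdef
  have hS0 : 0 ≤ S := by positivity
  have hSsq : (S / c) ^ 2 ≤ 16 * (gradSq G U V / σ) := by
    rw [div_pow, hcsq, div_le_iff₀ (by positivity)]
    have e1 : 16 * (gradSq G U V / σ) * (σ / 2) = 8 * gradSq G U V := by field_simp; ring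
    rw [e1]
    nlinarith [sq_nonneg (‖(G (U * Vᵀ))ᵀ * U‖ - ‖G (U * Vᵀ) * V‖)]
  have hrem : ‖G (U * Vᵀ)‖ * ‖T‖ * u ^ 2 ≤ (e + α / 4 * u) * u := by
    have e1 : ‖T‖ ≤ d / σ := hTn.trans (by gcongr; exact H.r_le)
    have e2 : d / σ * u ≤ d * ρ := by
      calc d / σ * u ≤ d / σ * (ρ * σ) := by gcongr; exact h.1
        _ = d * ρ := by field_simp
    calc ‖G (U * Vᵀ)‖ * ‖T‖ * u ^ 2 ≤ (e + β * u) * (d / σ) * u ^ 2 := by gcongr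
      _ = (e + β * u) * (d / σ * u) * u := by ring
      _ ≤ (e + β * u) * (d * ρ) * u := by gcongr
      _ = (d * ρ * e + d * ρ * β * u) * u := by ring
      _ ≤ (1 * e + α / 4 * u) * u := by gcongr; exacts [H.dρ_le, H.dρβ_le]
      _ = _ := by ring
  have hmain : 3 / 4 * α * u ≤ 2 * e + S / c := by
    rcases hu0.eq_or_lt with h0 | h0
    · rw [← h0]; simp only [mul_zero]; positivity
    · refine le_of_mul_le_mul_right ?_ h0
      have : ‖G Θs‖ * u ≤ e * u := by gcongr
      nlinarith
  -- The square of the right side is at most 8e² + 32·gradSq/σ; multiplying by 16/9 and rounding up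
  -- gives 15 and 57.
  have h5 := pow_le_pow_left₀ (by positivity) hmain 2
  nlinarith [sq_nonneg (2 * e - S / c), sq_nonneg e]

/-- The gradient-domination constant. -/
noncomputable def plConst (α β : ℝ) : ℝ := 30 * (1 + β) / α ^ 2

theorem LocalRegime.plConst_ge (H : LocalRegime L G Θs r α β d σ τ ρ e) : 1 ≤ plConst α β := by
  have := H.α_pos
  have := H.α_le
  have := H.β_nonneg
  unfold plConst
  rw [le_div_iff₀ (by positivity)]
  nlinarith

/-- A Polyak-Lojasiewicz inequality up to the statistical error `e`. -/
theorem LocalRegime.gradient_domination (H : LocalRegime L G Θs r α β d σ τ ρ e)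
    (h : InRegion Θs (ρ * σ) U V) :
    excess L Θs U V ≤ plConst α β * (e ^ 2 + gradSq G U V / σ) := by
  have h1 := H.excess_le U V
  have h2 := H.imbalance_sq_le h
  have h3 := H.deviation_sq_le h
  have hα := H.α_pos
  have hβ := H.β_nonneg
  have hσ := H.σ_pos
  have hg : 0 ≤ gradSq G U V / σ := div_nonneg (gradSq_nonneg G U V) hσ.le
  set g := gradSq G U V / σ
  set u := ‖U * Vᵀ - Θs‖
  have h4 : excess L Θs U V ≤ 1 / 2 * e ^ 2 + (1 + β) / 2 * u ^ 2 + 1 / 2 * g := by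
    nlinarith [sq_nonneg (e - u)]
  refine h4.trans ?_
  unfold plConst
  rw [div_mul_eq_mul_div (30 * (1 + β)), le_div_iff₀ (by positivity)]
  have h5 : α ^ 2 ≤ 1 := by nlinarith [H.α_le]
  have h6 : (1 + β) / 2 * (α ^ 2 * u ^ 2) ≤ (1 + β) / 2 * (15 * e ^ 2 + 57 * g) := by gcongr
  have h7 : α ^ 2 * e ^ 2 ≤ 1 * e ^ 2 := by gcongr
  have h8 : α ^ 2 * g ≤ 1 * g := by gcongr
  nlinarith [mul_nonneg hβ hg, mul_nonneg hβ (sq_nonneg e)]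

set_option maxHeartbeats 1000000 in
/-- One half step of factored gradient descent stays in the region and decreases the objective. -/
theorem LocalRegime.half_step (H : LocalRegime L G Θs r α β d σ τ ρ e)
    (h : InRegion Θs (ρ * σ) U V) (hF : excess L Θs U V ≤ α / 4 * (ρ * σ) ^ 2) {c : ℝ}
    (hc : 0 < c) (hc1 : 6 * c * ((1 + β) * (1 + 2 * d ^ 2)) ≤ 1) :
    InRegion Θs (ρ * σ) (U - (c / τ) • factoredGrad G U V) V ∧
      excess L Θs (U - (c / τ) • factoredGrad G U V) V ≤
        excess L Θs U V - c / τ / 2 * ‖factoredGrad G U V‖ ^ 2 := by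
  have hσ := H.σ_pos
  have hτ : 0 < τ := hσ.trans_le H.σ_le
  have hα := H.α_pos
  have hα4 := H.α_le
  have he := H.e_nonneg
  have hβ := H.β_nonneg
  have hρ := H.ρ_pos
  have hd := H.one_le_d
  have hρσ : 0 < ρ * σ := mul_pos hρ hσ
  have hρσ16 : ρ * σ ≤ τ / 16 := H.region_le.trans (by linarith [H.σ_le])
  have hel := H.e_le
  have hA : (2 : ℝ) ≤ 2 * d ^ 2 := by nlinarith
  have hU := H.norm_left_sq_le h
  have hV := H.norm_right_sq_le h
  have hη0 : 0 < c / τ := by positivity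
  have hexp := H.loss.factoredObjective_expansion U (-((c / τ) • factoredGrad G U V)) V hβ
  have hgram := norm_gram_sub_le U (-((c / τ) • factoredGrad G U V)) (Vᵀ * V)
  rw [← sub_eq_add_neg, norm_neg, frobenius_norm_smul, abs_of_pos hη0] at hexp hgram
  rw [frobInner_neg_right, frobInner_smul_right, ← frobenius_norm_sq] at hexp
  have hΔV : ‖(U - (c / τ) • factoredGrad G U V) * Vᵀ - Θs‖ ≤
      ‖U * Vᵀ - Θs‖ + c / τ * ‖factoredGrad G U V‖ * ‖V‖ := by
    have e1 : (U - (c / τ) • factoredGrad G U V) * Vᵀ - Θs =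
        (U * Vᵀ - Θs) - ((c / τ) • factoredGrad G U V) * Vᵀ := by
      rw [Matrix.sub_mul]; abel
    rw [e1]
    refine (norm_sub_le _ _).trans ?_
    gcongr
    refine (frobenius_norm_mul_le _ _).trans ?_
    rw [frobenius_norm_smul, abs_of_pos (by positivity), Matrix.frobenius_norm_transpose]
  have hgn : ‖factoredGrad G U V‖ ≤
      ‖V‖ * (e + β * (ρ * σ)) + 1 / 2 * (‖U‖ * (ρ * σ)) := by
    unfold factoredGrad
    refine (norm_add_le _ _).trans ?_
    rw [frobenius_norm_smul, abs_of_pos (by norm_num)]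
    gcongr
    · refine (frobenius_norm_mul_le _ _).trans ?_
      rw [mul_comm]
      gcongr
      refine (H.norm_grad_le _).trans ?_
      gcongr
      exact h.1
    · refine (frobenius_norm_mul_le _ _).trans ?_
      gcongr
      exact h.2
  set g := ‖factoredGrad G U V‖ with hg
  set A := 2 * d ^ 2 with hAdef
  have hg0 : 0 ≤ g := norm_nonneg _
  set a := Real.sqrt (A * τ) with ha
  have hA0 : 0 < A := by linarith
  have ha0 : 0 < a := Real.sqrt_pos.2 (by positivity)
  have hasq : a ^ 2 = A * τ := Real.sq_sqrt (by positivity)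
  have hUa : ‖U‖ ≤ a := Real.le_sqrt_of_sq_le hU
  have hVa : ‖V‖ ≤ a := Real.le_sqrt_of_sq_le hV
  have hga : g ≤ a * ((1 + β) * (ρ * σ)) := by
    have e1 : e ≤ 1 / 2 * (ρ * σ) := by nlinarith
    calc g ≤ a * (1 / 2 * (ρ * σ) + β * (ρ * σ)) + 1 / 2 * (a * (ρ * σ)) :=
          hgn.trans (by gcongr)
      _ = _ := by ring
  set η := c / τ with hη
  have hητ : η * τ = c := by rw [hη]; field_simp
  have hcA : c * ((1 + β) * A) ≤ 1 / 6 := by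
    have : c * ((1 + β) * A) ≤ c * ((1 + β) * (1 + A)) := by gcongr; linarith
    linarith
  have hha : η * g * a ≤ ρ * σ / 6 := by
    calc η * g * a ≤ η * (a * ((1 + β) * (ρ * σ))) * a := by gcongr
      _ = η * a ^ 2 * (1 + β) * (ρ * σ) := by ring
      _ = c * ((1 + β) * A) * (ρ * σ) := by rw [hasq, ← hητ]; ring
      _ ≤ 1 / 6 * (ρ * σ) := by gcongr
      _ = _ := by ring
  have hh : η * g ≤ a := by
    refine le_of_mul_le_mul_right ?_ ha0
    have : a * a = A * τ := by rw [← sq, hasq]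
    rw [this]
    nlinarith
  have hh0 : 0 ≤ η * g := by positivity
  -- A priori the step only stays within radius 2ρσ ≤ 1, where strong convexity still holds. The
  -- decrease of the objective then brings both deviations back to ρσ.
  have hΔ2 : ‖(U - η • factoredGrad G U V) * Vᵀ - Θs‖ ≤ 2 * (ρ * σ) := by
    have : η * g * ‖V‖ ≤ η * g * a := by gcongr
    linarith [h.1]
  have hB2 : ‖(U - η • factoredGrad G U V)ᵀ * (U - η • factoredGrad G U V) - Vᵀ * V‖ ≤
      2 * (ρ * σ) := by
    have e1 : (2 * ‖U‖ + η * g) * (η * g) ≤ (2 * a + a) * (η * g) := by gcongr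
    have e2 := norm_le_norm_sub_add ((U - η • factoredGrad G U V)ᵀ *
      (U - η • factoredGrad G U V) - Vᵀ * V) (Uᵀ * U - Vᵀ * V)
    have e3 : (2 * a + a) * (η * g) = 3 * (η * g * a) := by ring
    rw [e3] at e1
    refine e2.trans ((add_le_add (hgram.trans e1) h.2).trans ?_)
    linarith
  have hdec : excess L Θs (U - η • factoredGrad G U V) V ≤ excess L Θs U V - η / 2 * g ^ 2 := by
    have e1 := (abs_le.1 hexp).2
    -- Both factors have norm at most a and the step has length ηg ≤ a, so the quartic part
    -- contributes (3a)² = 9Aτ.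
    have e2 : (β / 2 * ‖V‖ ^ 2 + 1 / 4 * ‖Uᵀ * U - Vᵀ * V‖ + 1 / 8 * (2 * ‖U‖ + η * g) ^ 2) ≤
        (β / 2 * (A * τ) + 1 / 4 * τ + 9 / 8 * (A * τ)) := by
      have e3 : (2 * ‖U‖ + η * g) ^ 2 ≤ (2 * a + a) ^ 2 := by gcongr
      have e4 : β / 2 * ‖V‖ ^ 2 ≤ β / 2 * (A * τ) := by gcongr
      have e6 : 1 / 4 * ‖Uᵀ * U - Vᵀ * V‖ ≤ 1 / 4 * τ := by linarith [h.2]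
      have e7 : (2 * a + a) ^ 2 = 9 * (A * τ) := by rw [← hasq]; ring
      linarith
    have e5 : (β / 2 * ‖V‖ ^ 2 + 1 / 4 * ‖Uᵀ * U - Vᵀ * V‖ + 1 / 8 * (2 * ‖U‖ + η * g) ^ 2) *
        (η * g) ^ 2 ≤ η / 2 * g ^ 2 := by
      calc _ ≤ (β / 2 * (A * τ) + 1 / 4 * τ + 9 / 8 * (A * τ)) * (η * g) ^ 2 := by gcongr
        _ = (c * (β / 2 * A + 1 / 4 + 9 / 8 * A)) * (η * g ^ 2) := by rw [← hητ]; ring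
        _ ≤ 1 / 2 * (η * g ^ 2) := by
          gcongr
          have : β / 2 * A + 1 / 4 + 9 / 8 * A ≤ 3 * ((1 + β) * (1 + A)) := by
            linarith [mul_nonneg hβ hA0.le]
          calc _ ≤ c * (3 * ((1 + β) * (1 + A))) := by gcongr
            _ ≤ _ := by linarith
        _ = _ := by ring
    unfold excess
    linarith
  refine ⟨?_, hdec⟩
  have hF' : excess L Θs (U - η • factoredGrad G U V) V ≤ α / 4 * (ρ * σ) ^ 2 :=
    (hdec.trans (sub_le_self _ (by positivity))).trans hF
  have hlow := H.le_excess (hΔ2.trans H.ρσ_le)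
  have heu : e * ‖(U - η • factoredGrad G U V) * Vᵀ - Θs‖ ≤ α / 4 * (ρ * σ) ^ 2 := by
    calc _ ≤ α / 8 * (ρ * σ) * (2 * (ρ * σ)) := by gcongr
      _ = _ := by ring
  constructor
  · refine le_of_sq_le_sq ?_ hρσ.le
    refine le_of_mul_le_mul_left (a := α / 2) ?_ (by positivity)
    have := sq_nonneg ‖(U - η • factoredGrad G U V)ᵀ * (U - η • factoredGrad G U V) - Vᵀ * V‖
    linarith
  · refine le_of_sq_le_sq ?_ hρσ.le
    -- Here α ≤ 1/4 matters: one eighth of the squared imbalance is at most (α/2)(ρσ)² ≤ (ρσ)²/8.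
    have : α * (ρ * σ) ^ 2 ≤ 1 / 4 * (ρ * σ) ^ 2 := by gcongr
    have := mul_nonneg hα.le (sq_nonneg ‖(U - η • factoredGrad G U V) * Vᵀ - Θs‖)
    have := sq_nonneg (ρ * σ)
    linarith

/-- Changing the left factor by a gradient step changes the right gradient by at most the size of
the left gradient. -/
theorem LocalRegime.right_grad_sub_le (H : LocalRegime L G Θs r α β d σ τ ρ e)
    {U' : Matrix (Fin m) (Fin r) ℝ} (h : InRegion Θs (ρ * σ) U V)
    (h' : InRegion Θs (ρ * σ) U' V) :
    ‖factoredGrad (fun Θ => (G Θᵀ)ᵀ) V U - factoredGrad (fun Θ => (G Θᵀ)ᵀ) V U'‖ ≤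
      τ * ((1 + β) * (1 + 2 * d ^ 2)) * ‖U - U'‖ := by
  have hσ := H.σ_pos
  have hτ : 0 < τ := hσ.trans_le H.σ_le
  have hβ := H.β_nonneg
  have hρσ : 0 < ρ * σ := mul_pos H.ρ_pos hσ
  have hρσ16 : ρ * σ ≤ τ / 16 := H.region_le.trans (by linarith [H.σ_le])
  have hel : e ≤ τ := by nlinarith [H.e_le, H.α_le, H.α_pos]
  set a := Real.sqrt (2 * d ^ 2 * τ) with ha
  have hasq : a ^ 2 = 2 * d ^ 2 * τ := Real.sq_sqrt (by positivity)
  have ha0 : 0 ≤ a := Real.sqrt_nonneg _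
  have hUa : ‖U‖ ≤ a := Real.le_sqrt_of_sq_le (H.norm_left_sq_le h)
  have hUa' : ‖U'‖ ≤ a := Real.le_sqrt_of_sq_le (H.norm_left_sq_le h')
  have hVa : ‖V‖ ≤ a := Real.le_sqrt_of_sq_le (H.norm_right_sq_le h)
  rw [factoredGrad_transpose_eq, factoredGrad_transpose_eq]
  have e1 : (G (U * Vᵀ))ᵀ * U + (1 / 2 : ℝ) • (V * (Vᵀ * V - Uᵀ * U)) -
      ((G (U' * Vᵀ))ᵀ * U' + (1 / 2 : ℝ) • (V * (Vᵀ * V - U'ᵀ * U'))) =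
      (G (U * Vᵀ))ᵀ * (U - U') + (G (U * Vᵀ) - G (U' * Vᵀ))ᵀ * U' +
        (1 / 2 : ℝ) • (V * ((U' - U)ᵀ * U + U'ᵀ * (U' - U))) := by
    have e2 : (U' - U)ᵀ * U + U'ᵀ * (U' - U) = (Vᵀ * V - Uᵀ * U) - (Vᵀ * V - U'ᵀ * U') := by
      rw [Matrix.transpose_sub, Matrix.sub_mul, Matrix.mul_sub]; abel
    rw [e2, Matrix.mul_sub V _ (Vᵀ * V - U'ᵀ * U'), smul_sub, Matrix.transpose_sub,
      Matrix.sub_mul, Matrix.mul_sub _ U U']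
    abel
  rw [e1]
  have hD : ‖U' - U‖ = ‖U - U'‖ := norm_sub_rev _ _
  set D := ‖U - U'‖ with hDdef
  have hD0 : 0 ≤ D := norm_nonneg _
  have t1 : ‖(G (U * Vᵀ))ᵀ * (U - U')‖ ≤ (1 + β) * τ * D := by
    refine (frobenius_norm_mul_le _ _).trans ?_
    rw [Matrix.frobenius_norm_transpose]
    gcongr
    have h1 : β * ‖U * Vᵀ - Θs‖ ≤ β * τ := by gcongr; linarith [h.1]
    linarith [H.norm_grad_le (U * Vᵀ)]
  have t2 : ‖(G (U * Vᵀ) - G (U' * Vᵀ))ᵀ * U'‖ ≤ β * (D * a) * a := by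
    refine (frobenius_norm_mul_le _ _).trans ?_
    rw [Matrix.frobenius_norm_transpose]
    gcongr
    refine (H.loss.lipschitz _ _).trans ?_
    gcongr
    rw [← Matrix.sub_mul]
    refine (frobenius_norm_mul_le _ _).trans ?_
    rw [Matrix.frobenius_norm_transpose]
    gcongr
  have t3 : ‖(1 / 2 : ℝ) • (V * ((U' - U)ᵀ * U + U'ᵀ * (U' - U)))‖ ≤
      1 / 2 * (a * (D * a + a * D)) := by
    rw [frobenius_norm_smul, abs_of_pos (by norm_num)]
    gcongr
    refine (frobenius_norm_mul_le _ _).trans ?_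
    gcongr
    refine (norm_add_le _ _).trans ?_
    refine add_le_add ((frobenius_norm_mul_le _ _).trans ?_) ((frobenius_norm_mul_le _ _).trans ?_)
    · rw [Matrix.frobenius_norm_transpose, hD]; gcongr
    · rw [Matrix.frobenius_norm_transpose, hD]; gcongr
  refine (norm_add_le _ _).trans ((add_le_add ((norm_add_le _ _).trans (add_le_add t1 t2)) t3).trans
    (le_of_eq ?_))
  calc _ = (1 + β) * τ * D + (1 + β) * a ^ 2 * D := by ring
    _ = _ := by rw [hasq]; ring

/-- One round of factored gradient descent stays in the region and decreases the objective by a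
multiple of the squared gradient. -/
theorem LocalRegime.full_step (H : LocalRegime L G Θs r α β d σ τ ρ e)
    (h : InRegion Θs (ρ * σ) U V) (hF : excess L Θs U V ≤ α / 4 * (ρ * σ) ^ 2) {c : ℝ}
    (hc : 0 < c) (hc1 : 6 * c * ((1 + β) * (1 + 2 * d ^ 2)) ≤ 1)
    {U' : Matrix (Fin m) (Fin r) ℝ} {V' : Matrix (Fin n) (Fin r) ℝ}
    (hU' : U' = U - (c / τ) • factoredGrad G U V)
    (hV' : V' = V - (c / τ) • factoredGrad (fun Θ => (G Θᵀ)ᵀ) V U') :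
    InRegion Θs (ρ * σ) U' V' ∧
      excess L Θs U' V' ≤ excess L Θs U V - c / τ / 6 * gradSq G U V := by
  have hτ : 0 < τ := H.σ_pos.trans_le H.σ_le
  obtain ⟨hR1, hF1⟩ := H.half_step h hF hc hc1
  rw [← hU'] at hR1 hF1
  have hF1' : excess L Θs U' V ≤ α / 4 * (ρ * σ) ^ 2 :=
    (hF1.trans (sub_le_self _ (by positivity))).trans hF
  rw [excess_transpose] at hF1'
  -- The V step is a left step of the transposed problem, started at the updated U'.
  obtain ⟨hR2, hF2⟩ := H.transpose.half_step hR1.transpose hF1' hc hc1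
  rw [← hV'] at hR2 hF2
  rw [← excess_transpose, ← excess_transpose] at hF2
  refine ⟨by simpa using hR2.transpose, ?_⟩
  have hd := H.right_grad_sub_le h hR1
  have e1 : ‖U - U'‖ = c / τ * ‖factoredGrad G U V‖ := by
    rw [hU', sub_sub_cancel, frobenius_norm_smul, abs_of_pos (by positivity)]
  -- Gradient domination is needed at (U, V), but the V step uses the gradient at U'. The small step
  -- size keeps the discrepancy below the left gradient, which costs a factor 3 in `hg3`.
  have hd' : ‖factoredGrad (fun Θ => (G Θᵀ)ᵀ) V U - factoredGrad (fun Θ => (G Θᵀ)ᵀ) V U'‖ ≤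
      ‖factoredGrad G U V‖ := by
    refine hd.trans ?_
    rw [e1]
    calc _ = (c * ((1 + β) * (1 + 2 * d ^ 2))) * ‖factoredGrad G U V‖ := by field_simp
      _ ≤ 1 * ‖factoredGrad G U V‖ := by
        gcongr
        have : 0 ≤ c * ((1 + β) * (1 + 2 * d ^ 2)) := by have := H.β_nonneg; positivity
        linarith
      _ = _ := one_mul _
  have hn := norm_le_norm_sub_add (factoredGrad (fun Θ => (G Θᵀ)ᵀ) V U)
    (factoredGrad (fun Θ => (G Θᵀ)ᵀ) V U')
  have hsq := pow_le_pow_left₀ (norm_nonneg _) (hn.trans (add_le_add_left hd' _)) 2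
  have hg3 : gradSq G U V ≤
      3 * (‖factoredGrad G U V‖ ^ 2 + ‖factoredGrad (fun Θ => (G Θᵀ)ᵀ) V U'‖ ^ 2) := by
    unfold gradSq
    nlinarith [sq_nonneg (‖factoredGrad G U V‖ - ‖factoredGrad (fun Θ => (G Θᵀ)ᵀ) V U'‖)]
  have hη : 0 < c / τ := by positivity
  nlinarith [mul_le_mul_of_nonneg_left hg3 hη.le]

/-- The contraction rate of factored gradient descent. -/
noncomputable def fgdRate (α β c σ τ : ℝ) : ℝ := c / τ * σ / (6 * plConst α β)

theorem LocalRegime.fgdRate_mem (H : LocalRegime L G Θs r α β d σ τ ρ e) {c : ℝ}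
    (hc : 0 < c) (hc1 : 6 * c * ((1 + β) * (1 + 2 * d ^ 2)) ≤ 1) :
    0 < fgdRate α β c σ τ ∧ fgdRate α β c σ τ < 1 := by
  have hσ := H.σ_pos
  have hτ : 0 < τ := hσ.trans_le H.σ_le
  have hC := H.plConst_ge
  have hβ := H.β_nonneg
  unfold fgdRate
  refine ⟨by positivity, ?_⟩
  rw [div_lt_one (by positivity)]
  have h1 : c / τ * σ ≤ c := by
    rw [div_mul_eq_mul_div, div_le_iff₀ hτ]
    gcongr
    exact H.σ_le
  have h2 : c * 1 ≤ c * ((1 + β) * (1 + 2 * d ^ 2)) := by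
    gcongr
    nlinarith [mul_nonneg hβ (sq_nonneg d), sq_nonneg d]
  linarith

/-- Linear convergence of factored gradient descent down to the statistical error. -/
theorem LocalRegime.fgd_invariant (H : LocalRegime L G Θs r α β d σ τ ρ e) {c : ℝ}
    (hc : 0 < c) (hc1 : 6 * c * ((1 + β) * (1 + 2 * d ^ 2)) ≤ 1) (h : InRegion Θs (ρ * σ) U V)
    (hF : excess L Θs U V ≤ α / 4 * (ρ * σ) ^ 2) (k : ℕ) :
    InRegion Θs (ρ * σ) (fgd L (c / τ) U V k).1 (fgd L (c / τ) U V k).2 ∧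
      excess L Θs (fgd L (c / τ) U V k).1 (fgd L (c / τ) U V k).2 ≤ α / 4 * (ρ * σ) ^ 2 ∧
      excess L Θs (fgd L (c / τ) U V k).1 (fgd L (c / τ) U V k).2 ≤ plConst α β * e ^ 2 +
        (1 - fgdRate α β c σ τ) ^ k * (α / 4 * (ρ * σ) ^ 2) := by
  have hτ : 0 < τ := H.σ_pos.trans_le H.σ_le
  have hC : 0 < plConst α β := one_pos.trans_le H.plConst_ge
  obtain ⟨hq0, hq1⟩ := H.fgdRate_mem hc hc1
  induction k with
  | zero =>
    refine ⟨h, hF, ?_⟩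
    rw [pow_zero, one_mul]
    exact hF.trans (le_add_of_nonneg_left (by positivity))
  | succ k ih =>
    obtain ⟨hR, hF1, hF2⟩ := ih
    obtain ⟨hR', hF'⟩ := H.full_step hR hF1 hc hc1 (U' := (fgd L (c / τ) U V (k + 1)).1)
      (V' := (fgd L (c / τ) U V (k + 1)).2)
      (by rw [← H.loss.matGrad_left H.β_nonneg]; rfl)
      (by rw [← H.loss.matGrad_right H.β_nonneg]; rfl)
    have hpl := H.gradient_domination hR
    have hg := gradSq_nonneg G (fgd L (c / τ) U V k).1 (fgd L (c / τ) U V k).2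
    set g := gradSq G (fgd L (c / τ) U V k).1 (fgd L (c / τ) U V k).2
    set F := excess L Θs (fgd L (c / τ) U V k).1 (fgd L (c / τ) U V k).2
    set F' := excess L Θs (fgd L (c / τ) U V (k + 1)).1 (fgd L (c / τ) U V (k + 1)).2
    -- The decrease (c/τ)/6·g equals the rate times `plConst`·g/σ, which gradient domination bounds
    -- below by the rate times F − `plConst`·e².
    have hstep : F' ≤ F - fgdRate α β c σ τ * (F - plConst α β * e ^ 2) := by
      have h1 : fgdRate α β c σ τ * (F - plConst α β * e ^ 2) ≤
          fgdRate α β c σ τ * (plConst α β * (g / σ)) := by gcongr; linarith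
      have h2 : fgdRate α β c σ τ * (plConst α β * (g / σ)) = c / τ / 6 * g := by
        have := H.σ_pos
        unfold fgdRate
        field_simp
      linarith
    refine ⟨hR', hF'.trans ((sub_le_self _ (by positivity)).trans hF1), ?_⟩
    have h3 : (1 - fgdRate α β c σ τ) * (F - plConst α β * e ^ 2) ≤
        (1 - fgdRate α β c σ τ) * ((1 - fgdRate α β c σ τ) ^ k * (α / 4 * (ρ * σ) ^ 2)) := by
      gcongr
      linarith
    rw [pow_succ' (1 - fgdRate α β c σ τ)]
    linarith

/-- Error of factored gradient descent from a balanced initialization close to the target. -/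
theorem LocalRegime.fgd_error_sq_le (H : LocalRegime L G Θs r α β d σ τ ρ e) {c : ℝ}
    (hc : 0 < c) (hc1 : 6 * c * ((1 + β) * (1 + 2 * d ^ 2)) ≤ 1) (hB : Uᵀ * U = Vᵀ * V)
    (hΔ : ‖U * Vᵀ - Θs‖ ≤ α / (4 * (1 + β)) * (ρ * σ)) {k : ℕ}
    (hk : (1 - fgdRate α β c σ τ) ^ k * (α / 4 * (ρ * σ) ^ 2) ≤ e ^ 2) :
    ‖(fgd L (c / τ) U V k).1 * ((fgd L (c / τ) U V k).2)ᵀ - Θs‖ ^ 2 ≤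
      4 / α * (plConst α β + 1 + 1 / α) * e ^ 2 := by
  have hα := H.α_pos
  have hα4 := H.α_le
  have hβ := H.β_nonneg
  have he := H.e_nonneg
  have hρσ : 0 < ρ * σ := mul_pos H.ρ_pos H.σ_pos
  have ht0 : 0 ≤ α / (4 * (1 + β)) := by positivity
  have ht : α / (4 * (1 + β)) ≤ 1 := by
    rw [div_le_one (by positivity)]; linarith
  have htβ : α / (4 * (1 + β)) * β ≤ α / 4 := by
    rw [div_mul_eq_mul_div, div_le_div_iff₀ (by positivity) (by norm_num)]
    nlinarith
  have h : InRegion Θs (ρ * σ) U V := by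
    refine ⟨hΔ.trans (mul_le_of_le_one_left hρσ.le ht), ?_⟩
    rw [hB, sub_self, norm_zero]; exact hρσ.le
  -- At a balanced start only the deviation contributes; its linear and quadratic terms each take
  -- half of the budget.
  have hF : excess L Θs U V ≤ α / 4 * (ρ * σ) ^ 2 := by
    have h1 := H.excess_le U V
    rw [hB, sub_self, norm_zero] at h1
    set t := α / (4 * (1 + β))
    have h2 : e * ‖U * Vᵀ - Θs‖ ≤ α / 8 * (ρ * σ) * (1 * (ρ * σ)) := by
      gcongr
      · exact H.e_le
      · exact h.1.trans (one_mul _).ge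
    have h3 : β / 2 * ‖U * Vᵀ - Θs‖ ^ 2 ≤ α / 8 * (ρ * σ) ^ 2 := by
      calc _ ≤ β / 2 * (t * (ρ * σ)) ^ 2 := by gcongr
        _ = t * β / 2 * t * (ρ * σ) ^ 2 := by ring
        _ ≤ α / 4 / 2 * 1 * (ρ * σ) ^ 2 := by gcongr
        _ = _ := by ring
    linarith
  obtain ⟨hR, -, hFk⟩ := H.fgd_invariant hc hc1 h hF k
  have hlow := H.le_excess (hR.1.trans (by linarith [H.ρσ_le]))
  set u := ‖(fgd L (c / τ) U V k).1 * ((fgd L (c / τ) U V k).2)ᵀ - Θs‖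
  -- Young's inequality, spending half of the strong convexity term (α/2)u².
  have h1 : e * u ≤ α / 4 * u ^ 2 + e ^ 2 / α := by
    have h2 : α / 4 * u ^ 2 + e ^ 2 / α - e * u = α * (u / 2 - e / α) ^ 2 := by
      field_simp; ring
    nlinarith [mul_nonneg hα.le (sq_nonneg (u / 2 - e / α))]
  have h3 : α / 4 * u ^ 2 ≤ (plConst α β + 1 + 1 / α) * e ^ 2 := by
    have : (plConst α β + 1 + 1 / α) * e ^ 2 = plConst α β * e ^ 2 + e ^ 2 + e ^ 2 / α := by ring
    rw [this]
    nlinarith [sq_nonneg ‖((fgd L (c / τ) U V k).1)ᵀ * (fgd L (c / τ) U V k).1 -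
      ((fgd L (c / τ) U V k).2)ᵀ * (fgd L (c / τ) U V k).2‖]
  calc u ^ 2 = 4 / α * (α / 4 * u ^ 2) := by field_simp
    _ ≤ 4 / α * ((plConst α β + 1 + 1 / α) * e ^ 2) := by gcongr
    _ = _ := by ring

end Descent

/-! ### Smoothness and local strong convexity of the logistic loss. -/

section Logistic

/-- Monotonicity is asked only between the two points, so that the lemma also covers functions
convex merely on a bounded interval. -/
theorem tangent_le_of_monotoneOn {f f' : ℝ → ℝ} {x y : ℝ} (hf : ∀ z, HasDerivAt f (f' z) z)
    (hm : MonotoneOn f' (Set.uIcc x y)) : f x + f' x * (y - x) ≤ f y := by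
  have hcont : Continuous f := continuous_iff_continuousAt.2 fun z => (hf z).continuousAt
  rcases lt_trichotomy x y with h | rfl | h
  · obtain ⟨c, hc, hs⟩ := exists_hasDerivAt_eq_slope f f' h hcont.continuousOn fun z _ => hf z
    rw [Set.uIcc_of_le h.le] at hm
    have h1 := hm (Set.left_mem_Icc.2 h.le) (Set.Ioo_subset_Icc_self hc) hc.1.le
    rw [hs, le_div_iff₀ (sub_pos.2 h)] at h1
    linarith
  · simp
  · obtain ⟨c, hc, hs⟩ := exists_hasDerivAt_eq_slope f f' h hcont.continuousOn fun z _ => hf z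
    rw [Set.uIcc_of_ge h.le] at hm
    have h1 := hm (Set.Ioo_subset_Icc_self hc) (Set.right_mem_Icc.2 h.le) hc.2.le
    rw [hs, div_le_iff₀ (sub_pos.2 h)] at h1
    linarith

/-- The logistic loss of a margin `m` with label `b`. -/
noncomputable def logLoss (b m : ℝ) : ℝ := Real.log (1 + Real.exp (-m)) + (1 - b) * m

theorem hasDerivAt_logLoss (b m : ℝ) : HasDerivAt (logLoss b) (Real.sigmoid m - b) m := by
  have h1 : HasDerivAt (fun m : ℝ => 1 + Real.exp (-m)) (Real.exp (-m) * -1) m :=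
    ((hasDerivAt_neg m).exp).const_add 1
  have h0 : (0 : ℝ) < 1 + Real.exp (-m) := by positivity
  have h2 := (h1.log h0.ne').add ((hasDerivAt_id m).const_mul (1 - b))
  refine h2.congr_deriv ?_
  rw [Real.sigmoid_def]
  field_simp
  ring

theorem sigmoid_deriv_le (m : ℝ) : Real.sigmoid m * (1 - Real.sigmoid m) ≤ 1 / 4 := by
  nlinarith [sq_nonneg (Real.sigmoid m - 1 / 2)]

/-- Over |m| ≤ M the sigmoid takes values in [1 − sigmoid M, sigmoid M], and the concave function
s(1 − s) is smallest at the ends. -/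
theorem le_sigmoid_deriv {m M : ℝ} (h : |m| ≤ M) :
    Real.sigmoid M * (1 - Real.sigmoid M) ≤ Real.sigmoid m * (1 - Real.sigmoid m) := by
  have h1 := Real.sigmoid_le (abs_le.1 h).2
  have h2 := Real.sigmoid_le (abs_le.1 h).1
  rw [Real.sigmoid_neg] at h2
  nlinarith [mul_nonneg (sub_nonneg.2 h1) (sub_nonneg.2 h2)]

/-- The bound 1/4 on the slope of the sigmoid, in the form used for both the Lipschitz estimate and
the quadratic upper bound. -/
theorem monotone_quarter_sub_sigmoid (b : ℝ) :
    Monotone fun x : ℝ => x / 4 - (Real.sigmoid x - b) := by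
  have hd : ∀ x : ℝ, HasDerivAt (fun x : ℝ => x / 4 - (Real.sigmoid x - b))
      (1 / 4 - Real.sigmoid x * (1 - Real.sigmoid x)) x := fun x =>
    ((hasDerivAt_id x).div_const 4).sub ((Real.hasDerivAt_sigmoid x).sub_const b)
  refine monotone_of_deriv_nonneg (fun x => (hd x).differentiableAt) fun x => ?_
  rw [(hd x).deriv]
  linarith [sigmoid_deriv_le x]

theorem abs_sigmoid_sub_le (x y : ℝ) : |Real.sigmoid x - Real.sigmoid y| ≤ 1 / 4 * |x - y| := by
  rcases le_total x y with h | h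
  · have h1 := Real.sigmoid_le h
    have h2 := monotone_quarter_sub_sigmoid 0 h
    simp only at h2
    rw [abs_of_nonpos (by linarith), abs_of_nonpos (by linarith)]
    linarith
  · have h1 := Real.sigmoid_le h
    have h2 := monotone_quarter_sub_sigmoid 0 h
    simp only at h2
    rw [abs_of_nonneg (by linarith), abs_of_nonneg (by linarith)]
    linarith

theorem logLoss_le (b x y : ℝ) :
    logLoss b y ≤ logLoss b x + (Real.sigmoid x - b) * (y - x) + (y - x) ^ 2 / 8 := by
  have hd : ∀ z : ℝ, HasDerivAt (fun z : ℝ => z ^ 2 / 8 - logLoss b z)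
      (z / 4 - (Real.sigmoid z - b)) z := fun z => by
    refine (((hasDerivAt_pow 2 z).div_const 8).sub (hasDerivAt_logLoss b z)).congr_deriv ?_
    norm_num
    ring
  have := tangent_le_of_monotoneOn hd
    ((monotone_quarter_sub_sigmoid b).monotoneOn (Set.uIcc x y))
  nlinarith

theorem logLoss_ge (b x y : ℝ) :
    logLoss b x + (Real.sigmoid x - b) * (y - x) ≤ logLoss b y :=
  tangent_le_of_monotoneOn (hasDerivAt_logLoss b) fun _ _ _ _ h =>
    sub_le_sub_right (Real.sigmoid_le h) b

/-- The least curvature on [−M, M] is γ, so subtracting γz²/2 leaves a function convex there, to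
which the tangent inequality applies. -/
theorem logLoss_ge_strong (b : ℝ) {x y M : ℝ} (hx : |x| ≤ M) (hy : |y| ≤ M) :
    logLoss b x + (Real.sigmoid x - b) * (y - x) +
      Real.sigmoid M * (1 - Real.sigmoid M) / 2 * (y - x) ^ 2 ≤ logLoss b y := by
  set γ := Real.sigmoid M * (1 - Real.sigmoid M)
  have hd : ∀ z : ℝ, HasDerivAt (fun z : ℝ => logLoss b z - γ / 2 * z ^ 2)
      (Real.sigmoid z - b - γ * z) z := fun z => by
    refine ((hasDerivAt_logLoss b z).sub ((hasDerivAt_pow 2 z).const_mul (γ / 2))).congr_deriv ?_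
    norm_num
    ring
  have hd2 : ∀ z : ℝ, HasDerivAt (fun z : ℝ => Real.sigmoid z - b - γ * z)
      (Real.sigmoid z * (1 - Real.sigmoid z) - γ * 1) z := fun z =>
    ((Real.hasDerivAt_sigmoid z).sub_const b).sub ((hasDerivAt_id z).const_mul γ)
  have hsub : Set.uIcc x y ⊆ Set.Icc (-M) M :=
    Set.uIcc_subset_Icc (abs_le.1 hx) (abs_le.1 hy)
  have hmono : MonotoneOn (fun z : ℝ => Real.sigmoid z - b - γ * z) (Set.Icc (-M) M) := by
    refine monotoneOn_of_deriv_nonneg (convex_Icc _ _)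
      (fun z _ => (hd2 z).continuousAt.continuousWithinAt)
      (fun z _ => (hd2 z).differentiableAt.differentiableWithinAt) fun z hz => ?_
    rw [(hd2 z).deriv]
    have := le_sigmoid_deriv (abs_le.2 (Set.mem_Icc.1 (interior_subset hz)))
    linarith
  have := tangent_le_of_monotoneOn hd (hmono.mono hsub)
  nlinarith

variable {m n N : ℕ}

/-- The average logistic loss of the linear margins `⟨Z t, Θ⟩`. -/
noncomputable def logisticLoss (Z : Fin N → Matrix (Fin m) (Fin n) ℝ) (b : Fin N → ℝ)
    (Θ : Matrix (Fin m) (Fin n) ℝ) : ℝ :=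
  (1 / (N : ℝ)) * ∑ t, logLoss (b t) (frobInner (Z t) Θ)

/-- The gradient of the average logistic loss. -/
noncomputable def logisticGrad (Z : Fin N → Matrix (Fin m) (Fin n) ℝ) (b : Fin N → ℝ)
    (Θ : Matrix (Fin m) (Fin n) ℝ) : Matrix (Fin m) (Fin n) ℝ :=
  (1 / (N : ℝ)) • ∑ t, (Real.sigmoid (frobInner (Z t) Θ) - b t) • Z t

theorem frobInner_sum_left {ι : Type*} (s : Finset ι) (A : ι → Matrix (Fin m) (Fin n) ℝ)
    (B : Matrix (Fin m) (Fin n) ℝ) :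
    frobInner (∑ t ∈ s, A t) B = ∑ t ∈ s, frobInner (A t) B := by
  classical
  induction s using Finset.induction_on with
  | empty => simp [frobInner]
  | insert a s ha ih => rw [Finset.sum_insert ha, Finset.sum_insert ha, frobInner_add_left, ih]

theorem frobInner_logisticGrad (Z : Fin N → Matrix (Fin m) (Fin n) ℝ) (b : Fin N → ℝ)
    (Θ E : Matrix (Fin m) (Fin n) ℝ) :
    frobInner (logisticGrad Z b Θ) E =
      (1 / (N : ℝ)) * ∑ t, (Real.sigmoid (frobInner (Z t) Θ) - b t) * frobInner (Z t) E := by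
  rw [logisticGrad, frobInner_smul_left, frobInner_sum_left]
  simp only [frobInner_smul_left]

theorem average_le {a : Fin N → ℝ} {c : ℝ} (hN : 0 < N) (h : ∀ t, a t ≤ c) :
    (1 / (N : ℝ)) * ∑ t, a t ≤ c := by
  have hN' : (0 : ℝ) < N := by exact_mod_cast hN
  have h1 : ∑ t, a t ≤ N * c := by
    refine (Finset.sum_le_sum fun t _ => h t).trans ?_
    simp
  rw [one_div, inv_mul_le_iff₀ hN']
  exact h1

theorem abs_frobInner_le_of_norm_le {Z Θ : Matrix (Fin m) (Fin n) ℝ} {R B : ℝ} (hZ : ‖Z‖ ≤ R)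
    (hΘ : ‖Θ‖ ≤ B) : |frobInner Z Θ| ≤ R * B :=
  (abs_frobInner_le _ _).trans
    (mul_le_mul hZ hΘ (norm_nonneg _) ((norm_nonneg _).trans hZ))

/-- Regularity of the average logistic loss on a sample with bounded features and well-conditioned
empirical second moment. -/
theorem logisticLoss_regular (Z : Fin N → Matrix (Fin m) (Fin n) ℝ) (b : Fin N → ℝ)
    (Θs : Matrix (Fin m) (Fin n) ℝ) {R B c α : ℝ} (hN : 0 < N) (hZ : ∀ t, ‖Z t‖ ≤ R)
    (hB : ∀ Θ, ‖Θ - Θs‖ ≤ 1 → ‖Θ‖ ≤ B)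
    (hemp : ∀ E, c * ‖E‖ ^ 2 ≤ (1 / (N : ℝ)) * ∑ t, frobInner (Z t) E ^ 2)
    (hα : α ≤ Real.sigmoid (R * B) * (1 - Real.sigmoid (R * B)) * c) :
    IsRegularLoss (logisticLoss Z b) (logisticGrad Z b) Θs α (R ^ 2 / 4) := by
  have hN' : (0 : ℝ) < N := by exact_mod_cast hN
  have hR : 0 ≤ R := (norm_nonneg _).trans (hZ ⟨0, hN⟩)
  set γ := Real.sigmoid (R * B) * (1 - Real.sigmoid (R * B)) with hγ
  have hγ0 : 0 ≤ γ :=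
    mul_nonneg (Real.sigmoid_nonneg _) (sub_nonneg.2 (Real.sigmoid_le_one _))
  -- Inside the unit ball all margins are at most R·B in absolute value, so each summand has
  -- curvature at least γ; `hemp` turns the average squared margin into a multiple of the squared
  -- norm.
  have hstrong : ∀ Θ Θ' : Matrix (Fin m) (Fin n) ℝ, ‖Θ - Θs‖ ≤ 1 → ‖Θ' - Θs‖ ≤ 1 →
      logisticLoss Z b Θ + frobInner (logisticGrad Z b Θ) (Θ' - Θ) + α / 2 * ‖Θ' - Θ‖ ^ 2 ≤
        logisticLoss Z b Θ' := by
    intro Θ Θ' hΘ hΘ'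
    have h1 : α / 2 * ‖Θ' - Θ‖ ^ 2 ≤
        (1 / (N : ℝ)) * ∑ t, γ / 2 * frobInner (Z t) (Θ' - Θ) ^ 2 := by
      rw [← Finset.mul_sum]
      calc _ ≤ γ * c / 2 * ‖Θ' - Θ‖ ^ 2 := by gcongr
        _ = γ / 2 * (c * ‖Θ' - Θ‖ ^ 2) := by ring
        _ ≤ γ / 2 * ((1 / (N : ℝ)) * ∑ t, frobInner (Z t) (Θ' - Θ) ^ 2) := by
          exact mul_le_mul_of_nonneg_left (hemp _) (by positivity)
        _ = _ := by ring
    refine (add_le_add_right h1 _).trans ?_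
    rw [frobInner_logisticGrad, logisticLoss, logisticLoss, ← mul_add, ← mul_add,
      ← Finset.sum_add_distrib, ← Finset.sum_add_distrib]
    gcongr with t
    rw [frobInner_sub_right]
    exact logLoss_ge_strong _ (abs_frobInner_le_of_norm_le (hZ t) (hB _ hΘ))
      (abs_frobInner_le_of_norm_le (hZ t) (hB _ hΘ'))
  refine ⟨fun Θ E => ?_, fun Θ E => ?_, fun Θ Θ' => ?_, fun Θ hΘ => ?_, fun Θ hΘ => ?_⟩
  · have h1 : (1 / (N : ℝ)) * ∑ t, frobInner (Z t) E ^ 2 / 8 ≤ R ^ 2 / 4 / 2 * ‖E‖ ^ 2 := by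
      refine average_le hN fun t => ?_
      have := pow_le_pow_left₀ (abs_nonneg _) (abs_frobInner_le_of_norm_le (hZ t) le_rfl) 2
        (b := R * ‖E‖)
      rw [sq_abs] at this
      nlinarith
    refine le_trans ?_ (add_le_add_right h1 _)
    rw [frobInner_logisticGrad, logisticLoss, logisticLoss, ← mul_add, ← mul_add,
      ← Finset.sum_add_distrib, ← Finset.sum_add_distrib]
    gcongr with t
    have := logLoss_le (b t) (frobInner (Z t) Θ) (frobInner (Z t) (Θ + E))
    rw [frobInner_add_right] at this ⊢
    rwa [add_sub_cancel_left] at this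
  · rw [frobInner_logisticGrad, logisticLoss, logisticLoss, ← mul_add, ← Finset.sum_add_distrib]
    gcongr with t
    have := logLoss_ge (b t) (frobInner (Z t) Θ) (frobInner (Z t) (Θ + E))
    rw [frobInner_add_right] at this ⊢
    rwa [add_sub_cancel_left] at this
  · have h1 : logisticGrad Z b Θ - logisticGrad Z b Θ' = (1 / (N : ℝ)) • ∑ t,
        (Real.sigmoid (frobInner (Z t) Θ) - Real.sigmoid (frobInner (Z t) Θ')) • Z t := by
      rw [logisticGrad, logisticGrad, ← smul_sub, ← Finset.sum_sub_distrib]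
      congr 1
      refine Finset.sum_congr rfl fun t _ => ?_
      rw [← sub_smul]
      congr 1
      ring
    rw [h1, frobenius_norm_smul, abs_of_pos (by positivity)]
    refine (mul_le_mul_of_nonneg_left (norm_sum_le _ _) (by positivity)).trans
      (average_le hN fun t => ?_)
    rw [frobenius_norm_smul]
    have h2 := abs_sigmoid_sub_le (frobInner (Z t) Θ) (frobInner (Z t) Θ')
    rw [← frobInner_sub_right] at h2
    calc _ ≤ 1 / 4 * (R * ‖Θ - Θ'‖) * R := by
          gcongr
          · exact h2.trans (by gcongr; exact abs_frobInner_le_of_norm_le (hZ t) le_rfl)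
          · exact hZ t
      _ = _ := by ring
  · exact hstrong Θs Θ (by simp) hΘ
  · have := hstrong Θ Θs hΘ (by simp)
    have e1 : Θs - Θ = -(Θ - Θs) := by simp
    rw [e1, frobInner_neg_right, norm_neg] at this
    linarith

end Logistic

/-! ### Feature matrices; the likelihood as a logistic loss. -/

section Features

variable {dx dφ N : ℕ} {S A : Type*}

/-- The rank-one matrix `x ψᵀ` of a comparison. -/
def featureMat (φ : S → A → EuclideanSpace ℝ (Fin dφ)) (w : Query dx S A) :
    Matrix (Fin dx) (Fin dφ) ℝ :=
  Matrix.of fun i j => w.1 i * (φ w.2.1 w.2.2.2 - φ w.2.1 w.2.2.1) j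

theorem featureVec_eq (φ : S → A → EuclideanSpace ℝ (Fin dφ)) (w : Query dx S A)
    (p : Fin dφ × Fin dx) : featureVec φ w p = featureMat φ w p.2 p.1 := by
  simp [featureVec, featureMat, mul_comm]

theorem frobInner_featureMat (φ : S → A → EuclideanSpace ℝ (Fin dφ)) (w : Query dx S A)
    (Θ : Matrix (Fin dx) (Fin dφ) ℝ) :
    frobInner (featureMat φ w) Θ =
      w.1.ofLp ⬝ᵥ (Θ *ᵥ (φ w.2.1 w.2.2.2 - φ w.2.1 w.2.2.1).ofLp) := by
  simp only [frobInner, featureMat, Matrix.of_apply, dotProduct, Matrix.mulVec, Finset.mul_sum]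
  refine Finset.sum_congr rfl fun i _ => Finset.sum_congr rfl fun j _ => ?_
  ring

theorem negLogLik_eq_logisticLoss (φ : S → A → EuclideanSpace ℝ (Fin dφ))
    (w : Fin N → Query dx S A) (y : Fin N → Bool) :
    negLogLik φ w y = logisticLoss (fun t => featureMat φ (w t)) fun t => ((y t).toNat : ℝ) := by
  ext Θ
  simp only [negLogLik, logisticLoss, logLoss, frobInner_featureMat]

theorem btlProb_eq_sigmoid (φ : S → A → EuclideanSpace ℝ (Fin dφ)) (w : Query dx S A)
    (Θ : Matrix (Fin dx) (Fin dφ) ℝ) :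
    btlProb φ Θ w = Real.sigmoid (frobInner (featureMat φ w) Θ) := by
  rw [frobInner_featureMat, btlProb, Real.sigmoid_def]
  have h : w.1.ofLp ⬝ᵥ (Θ *ᵥ (φ w.2.1 w.2.2.2 - φ w.2.1 w.2.2.1).ofLp) =
      reward φ Θ w.1 w.2.1 w.2.2.2 - reward φ Θ w.1 w.2.1 w.2.2.1 := by
    simp [reward, Matrix.mulVec_sub, dotProduct_sub]
  rw [h, neg_sub, Real.exp_sub]
  have h1 := Real.exp_pos (reward φ Θ w.1 w.2.1 w.2.2.2)
  have h2 := Real.exp_pos (reward φ Θ w.1 w.2.1 w.2.2.1)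
  field_simp
  ring

theorem norm_featureMat_le (φ : S → A → EuclideanSpace ℝ (Fin dφ)) {w : Query dx S A} {Bx Bφ : ℝ}
    (hx : ‖w.1‖ ≤ Bx) (hφ : ∀ s a, ‖φ s a‖ ≤ Bφ) : ‖featureMat φ w‖ ≤ 2 * Bφ * Bx := by
  have h1 : ‖featureMat φ w‖ = ‖w.1‖ * ‖φ w.2.1 w.2.2.2 - φ w.2.1 w.2.2.1‖ := by
    rw [← sq_eq_sq₀ (norm_nonneg _) (by positivity), mul_pow, frobenius_norm_sq_eq_sum,
      EuclideanSpace.norm_sq_eq, EuclideanSpace.norm_sq_eq, Finset.sum_mul_sum]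
    simp [featureMat, mul_pow]
  have h2 : ‖φ w.2.1 w.2.2.2 - φ w.2.1 w.2.2.1‖ ≤ 2 * Bφ :=
    (norm_sub_le _ _).trans (by linarith [hφ w.2.1 w.2.2.2, hφ w.2.1 w.2.2.1])
  rw [h1, mul_comm]
  exact mul_le_mul h2 hx (norm_nonneg _) ((norm_nonneg _).trans h2)

theorem measurable_featureMat [MeasurableSpace S] [MeasurableSpace A]
    {φ : S → A → EuclideanSpace ℝ (Fin dφ)} (hφ : Measurable (Function.uncurry φ)) (i : Fin dx)
    (j : Fin dφ) : Measurable fun w : Query dx S A => featureMat φ w i j := by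
  have h1 : Measurable fun w : Query dx S A => φ w.2.1 w.2.2.2 :=
    hφ.comp (f := fun w : Query dx S A => (w.2.1, w.2.2.2)) (by fun_prop)
  have h0 : Measurable fun w : Query dx S A => φ w.2.1 w.2.2.1 :=
    hφ.comp (f := fun w : Query dx S A => (w.2.1, w.2.2.1)) (by fun_prop)
  have hc : ∀ {d : ℕ} (j : Fin d), Measurable fun v : EuclideanSpace ℝ (Fin d) => v j := by
    intro d j; fun_prop
  exact ((hc i).comp measurable_fst).mul ((hc j).comp (h1.sub h0))

theorem abs_apply_le_frobenius_norm {m n : ℕ} (A : Matrix (Fin m) (Fin n) ℝ) (i : Fin m)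
    (j : Fin n) : |A i j| ≤ ‖A‖ := by
  refine abs_le_of_sq_le_sq ?_ (norm_nonneg _)
  rw [frobenius_norm_sq_eq_sum]
  exact (Finset.single_le_sum (f := fun j => A i j ^ 2) (fun j _ => sq_nonneg _)
    (Finset.mem_univ j)).trans (Finset.single_le_sum (f := fun i => ∑ j, A i j ^ 2)
      (fun i _ => Finset.sum_nonneg fun j _ => sq_nonneg _) (Finset.mem_univ i))

end Features

/-! ### Hoeffding's inequality. -/

section Concentration

variable {Ω : Type*} [MeasurableSpace Ω] {μ : Measure Ω} [IsProbabilityMeasure μ] {N : ℕ}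

/-- Hoeffding's inequality for the average of bounded centered independent variables. -/
theorem measure_le_average_le {X : Fin N → Ω → ℝ} (hX : iIndepFun X μ)
    (hm : ∀ t, Measurable (X t)) {b ε : ℝ} (hb : 0 < b) (hbd : ∀ t, ∀ᵐ ω ∂μ, |X t ω| ≤ b)
    (hc : ∀ t, ∫ ω, X t ω ∂μ = 0) (hN : 0 < N) (hε : 0 ≤ ε) :
    μ.real {ω | ε ≤ (1 / (N : ℝ)) * ∑ t, X t ω} ≤ Real.exp (-(N * ε ^ 2 / (2 * b ^ 2))) := by
  have hN' : (0 : ℝ) < N := by exact_mod_cast hN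
  have h1 := HasSubgaussianMGF.measure_sum_ge_le_of_iIndepFun hX (s := Finset.univ)
    -- The interval [−b, b] has half-length b, so the variance proxy is b².
    (c := fun _ => (‖b - (-b)‖₊ / 2) ^ 2)
    (fun t _ => hasSubgaussianMGF_of_mem_Icc_of_integral_eq_zero (hm t).aemeasurable
      ((hbd t).mono fun ω h => abs_le.1 h) (hc t)) (ε := N * ε) (by positivity)
  have e1 : {ω | ε ≤ (1 / (N : ℝ)) * ∑ t, X t ω} = {ω | N * ε ≤ ∑ t, X t ω} := by
    ext ω
    simp only [Set.mem_ofPred_eq]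
    rw [one_div, le_inv_mul_iff₀ hN']
  rw [e1]
  refine h1.trans (le_of_eq ?_)
  congr 1
  have e2 : ‖b - (-b)‖ / 2 = b := by
    rw [sub_neg_eq_add, Real.norm_eq_abs, abs_of_pos (by linarith)]; ring
  simp only [Finset.sum_const, Finset.card_univ, Fintype.card_fin, nsmul_eq_mul, NNReal.coe_mul,
    NNReal.coe_natCast, NNReal.coe_pow, NNReal.coe_div, coe_nnnorm, NNReal.coe_ofNat, e2]
  field_simp

theorem measure_le_abs_average_le {X : Fin N → Ω → ℝ} (hX : iIndepFun X μ)
    (hm : ∀ t, Measurable (X t)) {b ε : ℝ} (hb : 0 < b) (hbd : ∀ t, ∀ᵐ ω ∂μ, |X t ω| ≤ b)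
    (hc : ∀ t, ∫ ω, X t ω ∂μ = 0) (hN : 0 < N) (hε : 0 ≤ ε) :
    μ {ω | ε ≤ |(1 / (N : ℝ)) * ∑ t, X t ω|} ≤
      ENNReal.ofReal (2 * Real.exp (-(N * ε ^ 2 / (2 * b ^ 2)))) := by
  have h1 := measure_le_average_le hX hm hb hbd hc hN hε
  have h2 := measure_le_average_le (X := fun t ω => -X t ω)
    (hX.comp (fun _ x => -x) fun _ => measurable_neg) (fun t => (hm t).neg) hb
    (by simpa using hbd) (fun t => by rw [integral_neg, hc t, neg_zero]) hN hε
  have hsub : {ω | ε ≤ |(1 / (N : ℝ)) * ∑ t, X t ω|} ⊆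
      {ω | ε ≤ (1 / (N : ℝ)) * ∑ t, X t ω} ∪ {ω | ε ≤ (1 / (N : ℝ)) * ∑ t, -X t ω} := by
    intro ω hω
    rcases le_abs.1 (show ε ≤ |(1 / (N : ℝ)) * ∑ t, X t ω| from hω) with h | h
    · exact Or.inl h
    · right
      simpa using h
  rw [ENNReal.le_ofReal_iff_toReal_le (measure_ne_top _ _) (by positivity)]
  calc μ.real _ ≤ μ.real _ := measureReal_mono hsub
    _ ≤ _ := measureReal_union_le _ _
    _ ≤ _ := by linarith

end Concentration

/-! ### Entrywise bounds on the score and on z zᵀ. -/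

section Scores

variable {dx dφ N : ℕ} {S A : Type*} {φ : S → A → EuclideanSpace ℝ (Fin dφ)}
  {Θs : Matrix (Fin dx) (Fin dφ) ℝ} {R : ℝ}

/-- One term of the gradient of the negative log-likelihood. -/
noncomputable def scoreEntry (φ : S → A → EuclideanSpace ℝ (Fin dφ))
    (Θs : Matrix (Fin dx) (Fin dφ) ℝ) (i : Fin dx) (j : Fin dφ) (q : Query dx S A × Bool) : ℝ :=
  (Real.sigmoid (frobInner (featureMat φ q.1) Θs) - (q.2.toNat : ℝ)) * featureMat φ q.1 i j

theorem abs_scoreEntry_le (i : Fin dx) (j : Fin dφ) {q : Query dx S A × Bool}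
    (hR : ‖featureMat φ q.1‖ ≤ R) : |scoreEntry φ Θs i j q| ≤ R := by
  have h1 := (abs_apply_le_frobenius_norm (featureMat φ q.1) i j).trans hR
  have h2 : |Real.sigmoid (frobInner (featureMat φ q.1) Θs) - (q.2.toNat : ℝ)| ≤ 1 := by
    have h3 := Real.sigmoid_nonneg (frobInner (featureMat φ q.1) Θs)
    have h4 := Real.sigmoid_le_one (frobInner (featureMat φ q.1) Θs)
    rw [abs_le]
    cases q.2 <;> simp <;> constructor <;> linarith
  rw [scoreEntry, abs_mul]
  exact (mul_le_of_le_one_left (abs_nonneg _) h2).trans h1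

theorem abs_featureVec_mul_le {w : Query dx S A} (hR : ‖featureMat φ w‖ ≤ R)
    (p q : Fin dφ × Fin dx) : |featureVec φ w p * featureVec φ w q| ≤ R ^ 2 := by
  rw [abs_mul, sq, featureVec_eq, featureVec_eq]
  have h0 := (norm_nonneg _).trans hR
  exact mul_le_mul ((abs_apply_le_frobenius_norm _ _ _).trans hR)
    ((abs_apply_le_frobenius_norm _ _ _).trans hR) (abs_nonneg _) h0

/-- Presents the squared margin as a quadratic form in z zᵀ, so that entrywise accuracy serves all
`E` at once. -/
theorem sum_featureVec_mul_eq (w : Query dx S A) (E : Matrix (Fin dx) (Fin dφ) ℝ) :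
    frobInner (featureMat φ w) E ^ 2 = ∑ p : Fin dφ × Fin dx, ∑ q : Fin dφ × Fin dx,
      E p.2 p.1 * E q.2 q.1 * (featureVec φ w p * featureVec φ w q) := by
  have h1 : frobInner (featureMat φ w) E =
      ∑ p : Fin dφ × Fin dx, E p.2 p.1 * featureVec φ w p := by
    simp only [featureVec_eq]
    rw [frobInner, Finset.sum_comm, Fintype.sum_prod_type]
    simp only [mul_comm]
  rw [h1, sq, Finset.sum_mul_sum]
  refine Finset.sum_congr rfl fun p _ => Finset.sum_congr rfl fun q _ => ?_
  ring

/-- If the entries of the score are small, so is the gradient at the true parameter. -/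
theorem norm_logisticGrad_le {w : Fin N → Query dx S A} {b : Fin N → Bool} {ε D : ℝ}
    (hD : (dx : ℝ) * dφ ≤ D) (hD1 : 1 ≤ D) (hε : 0 ≤ ε)
    (h : ∀ i j, |(1 / (N : ℝ)) * ∑ t, scoreEntry φ Θs i j (w t, b t)| ≤ ε) :
    ‖logisticGrad (fun t => featureMat φ (w t)) (fun t => ((b t).toNat : ℝ)) Θs‖ ≤ D * ε := by
  refine le_of_sq_le_sq ?_ (by positivity)
  rw [frobenius_norm_sq_eq_sum]
  have h1 : ∀ i j, logisticGrad (fun t => featureMat φ (w t)) (fun t => ((b t).toNat : ℝ)) Θs i j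
      ^ 2 ≤ ε ^ 2 := by
    intro i j
    have e1 : logisticGrad (fun t => featureMat φ (w t)) (fun t => ((b t).toNat : ℝ)) Θs i j =
        (1 / (N : ℝ)) * ∑ t, scoreEntry φ Θs i j (w t, b t) := by
      simp [logisticGrad, scoreEntry, Matrix.sum_apply]
    rw [e1, ← sq_abs]
    exact pow_le_pow_left₀ (abs_nonneg _) (h i j) 2
  refine (Finset.sum_le_sum fun i _ => Finset.sum_le_sum fun j _ => h1 i j).trans ?_
  simp only [Finset.sum_const, Finset.card_univ, Fintype.card_fin, nsmul_eq_mul]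
  -- The factor √D would do; D ≥ 1 avoids the root.
  have h2 : D ≤ D ^ 2 := by nlinarith
  calc (dx : ℝ) * (dφ * ε ^ 2) = dx * dφ * ε ^ 2 := by ring
    _ ≤ D ^ 2 * ε ^ 2 := by gcongr; linarith
    _ = _ := by ring

end Scores

/-! ### Expectations under the model and the probability of the good event. -/

section Model

variable {dx dφ N : ℕ} {S A Ω : Type*} [MeasurableSpace S] [MeasurableSpace A]
  [MeasurableSpace Ω] {μ : Measure Ω} {P : Measure (Query dx S A)}
  {φ : S → A → EuclideanSpace ℝ (Fin dφ)} {Θs : Matrix (Fin dx) (Fin dφ) ℝ}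
  {W : Fin N → Ω → Query dx S A} {y : Fin N → Ω → Bool} {R : ℝ}

theorem measurable_frobInner_featureMat (hφ : Measurable (Function.uncurry φ))
    (Θ : Matrix (Fin dx) (Fin dφ) ℝ) :
    Measurable fun w : Query dx S A => frobInner (featureMat φ w) Θ := by
  unfold frobInner
  exact Finset.measurable_sum _ fun i _ => Finset.measurable_sum _ fun j _ =>
    (measurable_featureMat hφ i j).mul_const _

theorem measurable_btlProb (hφ : Measurable (Function.uncurry φ)) :
    Measurable fun w : Query dx S A => btlProb φ Θs w := by
  simp only [btlProb_eq_sigmoid]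
  exact continuous_sigmoid.measurable.comp (measurable_frobInner_featureMat hφ Θs)

theorem IsBTLData.ae_query (h : IsBTLData μ P φ Θs W y) {p : Query dx S A → Prop}
    (hp : ∀ᵐ w ∂P, p w) (t : Fin N) : ∀ᵐ ω ∂μ, p (W t ω) := by
  rw [← h.law t] at hp
  exact ae_of_ae_map (h.measurable_query t).aemeasurable hp

theorem IsBTLData.integral_query (h : IsBTLData μ P φ Θs W y) {f : Query dx S A → ℝ}
    (hf : Measurable f) (t : Fin N) : ∫ ω, f (W t ω) ∂μ = ∫ w, f w ∂P := by
  rw [← h.law t, integral_map (h.measurable_query t).aemeasurable hf.aestronglyMeasurable]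

theorem IsBTLData.measurableSet_label (h : IsBTLData μ P φ Θs W y) (t : Fin N) :
    MeasurableSet {ω | y t ω = true} := h.measurable_label t (measurableSet_singleton true)

/-- The label law is given on sets only; as a density it yields the tower property of
`IsBTLData.integral_label_mul`. -/
theorem IsBTLData.map_restrict (h : IsBTLData μ P φ Θs W y) (t : Fin N) :
    (μ.restrict {ω | y t ω = true}).map (W t) =
      P.withDensity fun w => ENNReal.ofReal (btlProb φ Θs w) := by
  ext B hB
  rw [Measure.map_apply (h.measurable_query t) hB,
    Measure.restrict_apply (h.measurable_query t hB), withDensity_apply _ hB, ← h.label t B hB]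
  rfl

theorem IsBTLData.integral_label_mul (h : IsBTLData μ P φ Θs W y)
    (hφ : Measurable (Function.uncurry φ)) {f : Query dx S A → ℝ} (hf : Measurable f)
    (t : Fin N) :
    ∫ ω, ((y t ω).toNat : ℝ) * f (W t ω) ∂μ = ∫ w, btlProb φ Θs w * f w ∂P := by
  have e1 : (fun ω => ((y t ω).toNat : ℝ) * f (W t ω)) =
      {ω | y t ω = true}.indicator fun ω => f (W t ω) := by
    ext ω
    by_cases hy : y t ω = true <;> simp [Set.indicator, hy]
  rw [e1, integral_indicator (h.measurableSet_label t),
    ← integral_map (h.measurable_query t).aemeasurable hf.aestronglyMeasurable, h.map_restrict t,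
    integral_withDensity_eq_integral_toReal_smul (measurable_btlProb hφ).ennreal_ofReal
      (ae_of_all _ fun _ => ENNReal.ofReal_lt_top)]
  refine integral_congr_ae (ae_of_all _ fun w => ?_)
  have : 0 ≤ btlProb φ Θs w := by rw [btlProb_eq_sigmoid]; exact Real.sigmoid_nonneg _
  simp [ENNReal.toReal_ofReal this]

theorem integrable_of_abs_le {X : Type*} [MeasurableSpace X] {ν : Measure X} [IsFiniteMeasure ν]
    {f : X → ℝ} (hf : Measurable f) {b : ℝ} (hb : ∀ᵐ x ∂ν, |f x| ≤ b) : Integrable f ν :=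
  Integrable.of_bound hf.aestronglyMeasurable b hb

theorem measurable_scoreEntry (hφ : Measurable (Function.uncurry φ)) (i : Fin dx) (j : Fin dφ) :
    Measurable (scoreEntry φ Θs i j) := by
  have hb : Measurable fun b : Bool => (b.toNat : ℝ) := measurable_of_finite _
  exact (((continuous_sigmoid.measurable.comp (measurable_frobInner_featureMat hφ Θs)).comp
    measurable_fst).sub (hb.comp measurable_snd)).mul
      ((measurable_featureMat hφ i j).comp measurable_fst)

/-- Given the query, the label has mean `btlProb`, which is the sigmoid of the true margin; hence
the score is centered. -/
theorem IsBTLData.integral_scoreEntry [IsProbabilityMeasure μ] (h : IsBTLData μ P φ Θs W y)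
    (hφ : Measurable (Function.uncurry φ)) (hR : ∀ᵐ w ∂P, ‖featureMat φ w‖ ≤ R) (i : Fin dx)
    (j : Fin dφ) (t : Fin N) : ∫ ω, scoreEntry φ Θs i j (W t ω, y t ω) ∂μ = 0 := by
  have hz := measurable_featureMat hφ i j
  have hs : Measurable fun w : Query dx S A =>
      Real.sigmoid (frobInner (featureMat φ w) Θs) * featureMat φ w i j :=
    (continuous_sigmoid.measurable.comp (measurable_frobInner_featureMat hφ Θs)).mul hz
  have hb : Measurable fun b : Bool => (b.toNat : ℝ) := measurable_of_finite _
  have hRμ := h.ae_query hR t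
  have i1 : Integrable (fun ω => Real.sigmoid (frobInner (featureMat φ (W t ω)) Θs) *
      featureMat φ (W t ω) i j) μ := by
    refine integrable_of_abs_le (b := R) (hs.comp (h.measurable_query t)) (hRμ.mono fun ω hω => ?_)
    rw [abs_mul, abs_of_nonneg (Real.sigmoid_nonneg _)]
    exact (mul_le_of_le_one_left (abs_nonneg _) (Real.sigmoid_le_one _)).trans
      ((abs_apply_le_frobenius_norm _ i j).trans hω)
  have i2 : Integrable (fun ω => ((y t ω).toNat : ℝ) * featureMat φ (W t ω) i j) μ := by
    refine integrable_of_abs_le (b := R) ((hb.comp (h.measurable_label t)).mul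
      (hz.comp (h.measurable_query t))) (hRμ.mono fun ω hω => ?_)
    rw [abs_mul]
    refine (mul_le_of_le_one_left (abs_nonneg _) ?_).trans
      ((abs_apply_le_frobenius_norm _ i j).trans hω)
    cases y t ω <;> simp
  simp only [scoreEntry, sub_mul]
  rw [integral_sub i1 i2, h.integral_query hs t, h.integral_label_mul hφ hz t, sub_eq_zero]
  simp only [btlProb_eq_sigmoid]

/-- One centered term of an entry of the empirical second moment matrix. -/
noncomputable def momentEntry (φ : S → A → EuclideanSpace ℝ (Fin dφ)) (P : Measure (Query dx S A))
    (p q : Fin dφ × Fin dx) (w : Query dx S A) : ℝ :=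
  featureVec φ w p * featureVec φ w q - secondMoment φ P p q

theorem measurable_featureVec_mul (hφ : Measurable (Function.uncurry φ)) (p q : Fin dφ × Fin dx) :
    Measurable fun w : Query dx S A => featureVec φ w p * featureVec φ w q := by
  simp only [featureVec_eq]
  exact (measurable_featureMat hφ _ _).mul (measurable_featureMat hφ _ _)

theorem integrable_featureVec_mul [IsProbabilityMeasure P] (hφ : Measurable (Function.uncurry φ))
    (hR : ∀ᵐ w ∂P, ‖featureMat φ w‖ ≤ R) (p q : Fin dφ × Fin dx) :
    Integrable (fun w => featureVec φ w p * featureVec φ w q) P :=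
  integrable_of_abs_le (measurable_featureVec_mul hφ p q)
    (hR.mono fun _ hw => abs_featureVec_mul_le hw p q)

theorem abs_momentEntry_le [IsProbabilityMeasure P] (hR : ∀ᵐ w ∂P, ‖featureMat φ w‖ ≤ R)
    (p q : Fin dφ × Fin dx) {w : Query dx S A} (hw : ‖featureMat φ w‖ ≤ R) :
    |momentEntry φ P p q w| ≤ 2 * R ^ 2 := by
  have h1 : |secondMoment φ P p q| ≤ R ^ 2 := by
    have := norm_integral_le_of_norm_le_const (μ := P) (C := R ^ 2)
      (f := fun w => featureVec φ w p * featureVec φ w q)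
      (hR.mono fun _ hw => abs_featureVec_mul_le hw p q)
    simpa [secondMoment] using this
  have h2 := abs_featureVec_mul_le hw p q
  exact (abs_sub _ _).trans (by linarith)

theorem IsBTLData.integral_momentEntry [IsProbabilityMeasure P] (h : IsBTLData μ P φ Θs W y)
    (hφ : Measurable (Function.uncurry φ)) (hR : ∀ᵐ w ∂P, ‖featureMat φ w‖ ≤ R)
    (p q : Fin dφ × Fin dx) (t : Fin N) : ∫ ω, momentEntry φ P p q (W t ω) ∂μ = 0 := by
  rw [h.integral_query (f := momentEntry φ P p q)
    ((measurable_featureVec_mul hφ p q).sub_const _) t]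
  unfold momentEntry
  rw [integral_sub (integrable_featureVec_mul hφ hR p q) (integrable_const _)]
  simp [secondMoment]

/-- A lower bound on the second moment matrix bounds the number of parameters. -/
theorem card_le_of_secondMoment [IsProbabilityMeasure P] (hφ : Measurable (Function.uncurry φ))
    (hR : ∀ᵐ w ∂P, ‖featureMat φ w‖ ≤ R) {lam : ℝ}
    (hS : (secondMoment φ P -
      lam • (1 : Matrix (Fin dφ × Fin dx) (Fin dφ × Fin dx) ℝ)).PosSemidef) :
    dx * dφ * lam ≤ R ^ 2 := by
  -- Positive semidefiniteness makes each diagonal second moment at least λ, while their sum is the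
  -- mean of ‖featureMat‖², at most R².
  have h1 : ∀ p : Fin dφ × Fin dx, lam ≤ ∫ w, featureVec φ w p * featureVec φ w p ∂P := by
    intro p
    have := hS.diag_nonneg (i := p)
    simpa [secondMoment] using this
  have h2 : ∑ p : Fin dφ × Fin dx, ∫ w, featureVec φ w p * featureVec φ w p ∂P ≤ R ^ 2 := by
    rw [← integral_finsetSum _ fun p _ => integrable_featureVec_mul hφ hR p p]
    calc _ ≤ ∫ _w, R ^ 2 ∂P := by
          refine integral_mono_ae (integrable_finsetSum _ fun p _ =>
            integrable_featureVec_mul hφ hR p p) (integrable_const _) (hR.mono fun w hw => ?_)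
          have h3 := pow_le_pow_left₀ (norm_nonneg _) hw 2
          rw [frobenius_norm_sq_eq_sum, Finset.sum_comm, ← Fintype.sum_prod_type'] at h3
          simpa only [featureVec_eq, ← sq] using h3
      _ = _ := by simp
  have h3 := Finset.sum_le_sum fun (p : Fin dφ × Fin dx) (_ : p ∈ Finset.univ) => h1 p
  rw [Finset.sum_const, Finset.card_univ, Fintype.card_prod, Fintype.card_fin, Fintype.card_fin,
    nsmul_eq_mul] at h3
  push_cast at h3
  linarith [mul_comm (dx : ℝ) dφ]

/-- If the entries of the empirical second moment matrix are accurate, it inherits a lower bound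
from the population second moment matrix. -/
theorem empirical_secondMoment_ge {lam ε : ℝ} (hN : 0 < N) {w : Fin N → Query dx S A}
    (hS : (secondMoment φ P -
      lam • (1 : Matrix (Fin dφ × Fin dx) (Fin dφ × Fin dx) ℝ)).PosSemidef)
    (hε : dx * dφ * ε ≤ lam / 2) (hε0 : 0 ≤ ε)
    (h : ∀ p q, |(1 / (N : ℝ)) * ∑ t, momentEntry φ P p q (w t)| ≤ ε)
    (E : Matrix (Fin dx) (Fin dφ) ℝ) :
    lam / 2 * ‖E‖ ^ 2 ≤ (1 / (N : ℝ)) * ∑ t, frobInner (featureMat φ (w t)) E ^ 2 := by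
  have hN' : (N : ℝ) ≠ 0 := by exact_mod_cast hN.ne'
  set v : Fin dφ × Fin dx → ℝ := fun p => E p.2 p.1 with hv
  have hEv : ‖E‖ ^ 2 = ∑ p, v p ^ 2 := by
    rw [frobenius_norm_sq_eq_sum, Finset.sum_comm, ← Fintype.sum_prod_type']
  have h1 : lam * ‖E‖ ^ 2 ≤ ∑ p, ∑ q, v p * v q * secondMoment φ P p q := by
    have h2 := hS.dotProduct_mulVec_nonneg v
    rw [Matrix.sub_mulVec, dotProduct_sub, Matrix.smul_mulVec, Matrix.one_mulVec,
      dotProduct_smul] at h2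
    have e1 : star v ⬝ᵥ (secondMoment φ P *ᵥ v) =
        ∑ p, ∑ q, v p * v q * secondMoment φ P p q := by
      simp only [dotProduct, Matrix.mulVec, Finset.mul_sum, star_trivial]
      refine Finset.sum_congr rfl fun p _ => Finset.sum_congr rfl fun q _ => ?_
      ring
    have e2 : star v ⬝ᵥ v = ‖E‖ ^ 2 := by
      rw [hEv]; simp [dotProduct, sq]
    rw [e1, e2, smul_eq_mul] at h2
    linarith
  have h2 : (1 / (N : ℝ)) * ∑ t, frobInner (featureMat φ (w t)) E ^ 2 =
      ∑ p, ∑ q, v p * v q * secondMoment φ P p q +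
        ∑ p, ∑ q, v p * v q * ((1 / (N : ℝ)) * ∑ t, momentEntry φ P p q (w t)) := by
    rw [← Finset.sum_add_distrib]
    simp only [← Finset.sum_add_distrib, ← mul_add]
    have e1 : ∀ p q, secondMoment φ P p q + (1 / (N : ℝ)) * ∑ t, momentEntry φ P p q (w t) =
        (1 / (N : ℝ)) * ∑ t, featureVec φ (w t) p * featureVec φ (w t) q := by
      intro p q
      simp only [momentEntry, Finset.sum_sub_distrib, Finset.sum_const, Finset.card_univ,
        Fintype.card_fin, nsmul_eq_mul]
      field_simp
      ring
    simp only [e1, sum_featureVec_mul_eq]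
    rw [Finset.sum_comm, Finset.mul_sum]
    refine Finset.sum_congr rfl fun p _ => ?_
    rw [Finset.sum_comm, Finset.mul_sum]
    refine Finset.sum_congr rfl fun q _ => ?_
    rw [← Finset.mul_sum]
    ring
  -- Entrywise errors ε change the quadratic form by at most ε(∑|v p|)², which Cauchy-Schwarz bounds
  -- by ε·dx·dφ·‖E‖².
  have h3 : |∑ p, ∑ q, v p * v q * ((1 / (N : ℝ)) * ∑ t, momentEntry φ P p q (w t))| ≤
      lam / 2 * ‖E‖ ^ 2 := by
    calc _ ≤ ∑ p, ∑ q, |v p| * |v q| * ε := by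
          refine (Finset.abs_sum_le_sum_abs _ _).trans (Finset.sum_le_sum fun p _ =>
            (Finset.abs_sum_le_sum_abs _ _).trans (Finset.sum_le_sum fun q _ => ?_))
          rw [abs_mul, abs_mul]
          gcongr
          exact h p q
      _ = (∑ p, |v p|) ^ 2 * ε := by
          rw [sq, Finset.sum_mul_sum, Finset.sum_mul]
          simp only [Finset.sum_mul]
      _ ≤ (dx * dφ * ‖E‖ ^ 2) * ε := by
          gcongr
          have := sq_sum_le_card_mul_sum_sq (s := Finset.univ) (f := fun p => |v p|)
          rw [Finset.card_univ, Fintype.card_prod, Fintype.card_fin, Fintype.card_fin] at this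
          push_cast at this
          simp only [sq_abs] at this
          rw [hEv, mul_comm (dx : ℝ)]
          exact this
      _ = dx * dφ * ε * ‖E‖ ^ 2 := by ring
      _ ≤ _ := by gcongr
  have h4 := (abs_le.1 h3).1
  linarith

/-- The event on which the features are bounded and the score and the second moments are
accurate. -/
def goodEvent (P : Measure (Query dx S A)) (φ : S → A → EuclideanSpace ℝ (Fin dφ))
    (Θs : Matrix (Fin dx) (Fin dφ) ℝ) (W : Fin N → Ω → Query dx S A) (y : Fin N → Ω → Bool)
    (R ε₁ ε₂ : ℝ) : Set Ω :=
  {ω | (∀ t, ‖featureMat φ (W t ω)‖ ≤ R) ∧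
    (∀ i j, |(1 / (N : ℝ)) * ∑ t, scoreEntry φ Θs i j (W t ω, y t ω)| < ε₁) ∧
    ∀ p q, |(1 / (N : ℝ)) * ∑ t, momentEntry φ P p q (W t ω)| < ε₂}

theorem measurable_norm_featureMat (hφ : Measurable (Function.uncurry φ)) :
    Measurable fun w : Query dx S A => ‖featureMat φ w‖ := by
  have h1 : (fun w : Query dx S A => ‖featureMat φ w‖) =
      fun w => Real.sqrt (∑ i, ∑ j, featureMat φ w i j ^ 2) := by
    ext w
    rw [← frobenius_norm_sq_eq_sum, Real.sqrt_sq (norm_nonneg _)]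
  rw [h1]
  exact (Finset.measurable_sum _ fun i _ => Finset.measurable_sum _ fun j _ =>
    (measurable_featureMat hφ i j).pow_const 2).sqrt

theorem IsBTLData.measurableSet_goodEvent (h : IsBTLData μ P φ Θs W y)
    (hφ : Measurable (Function.uncurry φ)) (ε₁ ε₂ : ℝ) :
    MeasurableSet (goodEvent P φ Θs W y R ε₁ ε₂) := by
  refine MeasurableSet.inter (s₁ := {ω | ∀ t, ‖featureMat φ (W t ω)‖ ≤ R}) ?_
    (MeasurableSet.inter
      (s₁ := {ω | ∀ i j, |(1 / (N : ℝ)) * ∑ t, scoreEntry φ Θs i j (W t ω, y t ω)| < ε₁})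
      (s₂ := {ω | ∀ p q, |(1 / (N : ℝ)) * ∑ t, momentEntry φ P p q (W t ω)| < ε₂}) ?_ ?_)
  · rw [Set.ofPred_forall]
    exact MeasurableSet.iInter fun t => measurableSet_le
      ((measurable_norm_featureMat hφ).comp (h.measurable_query t)) measurable_const
  · simp only [Set.ofPred_forall]
    refine MeasurableSet.iInter fun i => MeasurableSet.iInter fun j => measurableSet_lt
      ((Finset.measurable_sum _ fun t _ => ?_).const_mul _).abs measurable_const
    exact (measurable_scoreEntry hφ i j).comp
      ((h.measurable_query t).prodMk (h.measurable_label t))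
  · simp only [Set.ofPred_forall]
    refine MeasurableSet.iInter fun p => MeasurableSet.iInter fun q => measurableSet_lt
      ((Finset.measurable_sum _ fun t _ => ?_).const_mul _).abs measurable_const
    exact ((measurable_featureVec_mul hφ p q).sub_const _).comp (h.measurable_query t)

/-- Union bound over dx·dφ ≤ D² score entries and (dx·dφ)² ≤ D² moment entries, each failing with
probability at most 2η; violation of the feature bound is a null event. -/
theorem IsBTLData.measure_goodEvent_compl_le [IsProbabilityMeasure μ] [IsProbabilityMeasure P]
    (h : IsBTLData μ P φ Θs W y) (hφ : Measurable (Function.uncurry φ)) (hR0 : 0 < R)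
    (hR : ∀ᵐ w ∂P, ‖featureMat φ w‖ ≤ R) (hN : 0 < N) {ε₁ ε₂ D η : ℝ} (hε₁ : 0 ≤ ε₁)
    (hε₂ : 0 ≤ ε₂) (hD : (dx : ℝ) * dφ ≤ D) (hD1 : 1 ≤ D)
    (h₁ : Real.exp (-(N * ε₁ ^ 2 / (2 * R ^ 2))) ≤ η)
    (h₂ : Real.exp (-(N * ε₂ ^ 2 / (2 * (2 * R ^ 2) ^ 2))) ≤ η) :
    μ (goodEvent P φ Θs W y R ε₁ ε₂)ᶜ ≤ ENNReal.ofReal (4 * D ^ 2 * η) := by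
  have hη : 0 ≤ η := (Real.exp_pos _).le.trans h₁
  have hRt : ∀ t, ∀ᵐ ω ∂μ, ‖featureMat φ (W t ω)‖ ≤ R := fun t => h.ae_query hR t
  set F0 := {ω | ¬ ∀ t, ‖featureMat φ (W t ω)‖ ≤ R}
  set F1 : Fin dx × Fin dφ → Set Ω := fun p =>
    {ω | ε₁ ≤ |(1 / (N : ℝ)) * ∑ t, scoreEntry φ Θs p.1 p.2 (W t ω, y t ω)|}
  set F2 : (Fin dφ × Fin dx) × (Fin dφ × Fin dx) → Set Ω := fun p =>
    {ω | ε₂ ≤ |(1 / (N : ℝ)) * ∑ t, momentEntry φ P p.1 p.2 (W t ω)|}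
  have hsub : (goodEvent P φ Θs W y R ε₁ ε₂)ᶜ ⊆ F0 ∪ ((⋃ p, F1 p) ∪ ⋃ p, F2 p) := by
    intro ω hω
    by_contra hc
    simp only [Set.mem_union, not_or, Set.mem_iUnion, not_exists] at hc
    exact hω ⟨not_not.1 hc.1, fun i j => not_le.1 (hc.2.1 (i, j)),
      fun p q => not_le.1 (hc.2.2 (p, q))⟩
  have hF0 : μ F0 = 0 := ae_all_iff.2 hRt
  have hF1 : ∀ p, μ (F1 p) ≤ ENNReal.ofReal (2 * η) := by
    intro p
    refine (measure_le_abs_average_le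
      (X := fun t ω => scoreEntry φ Θs p.1 p.2 (W t ω, y t ω))
      (h.indep.comp (fun _ => scoreEntry φ Θs p.1 p.2) fun _ => measurable_scoreEntry hφ _ _)
      (fun t => (measurable_scoreEntry hφ _ _).comp
        ((h.measurable_query t).prodMk (h.measurable_label t))) hR0
      (fun t => (hRt t).mono fun ω hω => abs_scoreEntry_le _ _ hω)
      (fun t => h.integral_scoreEntry hφ hR _ _ t) hN hε₁).trans ?_
    gcongr
  have hF2 : ∀ p, μ (F2 p) ≤ ENNReal.ofReal (2 * η) := by
    intro p
    have hm : Measurable (momentEntry φ P p.1 p.2) :=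
      (measurable_featureVec_mul hφ p.1 p.2).sub_const _
    refine (measure_le_abs_average_le (X := fun t ω => momentEntry φ P p.1 p.2 (W t ω))
      (h.indep.comp (fun _ q => momentEntry φ P p.1 p.2 q.1) fun _ => hm.comp measurable_fst)
      (fun t => hm.comp (h.measurable_query t)) (b := 2 * R ^ 2) (by positivity)
      (fun t => (hRt t).mono fun ω hω => abs_momentEntry_le hR _ _ hω)
      (fun t => h.integral_momentEntry hφ hR _ _ t) hN hε₂).trans ?_
    gcongr
  have hD0 : 0 ≤ (dx : ℝ) * dφ := by positivity
  have hsum1 : ∑ p, μ (F1 p) ≤ ENNReal.ofReal (D ^ 2 * (2 * η)) := by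
    refine (Finset.sum_le_sum fun p _ => hF1 p).trans ?_
    rw [Finset.sum_const, Finset.card_univ, Fintype.card_prod, Fintype.card_fin, Fintype.card_fin,
      nsmul_eq_mul, ← ENNReal.ofReal_natCast, ← ENNReal.ofReal_mul (by positivity)]
    gcongr
    push_cast
    nlinarith
  have hsum2 : ∑ p, μ (F2 p) ≤ ENNReal.ofReal (D ^ 2 * (2 * η)) := by
    refine (Finset.sum_le_sum fun p _ => hF2 p).trans ?_
    rw [Finset.sum_const, Finset.card_univ, Fintype.card_prod, Fintype.card_prod, Fintype.card_fin,
      Fintype.card_fin, nsmul_eq_mul, ← ENNReal.ofReal_natCast,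
      ← ENNReal.ofReal_mul (by positivity)]
    gcongr
    push_cast
    nlinarith
  calc _ ≤ μ (F0 ∪ ((⋃ p, F1 p) ∪ ⋃ p, F2 p)) := measure_mono hsub
    _ ≤ μ F0 + (μ (⋃ p, F1 p) + μ (⋃ p, F2 p)) :=
        (measure_union_le _ _).trans (by gcongr; exact measure_union_le _ _)
    _ ≤ 0 + (∑ p, μ (F1 p) + ∑ p, μ (F2 p)) := by
        gcongr
        · exact hF0.le
        · exact measure_iUnion_fintype_le _ _
        · exact measure_iUnion_fintype_le _ _
    _ ≤ 0 + (ENNReal.ofReal (D ^ 2 * (2 * η)) + ENNReal.ofReal (D ^ 2 * (2 * η))) := by gcongr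
    _ = _ := by
        rw [zero_add, ← ENNReal.ofReal_add (by positivity) (by positivity)]
        congr 1
        ring

theorem IsBTLData.le_measure_goodEvent [IsProbabilityMeasure μ] [IsProbabilityMeasure P]
    (h : IsBTLData μ P φ Θs W y) (hφ : Measurable (Function.uncurry φ)) (hR0 : 0 < R)
    (hR : ∀ᵐ w ∂P, ‖featureMat φ w‖ ≤ R) (hN : 0 < N) {ε₁ ε₂ D δ : ℝ} (hδ : 0 < δ)
    (hε₁ : 0 ≤ ε₁) (hε₂ : 0 ≤ ε₂) (hD : (dx : ℝ) * dφ ≤ D) (hD1 : 1 ≤ D)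
    (h₁ : Real.log (4 * D ^ 2 / δ) ≤ N * ε₁ ^ 2 / (2 * R ^ 2))
    (h₂ : Real.log (4 * D ^ 2 / δ) ≤ N * ε₂ ^ 2 / (2 * (2 * R ^ 2) ^ 2)) :
    ENNReal.ofReal (1 - δ) ≤ μ (goodEvent P φ Θs W y R ε₁ ε₂) := by
  have hq : 0 < 4 * D ^ 2 / δ := by positivity
  have hexp : ∀ {x : ℝ}, Real.log (4 * D ^ 2 / δ) ≤ x → Real.exp (-x) ≤ δ / (4 * D ^ 2) := by
    intro x hx
    refine (Real.exp_le_exp.2 (neg_le_neg hx)).trans (le_of_eq ?_)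
    rw [Real.exp_neg, Real.exp_log hq, inv_div]
  have h3 := h.measure_goodEvent_compl_le hφ hR0 hR hN hε₁ hε₂ hD hD1 (hexp h₁) (hexp h₂)
  have e1 : 4 * D ^ 2 * (δ / (4 * D ^ 2)) = δ := by field_simp
  rw [e1] at h3
  have hm := h.measurableSet_goodEvent (R := R) hφ ε₁ ε₂
  rw [ENNReal.ofReal_sub _ hδ.le, ENNReal.ofReal_one]
  refine tsub_le_iff_right.2 ?_
  rw [← prob_add_prob_compl (μ := μ) hm]
  gcongr

end Model

/-! ### From the good event to the local regime. -/

section Estimation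

theorem IsSVD.hasThinSVD {m n r : ℕ} {M : Matrix (Fin m) (Fin n) ℝ} {U s V}
    (h : IsSVD M U s V) (hr : M.rank = r) : HasThinSVD M r (s (r - 1)) (s 0) := by
  obtain ⟨Ur, Vr, hU, hV, hM⟩ := h.exists_thin hr
  exact ⟨Ur, Vr, fun i => s i, hU, hV, hM, fun i =>
    ⟨h.antitone (Nat.le_sub_one_of_lt i.2), h.antitone (Nat.zero_le _)⟩⟩

theorem IsSVD.singularValue_zero_le {m n : ℕ} {M : Matrix (Fin m) (Fin n) ℝ} {U s V}
    (h : IsSVD M U s V) : s 0 ≤ ‖M‖ := by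
  simpa using h.singularValue_le (N := 0) (r := 0) (by simp)

/-- On the good event, factored gradient descent on the negative log-likelihood is in its local
regime. -/
theorem localRegime_of_mem_goodEvent {dx dφ r N : ℕ} {S A Ω : Type*} [MeasurableSpace S]
    [MeasurableSpace A] {P : Measure (Query dx S A)} {φ : S → A → EuclideanSpace ℝ (Fin dφ)}
    {Θs : Matrix (Fin dx) (Fin dφ) ℝ} {W : Fin N → Ω → Query dx S A} {y : Fin N → Ω → Bool}
    {R B lam α D ρ σ τ ε₁ ε₂ : ℝ} {ω : Ω} (hω : ω ∈ goodEvent P φ Θs W y R ε₁ ε₂) (hN : 0 < N)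
    (hB : ∀ Θ, ‖Θ - Θs‖ ≤ 1 → ‖Θ‖ ≤ B)
    (hS : (secondMoment φ P -
      lam • (1 : Matrix (Fin dφ × Fin dx) (Fin dφ × Fin dx) ℝ)).PosSemidef)
    (hthin : HasThinSVD Θs r σ τ) (hσ : 0 < σ) (hστ : σ ≤ τ) (hσB : σ ≤ B)
    (hα : 0 < α) (hα4 : α ≤ 1 / 4)
    (hαγ : α ≤ Real.sigmoid (R * B) * (1 - Real.sigmoid (R * B)) * (lam / 2))
    (hD : (dx : ℝ) * dφ ≤ D) (hD1 : 1 ≤ D) (hr : (r : ℝ) ≤ D)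
    (hρ : ρ = α / (4 * D * (1 + R ^ 2 / 4) * (1 + B)))
    (hε₁ : 0 ≤ ε₁) (hε₂ : 0 ≤ ε₂) (hε₂' : D * ε₂ ≤ lam / 2) (he : D * ε₁ ≤ α / 8 * (ρ * σ)) :
    LocalRegime (negLogLik φ (fun t => W t ω) fun t => y t ω)
      (logisticGrad (fun t => featureMat φ (W t ω)) fun t => ((y t ω).toNat : ℝ)) Θs r α
      (R ^ 2 / 4) D σ τ ρ (D * ε₁) := by
  obtain ⟨h1, h2, h3⟩ := hω
  have hB0 : 0 < B := hσ.trans_le hσB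
  have hβ : 0 ≤ R ^ 2 / 4 := by positivity
  have hρpos : 0 < ρ := by rw [hρ]; positivity
  have hρeq : ρ * (4 * D * (1 + R ^ 2 / 4) * (1 + B)) = α := by rw [hρ]; field_simp
  -- Each factor in the denominator of ρ serves one requirement: D the bounds on dρ, 1 + R²/4 the
  -- one on dρβ, and 1 + B, through σ ≤ B, the one on ρσ.
  have hDρ : 4 * (D * ρ) * ((1 + R ^ 2 / 4) * (1 + B)) = α := by rw [← hρeq]; ring
  have hDρ0 : 0 < D * ρ := by positivity
  have hβB : 1 ≤ (1 + R ^ 2 / 4) * (1 + B) := by nlinarith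
  have hDρ16 : D * ρ ≤ 1 / 16 := by nlinarith
  refine
    { loss := ?_
      thin := hthin
      α_pos := hα
      α_le := hα4
      β_nonneg := hβ
      one_le_d := hD1
      r_le := hr
      σ_pos := hσ
      σ_le := hστ
      ρ_pos := hρpos
      ρ_le := by nlinarith
      dρ_le := by linarith
      dρβ_le := ?_
      ρσ_le := ?_
      grad_le := norm_logisticGrad_le hD hD1 hε₁ fun i j => (h2 i j).le
      e_le := he }
  · rw [negLogLik_eq_logisticLoss]
    refine logisticLoss_regular _ _ Θs hN h1 hB (c := lam / 2) ?_ hαγ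
    refine empirical_secondMoment_ge hN hS (ε := ε₂) ?_ hε₂ fun p q => (h3 p q).le
    exact (mul_le_mul_of_nonneg_right hD hε₂).trans hε₂'
  · have : D * ρ * (R ^ 2 / 4) ≤ D * ρ * ((1 + R ^ 2 / 4) * (1 + B)) := by
      gcongr; nlinarith [mul_nonneg hβ hB0.le]
    linarith
  · have e1 : ρ * σ ≤ D * ρ * ((1 + R ^ 2 / 4) * (1 + B)) := by
      calc ρ * σ ≤ (D * ρ) * B := by
            gcongr; exact le_mul_of_one_le_left hρpos.le hD1
        _ ≤ _ := by gcongr; nlinarith [mul_nonneg hβ hB0.le]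
    linarith

/-- The logarithm of the number of events in the union bound is at most a multiple of
`log (d / δ)`. -/
theorem log_div_le {D d δ : ℝ} (hD : 1 ≤ D) (hd : 2 ≤ d) (hδ : 0 < δ) (hδ1 : δ < 1) :
    0 < Real.log (d / δ) ∧
      Real.log (4 * D ^ 2 / δ) ≤ (Real.log (4 * D ^ 2) / Real.log 2 + 1) * Real.log (d / δ) := by
  have hl2 : 0 < Real.log 2 := Real.log_pos (by norm_num)
  have hlδ : Real.log δ < 0 := Real.log_neg hδ hδ1
  have hld : Real.log 2 ≤ Real.log d := Real.log_le_log (by norm_num) hd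
  have h4 : 0 ≤ Real.log (4 * D ^ 2) := Real.log_nonneg (by nlinarith)
  rw [Real.log_div (by positivity) hδ.ne', Real.log_div (by positivity) hδ.ne']
  refine ⟨by linarith, ?_⟩
  -- Since d ≥ 2 and δ < 1, log(d/δ) is at least log 2 and absorbs the constant log(4D²).
  have h5 : Real.log (4 * D ^ 2) ≤
      Real.log (4 * D ^ 2) / Real.log 2 * (Real.log d - Real.log δ) := by
    calc Real.log (4 * D ^ 2) = Real.log (4 * D ^ 2) / Real.log 2 * Real.log 2 := by field_simp
      _ ≤ _ := by gcongr; linarith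
  linarith

end Estimation

/-! ### The estimation bound: choice of constants and the two sample-size cases. -/

set_option maxHeartbeats 1000000 in
theorem mainTheorem2 (Bx Bφ Bθ lam : ℝ) (hBx : 0 < Bx) (hBφ : 0 < Bφ) (hBθ : 0 < Bθ)
    (hlam : 0 < lam) :
    ∃ c₁bar κ C₀ C₁ : ℝ, 0 < c₁bar ∧ 0 < κ ∧ 0 < C₀ ∧ 0 < C₁ ∧
      ∀ (dx dφ r N₀ : ℕ) (S A Ω : Type*) [MeasurableSpace S] [MeasurableSpace A]
        [MeasurableSpace Ω] (μ : Measure Ω) [IsProbabilityMeasure μ]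
        (P : Measure (Query dx S A)) [IsProbabilityMeasure P]
        (φ : S → A → EuclideanSpace ℝ (Fin dφ)) (Θs : Matrix (Fin dx) (Fin dφ) ℝ)
        (Us : Matrix (Fin dx) (Fin dx) ℝ) (σ : ℕ → ℝ) (Vs : Matrix (Fin dφ) (Fin dφ) ℝ)
        (W : Fin N₀ → Ω → Query dx S A) (y : Fin N₀ → Ω → Bool) (δ c₁ c₂ : ℝ),
        Measurable (Function.uncurry φ) →
        -- boundedness
        (∀ᵐ w ∂P, ‖w.1‖ ≤ Bx) →
        (∀ s a, ‖φ s a‖ ≤ Bφ) →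
        (∀ Θ : Matrix (Fin dx) (Fin dφ) ℝ, ‖Θ - Θs‖ ≤ 1 → ‖Θ‖ ≤ Bθ) →
        -- positive definite second moment, with smallest eigenvalue at least `lam`
        (secondMoment φ P - lam • (1 : Matrix (Fin dφ × Fin dx) (Fin dφ × Fin dx) ℝ)).PosSemidef →
        -- the true parameter has rank `r` and singular values `σ 0 ≥ … ≥ σ (r - 1) > 0`
        1 ≤ r → Θs.rank = r → IsSVD Θs Us σ Vs →
        -- the data
        1 ≤ N₀ → IsBTLData μ P φ Θs W y →
        0 < δ → δ < 1 →
        0 < c₁ → c₁ ≤ c₁bar →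
        0 < c₂ → c₂ ≤ κ * Real.sqrt (σ (r - 1)) →
        ∃ (K : ℕ) (E : Set Ω), MeasurableSet E ∧ ENNReal.ofReal (1 - δ) ≤ μ E ∧
          ∀ ω ∈ E, ∀ (Θ₀ : Matrix (Fin dx) (Fin dφ) ℝ) (U₀ : Matrix (Fin dx) (Fin dx) ℝ)
            (s₀ : ℕ → ℝ) (V₀ : Matrix (Fin dφ) (Fin dφ) ℝ),
            IsSVD Θ₀ U₀ s₀ V₀ →
            ‖Θ₀ - Θs‖ ≤ c₂ * Real.sqrt (σ (r - 1)) →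
            ∀ k : ℕ, K ≤ k →
              (k = K ∨ C₀ * (r * Real.log ((dx + dφ) / δ) / σ (r - 1) ^ 2) ≤ N₀) →
              ‖fgdEstimate r (negLogLik φ (fun t => W t ω) (fun t => y t ω)) (c₁ / σ 0)
                  U₀ s₀ V₀ k - Θs‖ ≤
                C₁ * Real.sqrt (σ 0 * r * Real.log ((dx + dφ) / δ) / (σ (r - 1) * N₀)) := by
  obtain ⟨R, hR⟩ : ∃ R, R = 2 * Bφ * Bx := ⟨_, rfl⟩
  have hR0 : 0 < R := by rw [hR]; positivity
  obtain ⟨γ, hγ⟩ : ∃ γ, γ = Real.sigmoid (R * Bθ) * (1 - Real.sigmoid (R * Bθ)) := ⟨_, rfl⟩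
  have hγ0 : 0 < γ := by
    rw [hγ]; exact mul_pos (Real.sigmoid_pos _) (sub_pos.2 (Real.sigmoid_lt_one _))
  obtain ⟨α, hα⟩ : ∃ α, α = min (γ * (lam / 2)) (1 / 4) := ⟨_, rfl⟩
  have hα0 : 0 < α := by rw [hα]; exact lt_min (by positivity) (by norm_num)
  have hα4 : α ≤ 1 / 4 := hα ▸ min_le_right _ _
  have hαγ : α ≤ γ * (lam / 2) := hα ▸ min_le_left _ _
  -- D will bound the number dx·dφ of parameters and, since r ≤ dx and r ≤ dφ, also the rank.
  obtain ⟨D, hD⟩ : ∃ D, D = max 1 (R ^ 2 / lam) := ⟨_, rfl⟩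
  have hD1 : 1 ≤ D := hD ▸ le_max_left _ _
  obtain ⟨ρ, hρ⟩ : ∃ ρ, ρ = α / (4 * D * (1 + R ^ 2 / 4) * (1 + Bθ)) := ⟨_, rfl⟩
  have hρ0 : 0 < ρ := by rw [hρ]; positivity
  -- The initialization radius, in units of σ_r, that `LocalRegime.fgd_error_sq_le` demands.
  obtain ⟨t, ht⟩ : ∃ t, t = α / (4 * (1 + R ^ 2 / 4)) * ρ := ⟨_, rfl⟩
  have ht0 : 0 < t := by rw [ht]; positivity
  have ht1 : t ≤ 1 := by
    rw [ht]
    have h1 : α / (4 * (1 + R ^ 2 / 4)) ≤ 1 := by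
      rw [div_le_one (by positivity)]; nlinarith [sq_nonneg R]
    have h2 : ρ ≤ 1 := by
      rw [hρ, div_le_one (by positivity)]
      have h3 : 1 ≤ D * (1 + R ^ 2 / 4) * (1 + Bθ) :=
        one_le_mul_of_one_le_of_one_le (one_le_mul_of_one_le_of_one_le hD1
          (by nlinarith [sq_nonneg R])) (by linarith)
      linarith
    exact mul_le_one₀ h1 hρ0.le h2
  obtain ⟨CD, hCD⟩ : ∃ CD, CD = Real.log (4 * D ^ 2) / Real.log 2 + 1 := ⟨_, rfl⟩
  have hCD0 : 0 < CD := by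
    have h1 : 0 ≤ Real.log (4 * D ^ 2) := Real.log_nonneg (by nlinarith)
    have h2 : 0 < Real.log 2 := Real.log_pos (by norm_num)
    rw [hCD]; positivity
  obtain ⟨ε₂, hε₂⟩ : ∃ ε₂, ε₂ = lam / 2 / D := ⟨_, rfl⟩
  have hε₂0 : 0 < ε₂ := by rw [hε₂]; positivity
  obtain ⟨Ce, hCe⟩ : ∃ Ce, Ce = D ^ 2 * (R ^ 2 * (2 * CD)) := ⟨_, rfl⟩
  have hCe0 : 0 < Ce := by rw [hCe]; positivity
  obtain ⟨Cs, hCs⟩ : ∃ Cs, Cs = CD * (2 * (2 * R ^ 2) ^ 2) / ε₂ ^ 2 := ⟨_, rfl⟩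
  have hCs0 : 0 < Cs := by rw [hCs]; positivity
  -- The first summand, through σ_r ≤ Bθ, makes the second moments accurate to ε₂; the second makes
  -- the gradient bound at most (α/8)ρσ_r.
  obtain ⟨C₀, hC₀⟩ : ∃ C₀, C₀ = Cs * Bθ ^ 2 + Ce / (α / 8 * ρ) ^ 2 := ⟨_, rfl⟩
  have hC₀0 : 0 < C₀ := by rw [hC₀]; positivity
  have hpl : 0 < plConst α (R ^ 2 / 4) := by unfold plConst; positivity
  obtain ⟨Cf, hCf⟩ : ∃ Cf, Cf = 4 / α * (plConst α (R ^ 2 / 4) + 1 + 1 / α) * Ce := ⟨_, rfl⟩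
  have hCf0 : 0 < Cf := by rw [hCf]; positivity
  -- Dividing t by 1 + D pays for truncating the initial SVD. In C₁ the term √C₀ serves small
  -- samples and √Cf large ones.
  refine ⟨1 / (6 * ((1 + R ^ 2 / 4) * (1 + 2 * D ^ 2))), t / (1 + D), C₀,
    Real.sqrt C₀ + Real.sqrt Cf, by positivity, by positivity, hC₀0, by positivity, ?_⟩
  intro dx dφ r N₀ S A Ω _ _ _ μ _ P _ φ Θs Us σ Vs W y δ c₁ c₂ hφ hx hφb hB hS hr hrank hsvd
    hN hdata hδ hδ1 hc₁ hc₁b hc₂ hc₂b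
  have hN' : 0 < N₀ := hN
  have hNr : (0 : ℝ) < N₀ := by exact_mod_cast hN'
  have hr1 : (1 : ℝ) ≤ r := by exact_mod_cast hr
  -- Indices start at 0, so this is σ_r. Positivity follows from 0 < c₂ ≤ κ√σ_r, because `Real.sqrt`
  -- vanishes on nonpositive numbers.
  have hσ : 0 < σ (r - 1) := by
    by_contra hc
    rw [Real.sqrt_eq_zero_of_nonpos (not_lt.1 hc), mul_zero] at hc₂b
    linarith
  have hστ : σ (r - 1) ≤ σ 0 := hsvd.antitone (Nat.zero_le _)
  have hσ0 : 0 < σ 0 := hσ.trans_le hστ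
  have hσB : σ (r - 1) ≤ Bθ := hστ.trans (hsvd.singularValue_zero_le.trans (hB Θs (by simp)))
  have hrx : r ≤ dx := by simpa [hrank] using Θs.rank_le_height
  have hrφ : r ≤ dφ := by simpa [hrank] using Θs.rank_le_width
  have hRae : ∀ᵐ w ∂P, ‖featureMat φ w‖ ≤ R := hx.mono fun w hw => by
    rw [hR]; exact norm_featureMat_le φ hw hφb
  have hdim : (dx : ℝ) * dφ ≤ D := by
    have := card_le_of_secondMoment hφ hRae hS
    rw [← le_div_iff₀ hlam] at this
    exact this.trans (hD ▸ le_max_right _ _)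
  have hrxr : (r : ℝ) ≤ dx := by exact_mod_cast hrx
  have hrφr : (r : ℝ) ≤ dφ := by exact_mod_cast hrφ
  have hrD : (r : ℝ) ≤ D := by nlinarith
  obtain ⟨hℓ, hlog⟩ := log_div_le (D := D) (d := (dx : ℝ) + dφ) hD1 (by linarith) hδ hδ1
  rw [← hCD] at hlog
  set ℓ := Real.log (((dx : ℝ) + dφ) / δ) with hℓdef
  have hQ : r * ℓ / N₀ ≤ σ 0 * r * ℓ / (σ (r - 1) * N₀) := by
    rw [div_le_div_iff₀ hNr (by positivity)]
    calc r * ℓ * (σ (r - 1) * N₀) ≤ r * ℓ * (σ 0 * N₀) := by gcongr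
      _ = _ := by ring
  have hinit : ∀ (Θ₀ : Matrix (Fin dx) (Fin dφ) ℝ) (U₀ : Matrix (Fin dx) (Fin dx) ℝ)
      (s₀ : ℕ → ℝ) (V₀ : Matrix (Fin dφ) (Fin dφ) ℝ), IsSVD Θ₀ U₀ s₀ V₀ →
      ‖Θ₀ - Θs‖ ≤ c₂ * Real.sqrt (σ (r - 1)) →
      ‖(U₀ * rectDiag dx r fun i => Real.sqrt (s₀ i)) *
        (V₀ * rectDiag dφ r fun i => Real.sqrt (s₀ i))ᵀ - Θs‖ ≤ t * σ (r - 1) := by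
    intro Θ₀ U₀ s₀ V₀ h₀ hd₀
    have h1 : ‖Θ₀ - Θs‖ ≤ t / (1 + D) * σ (r - 1) := by
      refine hd₀.trans ?_
      calc _ ≤ t / (1 + D) * Real.sqrt (σ (r - 1)) * Real.sqrt (σ (r - 1)) := by gcongr
        _ = _ := by rw [mul_assoc, Real.mul_self_sqrt hσ.le]
    calc _ ≤ (1 + dx * dφ) * ‖Θ₀ - Θs‖ := h₀.truncation_dist_le hrank.le
      _ ≤ (1 + D) * (t / (1 + D) * σ (r - 1)) := by gcongr
      _ = _ := by field_simp
  by_cases hlarge : C₀ * (r * ℓ / σ (r - 1) ^ 2) ≤ N₀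
  -- Chosen so that the Hoeffding exponent N₀ε₁²/(2R²) equals CD·ℓ.
  · obtain ⟨ε₁, hε₁⟩ : ∃ ε₁, ε₁ = Real.sqrt (R ^ 2 * (2 * CD) * (ℓ / N₀)) := ⟨_, rfl⟩
    have hε₁0 : 0 < ε₁ := by rw [hε₁]; positivity
    have hε₁sq : ε₁ ^ 2 = R ^ 2 * (2 * CD) * (ℓ / N₀) := by
      rw [hε₁]; exact Real.sq_sqrt (by positivity)
    have hesq : (D * ε₁) ^ 2 = Ce * (ℓ / N₀) := by rw [mul_pow, hε₁sq, hCe]; ring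
    have hlarge' : C₀ * ℓ ≤ N₀ * σ (r - 1) ^ 2 := by
      have h1 : C₀ * (ℓ / σ (r - 1) ^ 2) ≤ N₀ := by
        refine le_trans ?_ hlarge
        gcongr
        exact le_mul_of_one_le_left hℓ.le hr1
      rwa [mul_div_assoc', div_le_iff₀ (by positivity)] at h1
    have hN1 : Cs * ℓ ≤ N₀ := by
      have h1 : Cs * Bθ ^ 2 * ℓ ≤ N₀ * Bθ ^ 2 := by
        calc Cs * Bθ ^ 2 * ℓ ≤ C₀ * ℓ := by
              gcongr; rw [hC₀]; exact le_add_of_nonneg_right (by positivity)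
          _ ≤ N₀ * σ (r - 1) ^ 2 := hlarge'
          _ ≤ _ := by gcongr
      refine le_of_mul_le_mul_right (a := Bθ ^ 2) ?_ (by positivity)
      linarith
    have he : D * ε₁ ≤ α / 8 * (ρ * σ (r - 1)) := by
      refine le_of_sq_le_sq ?_ (by positivity)
      rw [hesq, mul_div_assoc', div_le_iff₀ hNr]
      have h1 : Ce / (α / 8 * ρ) ^ 2 * ℓ ≤ N₀ * σ (r - 1) ^ 2 := by
        refine le_trans ?_ hlarge'
        gcongr; rw [hC₀]; exact le_add_of_nonneg_left (by positivity)
      rw [div_mul_eq_mul_div, div_le_iff₀ (by positivity)] at h1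
      linarith
    have hc₁' : 6 * c₁ * ((1 + R ^ 2 / 4) * (1 + 2 * D ^ 2)) ≤ 1 := by
      rw [le_div_iff₀ (by positivity)] at hc₁b
      linarith
    have hD0 : 0 < D := by linarith
    have hregime : ∀ ω ∈ goodEvent P φ Θs W y R ε₁ ε₂, LocalRegime
        (negLogLik φ (fun t => W t ω) fun t => y t ω)
        (logisticGrad (fun t => featureMat φ (W t ω)) fun t => ((y t ω).toNat : ℝ)) Θs r α
        (R ^ 2 / 4) D (σ (r - 1)) (σ 0) ρ (D * ε₁) := fun ω hω =>
      localRegime_of_mem_goodEvent hω hN' hB hS (hsvd.hasThinSVD hrank) hσ hστ hσB hα0 hα4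
        (hγ ▸ hαγ) hdim hD1 hrD hρ hε₁0.le hε₂0.le
        (by rw [hε₂]; exact (mul_div_cancel₀ _ hD0.ne').le) he
    obtain ⟨q, hq⟩ : ∃ q, q = fgdRate α (R ^ 2 / 4) c₁ (σ (r - 1)) (σ 0) := ⟨_, rfl⟩
    have hprob : ENNReal.ofReal (1 - δ) ≤ μ (goodEvent P φ Θs W y R ε₁ ε₂) := by
      refine hdata.le_measure_goodEvent hφ hR0 hRae hN' hδ hε₁0.le hε₂0.le hdim hD1
        (hlog.trans (le_of_eq ?_)) (hlog.trans ?_)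
      · rw [hε₁sq]; field_simp
      · rw [le_div_iff₀ (by positivity)]
        rw [hCs, div_mul_eq_mul_div, div_le_iff₀ (by positivity)] at hN1
        linarith
    -- K must be fixed before ω, and the bounds on the rate come from a local regime. Positive
    -- probability supplies one sample point in that regime; the rate itself does not depend on it.
    obtain ⟨ω₀, hω₀⟩ : (goodEvent P φ Θs W y R ε₁ ε₂).Nonempty := by
      by_contra hne
      rw [Set.not_nonempty_iff_eq_empty.1 hne, measure_empty, nonpos_iff_eq_zero,
        ENNReal.ofReal_eq_zero] at hprob
      linarith
    obtain ⟨hq0, hq1⟩ := (hregime ω₀ hω₀).fgdRate_mem hc₁ hc₁'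
    rw [← hq] at hq0 hq1
    have hpos : 0 < (D * ε₁) ^ 2 / (α / 4 * (ρ * σ (r - 1)) ^ 2) := by positivity
    -- The target accuracy is the deterministic bound Dε₁ rather than the realized gradient, so K
    -- depends neither on the data nor on Θ₀.
    obtain ⟨K, hK⟩ := exists_pow_lt_of_lt_one hpos (sub_lt_self 1 hq0)
    refine ⟨K, goodEvent P φ Θs W y R ε₁ ε₂, hdata.measurableSet_goodEvent hφ _ _, hprob, ?_⟩
    intro ω hω Θ₀ U₀ s₀ V₀ h₀ hd₀ k hk _
    have hk' : (1 - q) ^ k * (α / 4 * (ρ * σ (r - 1)) ^ 2) ≤ (D * ε₁) ^ 2 := by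
      rw [← le_div_iff₀ (by positivity)]
      exact (pow_le_pow_of_le_one (by linarith) (by linarith) hk).trans hK.le
    have hmain := (hregime ω hω).fgd_error_sq_le hc₁ hc₁' (h₀.truncation_balanced hrx hrφ _)
      ((hinit Θ₀ U₀ s₀ V₀ h₀ hd₀).trans (by rw [ht, mul_assoc])) (hq ▸ hk')
    rw [hesq] at hmain
    refine (Real.le_sqrt_of_sq_le hmain).trans ?_
    have h1 : 4 / α * (plConst α (R ^ 2 / 4) + 1 + 1 / α) * (Ce * (ℓ / N₀)) ≤
        Cf * (σ 0 * r * ℓ / (σ (r - 1) * N₀)) := by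
      rw [← mul_assoc, ← hCf]
      refine mul_le_mul_of_nonneg_left (le_trans ?_ hQ) hCf0.le
      gcongr
      exact le_mul_of_one_le_left hℓ.le hr1
    refine (Real.sqrt_le_sqrt h1).trans ?_
    rw [Real.sqrt_mul hCf0.le]
    gcongr
    exact le_add_of_nonneg_left (Real.sqrt_nonneg _)
  -- Small sample: K = 0 on the whole space. Only k = 0 is claimed, and the start is within tσ_r ≤
  -- σ_r, which failure of the threshold places below the bound.
  · refine ⟨0, Set.univ, MeasurableSet.univ, ?_, ?_⟩
    · rw [measure_univ]; exact ENNReal.ofReal_le_one.2 (by linarith)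
    intro ω _ Θ₀ U₀ s₀ V₀ h₀ hd₀ k _ hk
    obtain rfl : k = 0 := hk.resolve_right hlarge
    have h1 : σ (r - 1) ^ 2 ≤ C₀ * (σ 0 * r * ℓ / (σ (r - 1) * N₀)) := by
      refine le_trans ?_ (mul_le_mul_of_nonneg_left hQ hC₀0.le)
      rw [mul_div_assoc', le_div_iff₀ hNr]
      have h2 := (not_le.1 hlarge).le
      rw [mul_div_assoc', le_div_iff₀ (by positivity)] at h2
      linarith
    calc _ ≤ t * σ (r - 1) := hinit Θ₀ U₀ s₀ V₀ h₀ hd₀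
      _ ≤ σ (r - 1) := mul_le_of_le_one_left hσ.le ht1
      _ ≤ Real.sqrt (C₀ * (σ 0 * r * ℓ / (σ (r - 1) * N₀))) := Real.le_sqrt_of_sq_le h1
      _ = Real.sqrt C₀ * Real.sqrt (σ 0 * r * ℓ / (σ (r - 1) * N₀)) := Real.sqrt_mul hC₀0.le _
      _ ≤ _ := by
        gcongr
        exact le_add_of_nonneg_right (Real.sqrt_nonneg _)
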